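/- Let $2\le p\le\infty$. Let $\phi:\mathbb R\to(0,\infty)$ be locally absolutely continuous with $|\phi'(x)|\le A|\phi(x)|$ for almost every $x$, for some $A>0$. Let $v:\mathbb R\to\mathbb R$ be sub-multiplicative, i.e. $v(x+y)\le v(x)v(y)$ for all $x,y\in\mathbb R$, with $\inf v>0$ and $v\,e^{-|\cdot|}\in L_p(\mathbb R)$, and let $\phi$ be $v$-moderate, i.e. there is a constant $c>0$ with $\phi(x+y)\le c\,v(x)\phi(y)$ for all $x,y\in\mathbb R$. Let $s>3$, $0<T<\infty$, and let $$z=(u,\rho)\in C([0,T);H^s(\mathbb R)\times H^{s-1}(\mathbb R))\cap C^1([0,T);H^{s-1}(\mathbb R)\times H^{s-2}(\mathbb R))$$ be the strong solution of the two-component Camassa--Holm system $$u_t-u_{txx}=uu_{xxx}+2u_xu_{xx}-3uu_x-\rho\rho_x,\qquad \rho_t=-(\rho u)_x,$$ starting from $z(0)=(u_0,\rho_0)$, and suppose that $$M:=\sup_{t\in[0,T)}\big(\|u(t)\|_\infty+\|u_x(t)\|_\infty+\|u_{xx}(t)\|_\infty+\|\rho(t)\|_\infty+\|\rho_x(t)\|_\infty\big)<\infty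 .$$ Assume that $\phi u_0,\ \phi u_{0x},\ \phi u_{0xx},\ \phi\rho_0,\ \phi\rho_{0x}\in L_p(\mathbb R)$ and $\phi^{1/2}u_0,\ \phi^{1/2}u_{0x},\ \phi^{1/2}u_{0xx},\ \phi^{1/2}\rho_0,\ \phi^{1/2}\rho_{0x}\in L_2(\mathbb R)$. Then $$\sup_{t\in[0,T)}\big(\|\phi u(t)\|_p+\|\phi u_x(t)\|_p+\|\phi u_{xx}(t)\|_p+\|\phi\rho(t)\|_p+\|\phi\rho_x(t)\|_p\big)<\infty$$ and $$\sup_{t\in[0,T)}\big(\|\phi^{1/2}u(t)\|_2+\|\phi^{1/2}u_x(t)\|_2+\|\phi^{1/2}u_{xx}(t)\|_2+\|\phi^{1/2}\rho(t)\|_2+\|\phi^{1/2}\rho_x(t)\|_2\big)<\infty .$$ -/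

import Mathlib

open MeasureTheory Set Filter Topology
open scoped ENNReal FourierTransform ContDiff

noncomputable section

namespace TwoCH

/-- `g` is the weak (distributional) derivative of `f` on the real line. -/
def IsWeakDeriv (f g : ℝ → ℝ) : Prop :=
  LocallyIntegrable f volume ∧ LocallyIntegrable g volume ∧
    ∀ ψ : ℝ → ℝ, ContDiff ℝ ∞ ψ → HasCompactSupport ψ →
      ∫ x, f x * deriv ψ x = -∫ x, g x * ψ x

open Classical in
/-- The weak derivative of `f` (determined almost everywhere); the value `0` is used if `f` has
no weak derivative. -/
def weakDeriv (f : ℝ → ℝ) : ℝ → ℝ :=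
  if h : ∃ g, IsWeakDeriv f g then h.choose else 0

open Classical in
/-- The norm of the Sobolev space `H^s` of real-valued functions on the line, for `s ≥ 0`, with
values in `[0, ∞]`: the square root of `∫ |𝓕 f (ξ)|² (1 + (2πξ)²)^s dξ`, where `𝓕` is the
Fourier transform on `L²`, and `∞` if `f` is not in `L²`. Since
`𝓕 f (ξ) = ∫ f(x) exp(-2πixξ) dx`, the angular frequency is `2πξ`. -/
def sobolevENorm (s : ℝ) (f : ℝ → ℝ) : ℝ≥0∞ :=
  if h : MemLp (fun x => (f x : ℂ)) 2 (volume : Measure ℝ) then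
    (∫⁻ ξ : ℝ, ‖(𝓕 (h.toLp (fun x => (f x : ℂ))) : Lp ℂ 2 (volume : Measure ℝ)) ξ‖ₑ ^ 2 *
      ENNReal.ofReal ((1 + (2 * Real.pi * ξ) ^ 2) ^ s)) ^ (1 / 2 : ℝ)
  else ⊤

/-- Membership in the Sobolev space `H^s`, for `s ≥ 0`. -/
def MemH (s : ℝ) (f : ℝ → ℝ) : Prop := sobolevENorm s f < ⊤

/-- `w ∈ C(I, H^s)`, where `w t` is the function of the space variable at time `t`. -/
def ContInH (s : ℝ) (I : Set ℝ) (w : ℝ → ℝ → ℝ) : Prop :=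
  (∀ t ∈ I, MemH s (w t)) ∧
    ∀ t ∈ I, Tendsto (fun τ => sobolevENorm s (w τ - w t)) (𝓝[I] t) (𝓝 0)

/-- `w` is differentiable on `I` as a map into `H^s`, with derivative `wt`. -/
def HasTimeDerivInH (s : ℝ) (I : Set ℝ) (w wt : ℝ → ℝ → ℝ) : Prop :=
  ∀ t ∈ I, Tendsto (fun τ => sobolevENorm s ((τ - t)⁻¹ • (w τ - w t) - wt t))
    (𝓝[I \ {t}] t) (𝓝 0)

/-- `(u, ρ)` is a strong solution on `[0, T)` of the two-component Camassa-Holm system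
`u_t - u_txx = u u_xxx + 2 u_x u_xx - 3 u u_x - ρ ρ_x`, `ρ_t = -(ρ u)_x`
with initial value `(u₀, ρ₀)`, in the class
`C([0,T), H^s × H^(s-1)) ∩ C¹([0,T), H^(s-1) × H^(s-2))`. For `s > 3` all terms of the system
are functions in `L²`. -/
structure IsStrongSolution (s T : ℝ) (u₀ ρ₀ : ℝ → ℝ) (u ρ : ℝ → ℝ → ℝ) : Prop where
  init_u : u 0 = u₀
  init_rho : ρ 0 = ρ₀
  cont_u : ContInH s (Ico 0 T) u
  cont_rho : ContInH (s - 1) (Ico 0 T) ρ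
  eqn : ∃ ut ρt : ℝ → ℝ → ℝ,
    ContInH (s - 1) (Ico 0 T) ut ∧ HasTimeDerivInH (s - 1) (Ico 0 T) u ut ∧
    ContInH (s - 2) (Ico 0 T) ρt ∧ HasTimeDerivInH (s - 2) (Ico 0 T) ρ ρt ∧
    ∀ t ∈ Ico 0 T,
      (∀ᵐ x : ℝ, ut t x - weakDeriv (weakDeriv (ut t)) x =
        u t x * weakDeriv (weakDeriv (weakDeriv (u t))) x
          + 2 * weakDeriv (u t) x * weakDeriv (weakDeriv (u t)) x
          - 3 * u t x * weakDeriv (u t) x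
          - ρ t x * weakDeriv (ρ t) x) ∧
      (∀ᵐ x : ℝ, ρt t x = -weakDeriv (fun y => ρ t y * u t y) x)

/-- `v` is sub-multiplicative. -/
def IsSubmultiplicative (v : ℝ → ℝ) : Prop := ∀ x y, v (x + y) ≤ v x * v y

/-- `φ` is `v`-moderate. -/
def IsModerate (v φ : ℝ → ℝ) : Prop := ∃ c > 0, ∀ x y, φ (x + y) ≤ c * v x * φ y

/-- `φ` is locally absolutely continuous on the line. -/
def LocallyAC (φ : ℝ → ℝ) : Prop := ∀ a b, AbsolutelyContinuousOnInterval φ a b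

/-- The functions `w f, w f_x, w f_xx, w r, w r_x` all lie in `L_p`. -/
def WeightedMemLp (p : ℝ≥0∞) (w f r : ℝ → ℝ) : Prop :=
  MemLp (fun x => w x * f x) p volume ∧
  MemLp (fun x => w x * weakDeriv f x) p volume ∧
  MemLp (fun x => w x * weakDeriv (weakDeriv f) x) p volume ∧
  MemLp (fun x => w x * r x) p volume ∧
  MemLp (fun x => w x * weakDeriv r x) p volume

/-- `‖w f‖_p + ‖w f_x‖_p + ‖w f_xx‖_p + ‖w r‖_p + ‖w r_x‖_p`, with values in `[0, ∞]`. -/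
def weightedNorm (p : ℝ≥0∞) (w f r : ℝ → ℝ) : ℝ≥0∞ :=
  eLpNorm (fun x => w x * f x) p volume
    + eLpNorm (fun x => w x * weakDeriv f x) p volume
    + eLpNorm (fun x => w x * weakDeriv (weakDeriv f) x) p volume
    + eLpNorm (fun x => w x * r x) p volume
    + eLpNorm (fun x => w x * weakDeriv r x) p volume

end TwoCH

end

/-!
Write `F = u² + u_x² / 2 + ρ² / 2`. Inverting `1 - ∂ₓ²` turns the system into transport equations
along the velocity field `u`,

  `u_t + u u_x = W`,  `u_xt + u u_xx = V + F - u_x²`,  `ρ_t + u ρ_x = - u_x ρ`,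

where `V'' - V = F` and `W = V'`. All of `u, u_x, u_xx, ρ, ρ_x` are bounded by `M`, so the velocity
field is bounded and Lipschitz: characteristics exist, move by at most `M T`, and distort lengths by at
most `exp (M T)`. Let `a = |u| + |u_x| + |u_xx| + |ρ| + |ρ_x|`. Integrating along characteristics (for
the space derivatives `u_xx` and `ρ_x`, through difference quotients along neighbouring
characteristics) and using Grönwall's inequality gives the pointwise transport estimate

  `a(t, z) ≤ C (a(0, X_t z) + ∫₀ᵗ ∫ exp (-|z - y|) a(σ, y)² dy dσ)`,

in `IsClassicalSolution.exists_transport_estimate`. It holds since `|V|, |W| ≤ exp (-|·|) * F` and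
`F ≤ a²`. The weighted bounds follow from this estimate alone.

* Weight `φ ^ (1 / 2)` in `L²` (`exists_lintegral_weight_mul_sq_le`). A moderate weight satisfies
  `√(φ z) exp (-|z - y|) ≤ k (z - y) √(φ y)` with `k = √(c v) exp (-|·|)`, up to a factor that absorbs
  a truncation of `φ`; the kernel `k` is integrable because `v exp (-|·|) ∈ L_p`. As one factor of
  `a²` is bounded, Young's inequality and Grönwall's inequality close the estimate. Truncated weights
  make the norms finite beforehand, and the bounds are uniform in the truncation.
* Weight `φ` in `L_p` (`exists_eLpNorm_weight_mul_le`). Now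
  `φ z exp (-|z - y|) a² ≤ (c v exp (-|·|))(z - y) (φ a²)(y)`, where the first factor is in `L_p` and
  the second one in `L₁` by the previous bound, so that Young's inequality suffices.

The condition `|φ'| ≤ A φ` makes `φ` comparable at `z` and at the foot `X_t z` of the characteristic.

The remaining task is to pass from strong solutions with values in Sobolev spaces to classical ones,
`IsStrongSolution.isClassicalSolution`. On the Fourier side, a function in `H^s`, `s ≥ 1`, has a weak
derivative in `H^(s-1)`; by the lemma of du Bois-Reymond and the one-dimensional Sobolev inequality it
has a continuous representative, bounded by its norm, so that continuity and differentiability in time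
hold pointwise. As `s > 3`, this applies to every function in the transport equations, and the
momentum equation, integrated once in space, identifies `V` and `W`.
-/

namespace TwoCH

/-! ### Young's inequality and Gronwall's inequality for lower Lebesgue integrals -/

/-- Young's convolution inequality `L^p * L^1 ⊆ L^p` for functions with values in `[0, ∞]`. -/
theorem eLpNorm_convolution_le {p : ℝ≥0∞} (hp : 1 ≤ p) {f h : ℝ → ℝ≥0∞}
    (hf : AEMeasurable f volume) (hh : AEMeasurable h volume) :
    eLpNorm (fun z => ∫⁻ y, f (z - y) * h y) p volume ≤ eLpNorm f p volume * ∫⁻ y, h y := by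
  have hshift : ∀ z : ℝ, AEMeasurable (fun y => f (z - y)) volume := fun z =>
    hf.comp_quasiMeasurePreserving (quasiMeasurePreserving_sub_left volume z)
  rcases eq_or_ne p ⊤ with rfl | hptop
  · rw [eLpNorm_exponent_top, eLpNorm_exponent_top]
    refine eLpNormEssSup_le_of_ae_enorm_bound (ae_of_all _ fun z => ?_)
    rw [enorm_eq_self, ← lintegral_const_mul'' _ hh]
    refine lintegral_mono_ae ?_
    have h1 : ∀ᵐ y : ℝ, f y ≤ eLpNormEssSup f volume := by
      simpa using ae_le_eLpNormEssSup (f := f) (μ := (volume : Measure ℝ))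
    filter_upwards [(quasiMeasurePreserving_sub_left (volume : Measure ℝ) z).ae h1] with y hy
    gcongr
  · have hp0 : p ≠ 0 := (zero_lt_one.trans_le hp).ne'
    have hpos : 0 < p.toReal := ENNReal.toReal_pos hp0 hptop
    have hp1 : 1 ≤ p.toReal := by simpa using ENNReal.toReal_mono hptop hp
    set H := ∫⁻ y, h y with hH
    -- Jensen's inequality for the measure with density `h`.
    have key : ∀ z : ℝ, (∫⁻ y, f (z - y) * h y) ^ p.toReal ≤
        (∫⁻ y, f (z - y) ^ p.toReal * h y) * H ^ (p.toReal - 1) := by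
      intro z
      have h2 := eLpNorm_le_eLpNorm_mul_rpow_measure_univ (μ := volume.withDensity h)
        (f := fun y => f (z - y)) hp ((hshift z).mono_ac
          (withDensity_absolutelyContinuous _ _)).aestronglyMeasurable
      rw [eLpNorm_one_eq_lintegral_enorm, eLpNorm_eq_lintegral_rpow_enorm_toReal hp0 hptop,
        withDensity_apply _ MeasurableSet.univ, Measure.restrict_univ] at h2
      simp only [enorm_eq_self, ENNReal.toReal_one, div_one] at h2
      rw [lintegral_withDensity_eq_lintegral_mul₀ hh (hshift z),
        lintegral_withDensity_eq_lintegral_mul₀ hh ((hshift z).pow_const _)] at h2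
      have h3 := ENNReal.rpow_le_rpow h2 hpos.le
      rw [ENNReal.mul_rpow_of_nonneg _ _ hpos.le, ← ENNReal.rpow_mul, ← ENNReal.rpow_mul] at h3
      have e1 : 1 / p.toReal * p.toReal = 1 := by field_simp
      have e2 : (1 - 1 / p.toReal) * p.toReal = p.toReal - 1 := by field_simp
      rw [e1, e2, ENNReal.rpow_one] at h3
      simpa only [Pi.mul_apply, mul_comm (h _)] using h3
    rw [eLpNorm_eq_lintegral_rpow_enorm_toReal hp0 hptop,
      eLpNorm_eq_lintegral_rpow_enorm_toReal hp0 hptop]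
    simp only [enorm_eq_self]
    have hjoint : AEMeasurable (Function.uncurry fun z y : ℝ => f (z - y) ^ p.toReal * h y)
        (volume.prod volume) := by
      refine AEMeasurable.mul ?_ hh.comp_snd
      exact (hf.comp_quasiMeasurePreserving (quasiMeasurePreserving_sub volume volume)).pow_const _
    have h4 : ∫⁻ z, (∫⁻ y, f (z - y) * h y) ^ p.toReal ≤
        (∫⁻ z, f z ^ p.toReal) * H ^ p.toReal := by
      calc ∫⁻ z, (∫⁻ y, f (z - y) * h y) ^ p.toReal
          ≤ ∫⁻ z, (∫⁻ y, f (z - y) ^ p.toReal * h y) * H ^ (p.toReal - 1) := lintegral_mono key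
        _ = (∫⁻ z, ∫⁻ y, f (z - y) ^ p.toReal * h y) * H ^ (p.toReal - 1) :=
            lintegral_mul_const'' _ hjoint.lintegral_prod_right'
        _ = (∫⁻ y, ∫⁻ z, f (z - y) ^ p.toReal * h y) * H ^ (p.toReal - 1) := by
            rw [lintegral_lintegral_swap hjoint]
        _ = (∫⁻ y, (∫⁻ z, f z ^ p.toReal) * h y) * H ^ (p.toReal - 1) := by
            congr 1
            refine lintegral_congr fun y => ?_
            rw [lintegral_mul_const'', lintegral_sub_right_eq_self (fun z => f z ^ p.toReal)]
            exact (hf.comp_quasiMeasurePreserving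
              (measurePreserving_sub_right volume y).quasiMeasurePreserving).pow_const _
        _ = (∫⁻ z, f z ^ p.toReal) * (H * H ^ (p.toReal - 1)) := by
            rw [lintegral_const_mul'' _ hh, mul_assoc]
        _ = (∫⁻ z, f z ^ p.toReal) * H ^ p.toReal := by
            congr 1
            nth_rewrite 1 [← ENNReal.rpow_one H]
            rw [← ENNReal.rpow_add_of_nonneg _ _ zero_le_one (by linarith)]
            congr 1; ring
    calc (∫⁻ z, (∫⁻ y, f (z - y) * h y) ^ p.toReal) ^ (1 / p.toReal)
        ≤ ((∫⁻ z, f z ^ p.toReal) * H ^ p.toReal) ^ (1 / p.toReal) := by gcongr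
      _ = _ := by
          rw [ENNReal.mul_rpow_of_nonneg _ _ (by positivity), ← ENNReal.rpow_mul]
          congr 1
          rw [show p.toReal * (1 / p.toReal) = 1 by field_simp, ENNReal.rpow_one]

theorem eLpNorm_const_mul_le {p c : ℝ≥0∞} (hc : c ≠ ⊤) (f : ℝ → ℝ≥0∞) :
    eLpNorm (fun x => c * f x) p volume ≤ c * eLpNorm f p volume := by
  lift c to NNReal using hc
  have := eLpNorm_le_nnreal_smul_eLpNorm_of_ae_le_mul' (μ := (volume : Measure ℝ))
    (f := fun x => (c : ℝ≥0∞) * f x) (g := f) (c := c) (ae_of_all _ fun x => by simp) p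
  simpa [ENNReal.smul_def] using this

/-- The square of the `L²` norm, as a Lebesgue integral. -/
theorem lintegral_sq_eq_eLpNorm_sq (f : ℝ → ℝ≥0∞) :
    ∫⁻ x, f x ^ 2 = eLpNorm f 2 volume ^ 2 := by
  rw [eLpNorm_eq_lintegral_rpow_enorm_toReal two_ne_zero ENNReal.ofNat_ne_top]
  simp only [enorm_eq_self, ENNReal.toReal_ofNat, ENNReal.rpow_ofNat]
  rw [← ENNReal.rpow_natCast, ← ENNReal.rpow_mul]
  norm_num

/-- Composition with a map that distorts Lebesgue measure by a bounded factor is bounded on `L^p`,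
`1 ≤ p ≤ ∞`. -/
theorem eLpNorm_comp_le_of_map_le {p K : ℝ≥0∞} (hp : 1 ≤ p) (hK1 : 1 ≤ K) {X : ℝ → ℝ}
    (hX : Measurable X) (hmap : Measure.map X volume ≤ K • volume) {f : ℝ → ℝ≥0∞}
    (hf : Measurable f) :
    eLpNorm (fun z => f (X z)) p volume ≤ K * eLpNorm f p volume := by
  rcases eq_or_ne p ⊤ with rfl | hptop
  · have h1 : ∀ᵐ y : ℝ, f y ≤ eLpNormEssSup f volume := by
      simpa using ae_le_eLpNormEssSup (f := f) (μ := (volume : Measure ℝ))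
    have h2 : ∀ᵐ z : ℝ, f (X z) ≤ eLpNormEssSup f volume := by
      have h3 : ∀ᵐ y ∂(Measure.map X volume), f y ≤ eLpNormEssSup f volume :=
        (Measure.absolutelyContinuous_of_le hmap).ae_le
          ((Measure.smul_absolutelyContinuous).ae_le h1)
      exact ae_of_ae_map hX.aemeasurable h3
    rw [eLpNorm_exponent_top, eLpNorm_exponent_top]
    calc _ ≤ eLpNormEssSup f volume := eLpNormEssSup_le_of_ae_enorm_bound (by simpa using h2)
      _ ≤ _ := le_mul_of_one_le_left' hK1
  · have hp0 : p ≠ 0 := (zero_lt_one.trans_le hp).ne'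
    have hpos : 0 < p.toReal := ENNReal.toReal_pos hp0 hptop
    have hp1 : 1 ≤ p.toReal := by simpa using ENNReal.toReal_mono hptop hp
    rw [eLpNorm_eq_lintegral_rpow_enorm_toReal hp0 hptop,
      eLpNorm_eq_lintegral_rpow_enorm_toReal hp0 hptop]
    simp only [enorm_eq_self]
    have h1 : ∫⁻ z, f (X z) ^ p.toReal ≤ K * ∫⁻ z, f z ^ p.toReal := by
      rw [← lintegral_map (f := fun z => f z ^ p.toReal) (hf.pow_const _) hX]
      refine (lintegral_mono' hmap le_rfl).trans ?_
      rw [lintegral_smul_measure, smul_eq_mul]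
    calc _ ≤ (K * ∫⁻ z, f z ^ p.toReal) ^ (1 / p.toReal) := by gcongr
      _ = K ^ (1 / p.toReal) * (∫⁻ z, f z ^ p.toReal) ^ (1 / p.toReal) :=
          ENNReal.mul_rpow_of_nonneg _ _ (by positivity)
      _ ≤ _ := by
          gcongr
          calc K ^ (1 / p.toReal) ≤ K ^ (1 : ℝ) :=
                ENNReal.rpow_le_rpow_of_exponent_le hK1 (by rw [div_le_one hpos]; exact hp1)
            _ = K := ENNReal.rpow_one K

/-- Grönwall's inequality in integral form, for bounded `[0, ∞]`-valued functions of which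
measurability is not required: the supremum `S` of `exp (-2 b t) I t` satisfies
`S ≤ A + S / 2`. -/
theorem gronwall_lintegral {T A : ℝ} {b : NNReal} (hb : 0 < b) {I : ℝ → ℝ≥0∞} {B : ℝ≥0∞}
    (hB : B ≠ ⊤) (hA : 0 ≤ A) (hI : ∀ t ∈ Ico 0 T, I t ≤ B)
    (h : ∀ t ∈ Ico 0 T, I t ≤ ENNReal.ofReal A + b * ∫⁻ σ in Ioo 0 t, I σ) :
    ∀ t ∈ Ico 0 T, I t ≤ ENNReal.ofReal (2 * A * Real.exp (2 * b * T)) := by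
  set S : ℝ≥0∞ := ⨆ t ∈ Ico 0 T, ENNReal.ofReal (Real.exp (-(2 * b * t))) * I t with hS
  have hSB : S ≤ B := by
    refine iSup₂_le fun t ht => ?_
    calc _ ≤ 1 * B := by
          gcongr
          · rw [ENNReal.ofReal_le_one, Real.exp_le_one_iff]
            have := ht.1
            have : 0 ≤ 2 * (b : ℝ) * t := by positivity
            linarith
          · exact hI t ht
      _ = B := one_mul B
  have hStop : S ≠ ⊤ := (hSB.trans_lt hB.lt_top).ne
  have hIS : ∀ t ∈ Ico 0 T, I t ≤ ENNReal.ofReal (Real.exp (2 * b * t)) * S := by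
    intro t ht
    calc I t = ENNReal.ofReal (Real.exp (2 * b * t)) *
          (ENNReal.ofReal (Real.exp (-(2 * b * t))) * I t) := by
          rw [← mul_assoc, ← ENNReal.ofReal_mul (Real.exp_nonneg _), ← Real.exp_add]
          simp
      _ ≤ _ := by
          gcongr
          exact le_iSup₂ (f := fun t (_ : t ∈ Ico 0 T) =>
            ENNReal.ofReal (Real.exp (-(2 * b * t))) * I t) t ht
  have hint : ∀ t ∈ Ico 0 T, ENNReal.ofReal (Real.exp (-(2 * b * t))) * (b * ∫⁻ σ in Ioo 0 t, I σ)
      ≤ ENNReal.ofReal (1 / 2) * S := by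
    intro t ht
    have e0 : ∫⁻ σ in Ioo 0 t, ENNReal.ofReal (Real.exp (2 * b * σ)) ≤
        ENNReal.ofReal (Real.exp (2 * b * t) / (2 * b)) := by
      rw [← ofReal_integral_eq_lintegral_ofReal]
      · refine ENNReal.ofReal_le_ofReal ?_
        rw [← integral_Ioc_eq_integral_Ioo, ← intervalIntegral.integral_of_le ht.1]
        have hd : ∀ x ∈ uIcc 0 t, HasDerivAt (fun σ => Real.exp (2 * b * σ) / (2 * b))
            (Real.exp (2 * b * x)) x := by
          intro x _
          have := (((hasDerivAt_id x).const_mul (2 * (b : ℝ))).exp).div_const (2 * (b : ℝ))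
          convert! this using 1
          have : (b : ℝ) ≠ 0 := by exact_mod_cast hb.ne'
          simp; field_simp
        rw [intervalIntegral.integral_eq_sub_of_hasDerivAt hd
          (by apply Continuous.intervalIntegrable; fun_prop)]
        have : 0 ≤ Real.exp (2 * b * 0) / (2 * b) := by positivity
        linarith
      · exact (Continuous.integrableOn_Icc (by fun_prop)).mono_set Ioo_subset_Icc_self
      · exact ae_of_all _ fun _ => Real.exp_nonneg _
    calc ENNReal.ofReal (Real.exp (-(2 * b * t))) * (b * ∫⁻ σ in Ioo 0 t, I σ)
        ≤ ENNReal.ofReal (Real.exp (-(2 * b * t))) *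
          (b * ∫⁻ σ in Ioo 0 t, ENNReal.ofReal (Real.exp (2 * b * σ)) * S) := by
          gcongr 2
          refine setLIntegral_mono_ae' measurableSet_Ioo (ae_of_all _ fun σ hσ => ?_)
          exact hIS σ ⟨hσ.1.le, hσ.2.trans ht.2⟩
      _ ≤ ENNReal.ofReal (Real.exp (-(2 * b * t))) *
          (ENNReal.ofReal b * (ENNReal.ofReal (Real.exp (2 * b * t) / (2 * b)) * S)) := by
          rw [lintegral_mul_const' _ _ hStop, ENNReal.ofReal_coe_nnreal]
          gcongr
      _ = ENNReal.ofReal (1 / 2) * S := by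
          rw [← mul_assoc, ← mul_assoc, ← ENNReal.ofReal_mul (by positivity),
            ← ENNReal.ofReal_mul (by positivity)]
          congr 2
          have : (b : ℝ) ≠ 0 := by exact_mod_cast hb.ne'
          rw [Real.exp_neg]
          field_simp
  have hSle : S ≤ ENNReal.ofReal A + ENNReal.ofReal (1 / 2) * S := by
    refine iSup₂_le fun t ht => ?_
    calc _ ≤ ENNReal.ofReal (Real.exp (-(2 * b * t))) *
            (ENNReal.ofReal A + b * ∫⁻ σ in Ioo 0 t, I σ) := by gcongr; exact h t ht
      _ ≤ _ := by
          rw [mul_add]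
          refine add_le_add ?_ (hint t ht)
          refine mul_le_of_le_one_left' ?_
          rw [ENNReal.ofReal_le_one, Real.exp_le_one_iff]
          have := ht.1
          have : 0 ≤ 2 * (b : ℝ) * t := by positivity
          linarith
  have hS2 : S ≤ ENNReal.ofReal (2 * A) := by
    rw [← ENNReal.ofReal_toReal hStop, ← ENNReal.ofReal_mul (by norm_num),
      ← ENNReal.ofReal_add hA (by positivity)] at hSle
    rw [← ENNReal.ofReal_toReal hStop]
    refine ENNReal.ofReal_le_ofReal ?_
    have := (ENNReal.ofReal_le_ofReal_iff (by positivity)).1 hSle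
    linarith
  intro t ht
  calc I t ≤ _ := hIS t ht
    _ ≤ ENNReal.ofReal (Real.exp (2 * b * T)) * ENNReal.ofReal (2 * A) := by
        gcongr
        exact ht.2.le
    _ = _ := by
        rw [← ENNReal.ofReal_mul (by positivity)]; congr 1; ring

/-! ### The weighted square integral -/

/-- The exponential kernel `exp (-|x|)`, twice the Green function of `1 - ∂ₓ²`, with values in
`[0, ∞]`. -/
noncomputable def expKernel (x : ℝ) : ℝ≥0∞ := ENNReal.ofReal (Real.exp (-|x|))

theorem measurable_expKernel : Measurable expKernel := by
  unfold expKernel; fun_prop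

/-- The Cauchy-Schwarz inequality against the constant `1`. -/
theorem sq_lintegral_le {α : Type*} [MeasurableSpace α] (μ : Measure α) {f : α → ℝ≥0∞}
    (hf : AEMeasurable f μ) : (∫⁻ x, f x ∂μ) ^ 2 ≤ μ univ * ∫⁻ x, f x ^ 2 ∂μ := by
  have h := eLpNorm_le_eLpNorm_mul_rpow_measure_univ (μ := μ) (f := f) (p := 1) (q := 2)
    (by norm_num) hf.aestronglyMeasurable
  rw [eLpNorm_one_eq_lintegral_enorm,
    eLpNorm_eq_lintegral_rpow_enorm_toReal two_ne_zero ENNReal.ofNat_ne_top] at h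
  simp only [enorm_eq_self, ENNReal.toReal_ofNat, ENNReal.rpow_ofNat, ENNReal.toReal_one] at h
  calc (∫⁻ x, f x ∂μ) ^ 2
      ≤ ((∫⁻ x, f x ^ 2 ∂μ) ^ (1 / 2 : ℝ) * μ univ ^ (1 / 1 - 1 / 2 : ℝ)) ^ 2 := by gcongr
    _ = _ := by
      rw [mul_pow, ← ENNReal.rpow_natCast, ← ENNReal.rpow_mul, ← ENNReal.rpow_natCast,
        ← ENNReal.rpow_mul]
      norm_num
      rw [mul_comm]

theorem add_sq_le_two_mul (x y : ℝ≥0∞) : (x + y) ^ 2 ≤ 2 * (x ^ 2 + y ^ 2) := by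
  have := ENNReal.rpow_add_le_mul_rpow_add_rpow x y (p := 2) (by norm_num)
  norm_num at this
  exact this

/-- A weighted `L²` bound, uniform over square-integrable weights `w`, for a bounded function `a`
that is controlled by its initial value, transported by maps `X t`, and by the convolution of
`a ^ 2` with the exponential kernel. The constant depends on the weight only through the `L¹` norm
`J` of a kernel `k` with `w z * exp (-|z - y|) ≤ k (z - y) * w y`, the distortion `L` of `w` under
`X`, and the initial size `Q₀`. Square-integrability of `w` makes the norm finite beforehand, as
Grönwall's inequality requires. -/
theorem exists_weighted_sq_bound {T : ℝ} {a : ℝ → ℝ → ℝ≥0∞}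
    (ha : Measurable (Function.uncurry a)) {B : NNReal} (haB : ∀ t z, a t z ≤ B)
    {X : ℝ → ℝ → ℝ} (hX : ∀ t ∈ Ico 0 T, Measurable (X t)) {K : NNReal}
    (hK : 1 ≤ K) (hmap : ∀ t ∈ Ico 0 T, Measure.map (X t) volume ≤ (K : ℝ≥0∞) • volume) {C : NNReal}
    (hest : ∀ t ∈ Ico 0 T, ∀ z, a t z ≤
      C * (a 0 (X t z) + ∫⁻ σ in Ioo 0 t, ∫⁻ y, expKernel (z - y) * a σ y ^ 2))
    (L J Q₀ : NNReal) :
    ∃ Q : NNReal, ∀ (w : ℝ → ℝ≥0∞) (k : ℝ → ℝ≥0∞), Measurable w → Measurable k →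
      (∀ z, ∀ᵐ y : ℝ, w z * expKernel (z - y) ≤ k (z - y) * w y) → ∫⁻ x, k x ≤ J →
      (∀ t ∈ Ico 0 T, ∀ z, w z ≤ L * w (X t z)) → (∫⁻ x, w x ^ 2) ≠ ⊤ →
      (∫⁻ x, (w x * a 0 x) ^ 2 ≤ Q₀) →
      ∀ t ∈ Ico 0 T, ∫⁻ x, (w x * a t x) ^ 2 ≤ Q := by
  rcases le_or_gt T 0 with hT | hT
  · refine ⟨0, fun w k _ _ _ _ _ _ _ t ht => ?_⟩
    exact absurd (ht.1.trans_lt ht.2) (not_lt.2 hT)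
  lift T to NNReal using hT.le
  set b : NNReal := 2 * C ^ 2 * (T * (B ^ 2 * J ^ 2)) + 1 with hb
  set A : NNReal := 2 * C ^ 2 * (L ^ 2 * (K ^ 2 * Q₀)) with hA
  refine ⟨Real.toNNReal (2 * A * Real.exp (2 * b * T)), fun w k hw hk hwk hkJ hwL hw2 hQ => ?_⟩
  have hat : ∀ t, Measurable (a t) := fun t => ha.comp measurable_prodMk_left
  have hmeas : Measurable (Function.uncurry fun σ z => ∫⁻ y, k (z - y) * (w y * a σ y)) := by
    have h1 : Measurable fun q : (ℝ × ℝ) × ℝ => k (q.1.2 - q.2) * (w q.2 * a q.1.1 q.2) := by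
      refine (hk.comp (by fun_prop)).mul ((hw.comp measurable_snd).mul ?_)
      exact ha.comp (g := Function.uncurry a)
        (f := fun q : (ℝ × ℝ) × ℝ => (q.1.1, q.2)) (by fun_prop)
    exact h1.lintegral_prod_right'
  -- Young's inequality for the convolution with `k`.
  have hyoung : ∀ σ, ∫⁻ z, (∫⁻ y, k (z - y) * (w y * a σ y)) ^ 2 ≤
      J ^ 2 * ∫⁻ x, (w x * a σ x) ^ 2 := by
    intro σ
    have hb' : Measurable fun y => w y * a σ y := hw.mul (hat σ)
    have e : ∀ z, ∫⁻ y, k (z - y) * (w y * a σ y) = ∫⁻ y, (w (z - y) * a σ (z - y)) * k y := by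
      intro z
      rw [← lintegral_sub_left_eq_self _ z]
      refine lintegral_congr fun y => ?_
      rw [sub_sub_cancel, mul_comm]
    simp only [e]
    rw [lintegral_sq_eq_eLpNorm_sq, lintegral_sq_eq_eLpNorm_sq (fun x => w x * a σ x), ← mul_pow,
      mul_comm]
    gcongr
    refine (eLpNorm_convolution_le (by norm_num) hb'.aemeasurable hk.aemeasurable).trans ?_
    gcongr
  -- The inequality for `a`, multiplied by the weight.
  have hpt : ∀ t ∈ Ico 0 (T : ℝ), ∀ z, w z * a t z ≤ C * (L * (w (X t z) * a 0 (X t z)) +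
      B * ∫⁻ σ in Ioo 0 t, ∫⁻ y, k (z - y) * (w y * a σ y)) := by
    intro t ht z
    have h1 : ∀ σ, w z * ∫⁻ y, expKernel (z - y) * a σ y ^ 2 ≤
        B * ∫⁻ y, k (z - y) * (w y * a σ y) := by
      intro σ
      rw [← lintegral_const_mul, ← lintegral_const_mul' _ _ ENNReal.coe_ne_top]
      · refine lintegral_mono_ae ?_
        filter_upwards [hwk z] with y hy
        calc w z * (expKernel (z - y) * a σ y ^ 2)
            = (w z * expKernel (z - y)) * a σ y * a σ y := by ring
          _ ≤ (k (z - y) * w y) * B * a σ y := by gcongr; exact haB σ y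
          _ = _ := by ring
      · exact (measurable_expKernel.comp (by fun_prop)).mul ((hat σ).pow_const _)
    calc w z * a t z
        ≤ w z * (C * (a 0 (X t z) + ∫⁻ σ in Ioo 0 t, ∫⁻ y, expKernel (z - y) * a σ y ^ 2)) := by
          gcongr; exact hest t ht z
      _ = C * (w z * a 0 (X t z) +
            w z * ∫⁻ σ in Ioo 0 t, ∫⁻ y, expKernel (z - y) * a σ y ^ 2) := by ring
      _ ≤ C * ((L * w (X t z)) * a 0 (X t z) +
            ∫⁻ σ in Ioo 0 t, w z * ∫⁻ y, expKernel (z - y) * a σ y ^ 2) := by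
          gcongr
          · exact hwL t ht z
          · rw [lintegral_const_mul]
            have h2 : Measurable fun q : ℝ × ℝ => expKernel (z - q.2) * a q.1 q.2 ^ 2 :=
              (measurable_expKernel.comp (by fun_prop)).mul (ha.pow_const _)
            exact h2.lintegral_prod_right'
      _ ≤ C * ((L * w (X t z)) * a 0 (X t z) +
            ∫⁻ σ in Ioo 0 t, B * ∫⁻ y, k (z - y) * (w y * a σ y)) := by
          gcongr C * (_ + ?_); exact lintegral_mono h1
      _ = _ := by rw [lintegral_const_mul' _ _ ENNReal.coe_ne_top, mul_assoc]
  have hfin : ∀ t ∈ Ico 0 (T : ℝ), ∫⁻ x, (w x * a t x) ^ 2 ≤ B ^ 2 * ∫⁻ x, w x ^ 2 := by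
    intro t _
    rw [← lintegral_const_mul' _ _ (by finiteness)]
    refine lintegral_mono fun x => ?_
    rw [mul_pow, mul_comm]
    gcongr
    exact haB t x
  have hint : ∀ t ∈ Ico 0 (T : ℝ), ∫⁻ x, (w x * a t x) ^ 2 ≤
      ENNReal.ofReal A + b * ∫⁻ σ in Ioo 0 t, ∫⁻ x, (w x * a σ x) ^ 2 := by
    intro t ht
    have hX0 : ∫⁻ z, (w (X t z) * a 0 (X t z)) ^ 2 ≤ K ^ 2 * Q₀ := by
      rw [lintegral_sq_eq_eLpNorm_sq]
      have := eLpNorm_comp_le_of_map_le (p := 2) (by norm_num)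
        (by exact_mod_cast hK) (hX t ht) (hmap t ht) (hw.mul (hat 0))
      calc _ ≤ (K * eLpNorm (fun x => w x * a 0 x) 2 volume) ^ 2 := by gcongr; exact this
        _ = K ^ 2 * ∫⁻ x, (w x * a 0 x) ^ 2 := by rw [mul_pow, ← lintegral_sq_eq_eLpNorm_sq]
        _ ≤ _ := by gcongr
    have hm0 : Measurable fun z => (w (X t z) * a 0 (X t z)) ^ 2 :=
      ((hw.mul (hat 0)).comp (hX t ht)).pow_const 2
    calc ∫⁻ x, (w x * a t x) ^ 2
        ≤ ∫⁻ z, (2 * C ^ 2 * (L ^ 2 * (w (X t z) * a 0 (X t z)) ^ 2) +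
            2 * C ^ 2 * (T * (B ^ 2 *
              ∫⁻ σ in Ioo 0 t, (∫⁻ y, k (z - y) * (w y * a σ y)) ^ 2))) := by
          refine lintegral_mono fun z => ?_
          calc (w z * a t z) ^ 2 ≤ (C * (L * (w (X t z) * a 0 (X t z)) +
                B * ∫⁻ σ in Ioo 0 t, ∫⁻ y, k (z - y) * (w y * a σ y))) ^ 2 := by
                exact pow_le_pow_left' (hpt t ht z) 2
            _ ≤ C ^ 2 * (2 * ((L * (w (X t z) * a 0 (X t z))) ^ 2 +
                (B * ∫⁻ σ in Ioo 0 t, ∫⁻ y, k (z - y) * (w y * a σ y)) ^ 2)) := by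
                rw [mul_pow]; gcongr; exact add_sq_le_two_mul _ _
            _ ≤ C ^ 2 * (2 * ((L * (w (X t z) * a 0 (X t z))) ^ 2 +
                B ^ 2 * (T *
                  ∫⁻ σ in Ioo 0 t, (∫⁻ y, k (z - y) * (w y * a σ y)) ^ 2))) := by
                rw [mul_pow (B : ℝ≥0∞)]
                gcongr
                refine (sq_lintegral_le _ (Measurable.aemeasurable ?_)).trans ?_
                · exact hmeas.comp measurable_prodMk_right
                · gcongr
                  rw [Measure.restrict_apply MeasurableSet.univ, univ_inter, Real.volume_Ioo,
                    sub_zero, ← ENNReal.ofReal_coe_nnreal]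
                  exact ENNReal.ofReal_le_ofReal ht.2.le
            _ = _ := by ring
      _ = 2 * C ^ 2 * (L ^ 2 * ∫⁻ z, (w (X t z) * a 0 (X t z)) ^ 2) +
            2 * C ^ 2 * (T * (B ^ 2 *
              ∫⁻ σ in Ioo 0 t, ∫⁻ z, (∫⁻ y, k (z - y) * (w y * a σ y)) ^ 2)) := by
          rw [lintegral_add_left ((hm0.const_mul _).const_mul _),
            lintegral_const_mul' _ _ (by finiteness), lintegral_const_mul' _ _ (by finiteness),
            lintegral_const_mul' _ _ (by finiteness), lintegral_const_mul' _ _ (by finiteness),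
            lintegral_const_mul' _ _ (by finiteness), lintegral_lintegral_swap]
          exact ((hmeas.comp measurable_swap).pow_const 2).aemeasurable
      _ ≤ 2 * C ^ 2 * (L ^ 2 * (K ^ 2 * Q₀)) + 2 * C ^ 2 * (T * (B ^ 2 *
              ∫⁻ σ in Ioo 0 t, J ^ 2 * ∫⁻ x, (w x * a σ x) ^ 2)) := by
          gcongr with σ; exact hyoung σ
      _ = A + (2 * C ^ 2 * (T * (B ^ 2 * J ^ 2))) * ∫⁻ σ in Ioo 0 t, ∫⁻ x, (w x * a σ x) ^ 2 := by
          rw [lintegral_const_mul' _ _ (by finiteness), hA]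
          push_cast
          ring
      _ ≤ _ := by
          rw [ENNReal.ofReal_coe_nnreal, hb]
          push_cast
          gcongr
          exact le_self_add
  exact gronwall_lintegral (b := b) (by positivity) (ENNReal.mul_ne_top (by finiteness) hw2)
    A.coe_nonneg hfin hint

/-! ### Weights -/

theorem integrable_exp_neg_mul_abs {c : ℝ} (hc : 0 < c) :
    Integrable (fun x : ℝ => Real.exp (-(c * |x|))) := by
  rw [← integrableOn_univ, ← Iic_union_Ioi (a := (0 : ℝ)), integrableOn_union]
  constructor
  · refine (integrableOn_exp_mul_Iic hc 0).congr_fun (fun x hx => ?_) measurableSet_Iic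
    simp [abs_of_nonpos (mem_Iic.1 hx)]
  · refine (integrableOn_exp_mul_Ioi (neg_lt_zero.2 hc) 0).congr_fun (fun x hx => ?_)
      measurableSet_Ioi
    simp [abs_of_pos (mem_Ioi.1 hx)]

/-- A positive locally absolutely continuous function whose logarithmic derivative is bounded by
`A` varies by at most the factor `exp (A |x - y|)`: the derivative of `φ x * exp (-A x)` is
nonpositive and that of `φ x * exp (A x)` is nonnegative. -/
theorem le_exp_mul_of_abs_deriv_le {φ : ℝ → ℝ} (hpos : ∀ x, 0 < φ x) (hac : LocallyAC φ)
    {A : ℝ} (hA : ∀ᵐ x : ℝ, |deriv φ x| ≤ A * |φ x|) (x y : ℝ) :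
    φ x ≤ Real.exp (A * |x - y|) * φ y := by
  have hexp : ∀ B a b : ℝ, AbsolutelyContinuousOnInterval (fun x => Real.exp (B * x)) a b :=
    fun B a b => ContDiffOn.absolutelyContinuousOnInterval (by fun_prop)
  have hderiv : ∀ B x : ℝ, deriv (fun x => Real.exp (B * x)) x = B * Real.exp (B * x) := by
    intro B x
    have := ((hasDerivAt_id x).const_mul B).exp.deriv
    simp only [id] at this
    rw [this]; ring
  have hsub : ∀ B a b : ℝ, φ b * Real.exp (B * b) - φ a * Real.exp (B * a) =
      ∫ x in a..b, (deriv φ x + B * φ x) * Real.exp (B * x) := by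
    intro B a b
    rw [← (hac a b).integral_deriv_mul_eq_sub (hexp B a b)]
    refine intervalIntegral.integral_congr fun x _ => ?_
    simp only [hderiv]; ring
  have hA' : ∀ᵐ x : ℝ, -(A * φ x) ≤ deriv φ x ∧ deriv φ x ≤ A * φ x := by
    filter_upwards [hA] with x hx
    rw [abs_of_pos (hpos x)] at hx
    exact abs_le.1 hx
  rcases le_total x y with hxy | hxy
  · have h1 := hsub A x y
    have h2 : 0 ≤ ∫ x in x..y, (deriv φ x + A * φ x) * Real.exp (A * x) := by
      refine intervalIntegral.integral_nonneg_of_ae hxy ?_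
      filter_upwards [hA'] with z hz
      have := Real.exp_pos (A * z)
      have : 0 ≤ deriv φ z + A * φ z := by linarith
      simp only [Pi.zero_apply]; positivity
    have h3 : φ x * Real.exp (A * x) ≤ φ y * Real.exp (A * y) := by linarith
    rw [abs_of_nonpos (by linarith), show A * -(x - y) = A * y - A * x by ring, Real.exp_sub,
      div_mul_eq_mul_div, le_div_iff₀ (Real.exp_pos _)]
    linarith
  · have h1 := hsub (-A) y x
    have h2 : 0 ≤ ∫ x in y..x, -((deriv φ x + -A * φ x) * Real.exp (-A * x)) := by
      refine intervalIntegral.integral_nonneg_of_ae hxy ?_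
      filter_upwards [hA'] with z hz
      have := Real.exp_pos (-A * z)
      have : 0 ≤ A * φ z - deriv φ z := by linarith
      simp only [Pi.zero_apply]
      calc (0 : ℝ) ≤ (A * φ z - deriv φ z) * Real.exp (-A * z) := by positivity
        _ = _ := by ring
    rw [intervalIntegral.integral_neg] at h2
    have h3 : φ x * Real.exp (-A * x) ≤ φ y * Real.exp (-A * y) := by linarith
    rw [abs_of_nonneg (by linarith), show A * (x - y) = A * x + -A * y by ring, Real.exp_add]
    have h4 : Real.exp (-A * x) * Real.exp (A * x) = 1 := by rw [← Real.exp_add]; simp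
    calc φ x = φ x * Real.exp (-A * x) * Real.exp (A * x) := by rw [mul_assoc, h4, mul_one]
      _ ≤ φ y * Real.exp (-A * y) * Real.exp (A * x) := by gcongr
      _ = _ := by ring

theorem aemeasurable_of_memLp_mul_exp {v : ℝ → ℝ} {p : ℝ≥0∞}
    (hv : MemLp (fun x : ℝ => v x * Real.exp (-|x|)) p volume) : AEMeasurable v volume := by
  have h : AEMeasurable (fun x => v x * Real.exp (-|x|) * Real.exp |x|) volume :=
    hv.1.aemeasurable.mul (by fun_prop)
  refine h.congr (ae_of_all _ fun x => ?_)
  simp [mul_assoc, ← Real.exp_add]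

/-- If `v exp (-|x|)` is in `L^p` with `p > 1`, then `(v exp (|x| / 2)) ^ (1 / 2) exp (-|x|)` is
integrable: it is the geometric mean of `v exp (-|x|) exp (-|x| / 4)`, integrable by Hölder, and
`exp (-|x| / 4)`. -/
theorem integrable_sqrt_mul_exp {v : ℝ → ℝ} {p : ℝ≥0∞} (hp : 2 ≤ p) (hv0 : ∀ x, 0 ≤ v x)
    (hv : MemLp (fun x : ℝ => v x * Real.exp (-|x|)) p volume) :
    Integrable (fun x : ℝ => √(v x * Real.exp (|x| / 2)) * Real.exp (-|x|)) := by
  have hp1 : 1 < p := lt_of_lt_of_le (by norm_num) hp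
  set q : ℝ≥0∞ := ENNReal.conjExponent p with hq
  have hqtop : q ≠ ⊤ := by
    rw [hq, ENNReal.conjExponent]
    have : p - 1 ≠ 0 := (tsub_pos_of_lt hp1).ne'
    finiteness
  have hq0 : q ≠ 0 := by
    rw [hq, ENNReal.conjExponent]
    simp
  have hpq : ENNReal.HolderConjugate p q := ENNReal.HolderConjugate.conjExponent hp1.le
  have he : Integrable (fun x : ℝ => Real.exp (-(1 / 4 * |x|))) :=
    integrable_exp_neg_mul_abs (by norm_num)
  have heq : MemLp (fun x : ℝ => Real.exp (-(1 / 4 * |x|))) q volume := by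
    rw [← integrable_norm_rpow_iff (by fun_prop) hq0 hqtop]
    have := integrable_exp_neg_mul_abs (c := q.toReal / 4)
      (by have := ENNReal.toReal_pos hq0 hqtop; positivity)
    refine this.congr (ae_of_all _ fun x => ?_)
    simp only [Real.norm_eq_abs, Real.abs_exp]
    rw [← Real.exp_mul]
    congr 1; ring
  have h1 := hv.integrable_mul heq
  refine (h1.add he).mono' ?_ (ae_of_all _ fun x => ?_)
  · have := aemeasurable_of_memLp_mul_exp hv
    refine AEMeasurable.aestronglyMeasurable (AEMeasurable.mul ?_ (by fun_prop))
    exact Real.continuous_sqrt.measurable.comp_aemeasurable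
      (f := fun x => v x * Real.exp (|x| / 2)) (this.mul (by fun_prop))
  · have e1 : √(v x * Real.exp (|x| / 2)) * Real.exp (-|x|) =
        √(v x * Real.exp (-|x|)) * Real.exp (-(1 / 4 * |x|)) := by
      rw [Real.sqrt_mul (hv0 x), Real.sqrt_mul (hv0 x), ← Real.exp_half, ← Real.exp_half, mul_assoc,
        mul_assoc, ← Real.exp_add, ← Real.exp_add]
      congr 2; ring
    rw [e1, Real.norm_of_nonneg (by positivity)]
    have h2 : √(v x * Real.exp (-|x|)) ≤ v x * Real.exp (-|x|) + 1 := by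
      have h3 : 0 ≤ v x * Real.exp (-|x|) := mul_nonneg (hv0 x) (Real.exp_nonneg _)
      have := Real.sq_sqrt h3
      nlinarith [sq_nonneg (√(v x * Real.exp (-|x|)) - 1), Real.sqrt_nonneg (v x * Real.exp (-|x|))]
    simp only [Pi.add_apply, Pi.mul_apply]
    calc _ ≤ (v x * Real.exp (-|x|) + 1) * Real.exp (-(1 / 4 * |x|)) := by gcongr
      _ = _ := by ring

/-- The truncation `min (φ x) (n * exp (-|x| / 2))` of a weight, which is integrable and increases
to `φ` as `n` grows. -/
noncomputable def truncWeight (φ : ℝ → ℝ) (n : ℕ) (x : ℝ) : ℝ :=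
  min (φ x) (n * Real.exp (-(1 / 2 * |x|)))

theorem truncWeight_nonneg {φ : ℝ → ℝ} (hpos : ∀ x, 0 < φ x) (n : ℕ) (x : ℝ) : 0 ≤ truncWeight φ n x :=
  le_min (hpos x).le (by positivity)

theorem exp_half_abs_le (x y : ℝ) : Real.exp (-(1 / 2 * |x|)) ≤
    Real.exp (1 / 2 * |x - y|) * Real.exp (-(1 / 2 * |y|)) := by
  rw [← Real.exp_add, Real.exp_le_exp]
  have : |y| ≤ |x - y| + |x| := by
    have := abs_sub_abs_le_abs_sub y x
    rw [abs_sub_comm y x] at this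
    linarith
  linarith

/-- The truncated weights are moderate with respect to `v exp (|x| / 2)`, uniformly in `n`; the
lower bound of `v` makes the factor at least `1`. -/
theorem truncWeight_le_moderate {φ v : ℝ → ℝ} (hpos : ∀ x, 0 < φ x) {c δ : ℝ} (hc : 0 < c) (hδ : 0 < δ)
    (hv : ∀ x, δ ≤ v x) (hφv : ∀ x y, φ (x + y) ≤ c * v x * φ y) (n : ℕ) (x y : ℝ) :
    truncWeight φ n x ≤
      max c δ⁻¹ * (v (x - y) * Real.exp (|x - y| / 2)) * truncWeight φ n y := by
  have hvp : 0 < v (x - y) := hδ.trans_le (hv _)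
  have he : 1 ≤ Real.exp (|x - y| / 2) := Real.one_le_exp (by positivity)
  have hm : 0 < max c δ⁻¹ := lt_max_of_lt_left hc
  rw [truncWeight, truncWeight, mul_min_of_nonneg _ _ (by positivity)]
  refine min_le_min ?_ ?_
  · calc φ x = φ ((x - y) + y) := by simp
      _ ≤ c * v (x - y) * φ y := hφv _ _
      _ ≤ (max c δ⁻¹ * (v (x - y) * Real.exp (|x - y| / 2))) * φ y := by
          refine mul_le_mul_of_nonneg_right ?_ (hpos y).le
          calc c * v (x - y) ≤ max c δ⁻¹ * v (x - y) := by gcongr; exact le_max_left _ _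
            _ ≤ max c δ⁻¹ * (v (x - y) * Real.exp (|x - y| / 2)) := by
                gcongr; exact le_mul_of_one_le_right hvp.le he
  · have h1 : 1 ≤ max c δ⁻¹ * v (x - y) := by
      calc 1 = δ⁻¹ * δ := by field_simp
        _ ≤ _ := by gcongr; exacts [le_max_right _ _, hv _]
    calc (n : ℝ) * Real.exp (-(1 / 2 * |x|))
        ≤ n * (1 * (Real.exp (1 / 2 * |x - y|) * Real.exp (-(1 / 2 * |y|)))) := by
          rw [one_mul]; gcongr; exact exp_half_abs_le x y
      _ ≤ n * ((max c δ⁻¹ * v (x - y)) *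
            (Real.exp (1 / 2 * |x - y|) * Real.exp (-(1 / 2 * |y|)))) := by gcongr
      _ = _ := by rw [show 1 / 2 * |x - y| = |x - y| / 2 by ring]; ring

theorem truncWeight_le_exp {φ : ℝ → ℝ} (hpos : ∀ x, 0 < φ x) {A : ℝ}
    (hφA : ∀ x y, φ x ≤ Real.exp (A * |x - y|) * φ y)
    (n : ℕ) (x y : ℝ) :
    truncWeight φ n x ≤ Real.exp (max A 1 * |x - y|) * truncWeight φ n y := by
  rw [truncWeight, truncWeight, mul_min_of_nonneg _ _ (by positivity)]
  refine min_le_min ((hφA x y).trans ?_) ?_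
  · have := hpos y
    gcongr
    exact le_max_left _ _
  · calc (n : ℝ) * Real.exp (-(1 / 2 * |x|))
        ≤ n * (Real.exp (1 / 2 * |x - y|) * Real.exp (-(1 / 2 * |y|))) := by
          gcongr; exact exp_half_abs_le x y
      _ ≤ n * (Real.exp (max A 1 * |x - y|) * Real.exp (-(1 / 2 * |y|))) := by
          gcongr
          exact le_trans (by norm_num) (le_max_right A 1)
      _ = _ := by ring

theorem truncWeight_mono {φ : ℝ → ℝ} (x : ℝ) : Monotone fun n => truncWeight φ n x := fun m n h => by
  simp only [truncWeight]
  gcongr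

theorem eventually_truncWeight_eq {φ : ℝ → ℝ} (x : ℝ) : ∀ᶠ n in atTop, truncWeight φ n x = φ x := by
  obtain ⟨N, hN⟩ := exists_nat_ge (φ x / Real.exp (-(1 / 2 * |x|)))
  filter_upwards [eventually_ge_atTop N] with n hn
  refine min_eq_left ?_
  rw [← div_le_iff₀ (Real.exp_pos _)]
  exact hN.trans (by exact_mod_cast hn)

/-! ### Propagation of the weighted norms -/

theorem ae_comp_sub_left {f g : ℝ → ℝ≥0∞} (h : f =ᵐ[volume] g) (z : ℝ) :
    ∀ᵐ y : ℝ, f (z - y) = g (z - y) :=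
  (quasiMeasurePreserving_sub_left (volume : Measure ℝ) z).ae h

/-- The weighted `L²` bound with weight `φ ^ (1 / 2)`, obtained from truncated weights by monotone
convergence. -/
theorem exists_lintegral_weight_mul_sq_le {p : ℝ≥0∞} (hp : 2 ≤ p) {φ v : ℝ → ℝ}
    (hpos : ∀ x, 0 < φ x) (hφm : Measurable φ) {A : ℝ}
    (hφA : ∀ x y, φ x ≤ Real.exp (A * |x - y|) * φ y)
    {c δ : ℝ} (hc : 0 < c) (hδ : 0 < δ) (hvδ : ∀ x, δ ≤ v x)
    (hφv : ∀ x y, φ (x + y) ≤ c * v x * φ y)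
    (hvp : MemLp (fun x : ℝ => v x * Real.exp (-|x|)) p volume)
    {T : ℝ} {a : ℝ → ℝ → ℝ≥0∞}
    (ha : Measurable (Function.uncurry a)) {B : NNReal} (haB : ∀ t z, a t z ≤ B)
    {X : ℝ → ℝ → ℝ} (hX : ∀ t ∈ Ico 0 T, Measurable (X t)) {D : ℝ} (hD : 0 ≤ D)
    (hXD : ∀ t ∈ Ico 0 T, ∀ z, |z - X t z| ≤ D) {K : NNReal}
    (hK : 1 ≤ K) (hmap : ∀ t ∈ Ico 0 T, Measure.map (X t) volume ≤ (K : ℝ≥0∞) • volume) {C : NNReal}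
    (hest : ∀ t ∈ Ico 0 T, ∀ z, a t z ≤
      C * (a 0 (X t z) + ∫⁻ σ in Ioo 0 t, ∫⁻ y, expKernel (z - y) * a σ y ^ 2))
    (h2 : ∫⁻ x, ENNReal.ofReal (φ x) * a 0 x ^ 2 ≠ ⊤) :
    ∃ Q : NNReal, ∀ t ∈ Ico 0 T, ∫⁻ x, ENNReal.ofReal (φ x) * a t x ^ 2 ≤ Q := by
  have hv0 : ∀ x, 0 ≤ v x := fun x => hδ.le.trans (hvδ x)
  set k₀ : ℝ → ℝ := fun x => √(max c δ⁻¹) * (√(v x * Real.exp (|x| / 2)) * Real.exp (-|x|)) with hk₀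
  have hk₀int : Integrable k₀ := (integrable_sqrt_mul_exp hp hv0 hvp).const_mul _
  have hk₀m : AEMeasurable (fun x => ENNReal.ofReal (k₀ x)) volume :=
    hk₀int.1.aemeasurable.ennreal_ofReal
  set k : ℝ → ℝ≥0∞ := hk₀m.mk _ with hk
  set J : NNReal := (∫⁻ x, k x).toNNReal with hJ
  have hJ' : ∫⁻ x, k x ≤ J := by
    rw [hJ, ENNReal.coe_toNNReal]
    rw [hk, ← lintegral_congr_ae hk₀m.ae_eq_mk]
    exact hk₀int.lintegral_lt_top.ne
  set L : NNReal := (Real.exp (max A 1 * D)).toNNReal with hL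
  obtain ⟨Q, hQ⟩ := exists_weighted_sq_bound ha haB hX hK hmap hest L J
    (∫⁻ x, ENNReal.ofReal (φ x) * a 0 x ^ 2).toNNReal
  have hsq : ∀ n x, ENNReal.ofReal √(truncWeight φ n x) ^ 2 =
      ENNReal.ofReal (truncWeight φ n x) := fun n x => by
    rw [← ENNReal.ofReal_pow (Real.sqrt_nonneg _), Real.sq_sqrt (truncWeight_nonneg hpos n x)]
  have htm : ∀ n, Measurable (truncWeight φ n) := fun n => by
    unfold truncWeight
    exact hφm.min (by fun_prop)
  have hn : ∀ n : ℕ, ∀ t ∈ Ico 0 T,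
      ∫⁻ x, ENNReal.ofReal (truncWeight φ n x) * a t x ^ 2 ≤ Q := by
    intro n t ht
    have := hQ (fun x => ENNReal.ofReal √(truncWeight φ n x)) k
      (Real.continuous_sqrt.measurable.comp (htm n)).ennreal_ofReal hk₀m.measurable_mk ?_ hJ' ?_
      ?_ ?_ t ht
    · simpa only [mul_pow, hsq] using this
    · intro z
      filter_upwards [ae_comp_sub_left hk₀m.ae_eq_mk z] with y hy
      rw [hk, ← hy, expKernel, ← ENNReal.ofReal_mul (Real.sqrt_nonneg _), ← ENNReal.ofReal_mul]
      · refine ENNReal.ofReal_le_ofReal ?_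
        calc √(truncWeight φ n z) * Real.exp (-|z - y|)
            ≤ √(max c δ⁻¹ * (v (z - y) * Real.exp (|z - y| / 2)) * truncWeight φ n y) *
              Real.exp (-|z - y|) := by
              gcongr
              exact truncWeight_le_moderate hpos hc hδ hvδ hφv n z y
          _ = _ := by
              rw [Real.sqrt_mul' _ (truncWeight_nonneg hpos n y),
                Real.sqrt_mul' _ (mul_nonneg (hv0 _) (Real.exp_nonneg _))]
              simp only [hk₀]; ring
      · exact mul_nonneg (Real.sqrt_nonneg _)
          (mul_nonneg (Real.sqrt_nonneg _) (Real.exp_nonneg _))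
    · intro s hs z
      rw [hL, ← ENNReal.ofReal, ← ENNReal.ofReal_mul (Real.exp_nonneg _)]
      refine ENNReal.ofReal_le_ofReal ?_
      have h1 : 1 ≤ Real.exp (max A 1 * D) := Real.one_le_exp
        (mul_nonneg (zero_le_one.trans (le_max_right _ _)) hD)
      calc √(truncWeight φ n z) ≤ √(Real.exp (max A 1 * D) ^ 2 * truncWeight φ n (X s z)) := by
            refine Real.sqrt_le_sqrt ((truncWeight_le_exp hpos hφA n z (X s z)).trans ?_)
            refine mul_le_mul_of_nonneg_right ?_ (truncWeight_nonneg hpos _ _)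
            calc Real.exp (max A 1 * |z - X s z|) ≤ Real.exp (max A 1 * D) := by
                  gcongr; exact hXD s hs z
              _ ≤ _ := le_self_pow₀ h1 two_ne_zero
        _ = _ := by
            rw [Real.sqrt_mul (by positivity), Real.sqrt_sq (Real.exp_nonneg _)]
    · simp only [hsq]
      have hi : Integrable (fun x : ℝ => (n : ℝ) * Real.exp (-(1 / 2 * |x|))) :=
        (integrable_exp_neg_mul_abs (by norm_num)).const_mul _
      refine ((lintegral_mono fun x => ?_).trans_lt hi.lintegral_lt_top).ne
      exact ENNReal.ofReal_le_ofReal (min_le_right _ _)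
    · rw [ENNReal.coe_toNNReal h2]
      refine lintegral_mono fun x => ?_
      simp only [mul_pow, hsq]
      gcongr
      exact min_le_left _ _
  refine ⟨Q, fun t ht => ?_⟩
  have hat : Measurable (a t) := ha.comp measurable_prodMk_left
  refine le_of_tendsto' (lintegral_tendsto_of_tendsto_of_monotone
    (f := fun n x => ENNReal.ofReal (truncWeight φ n x) * a t x ^ 2) ?_ ?_ ?_) (hn · t ht)
  · exact fun n => ((htm n).ennreal_ofReal.mul (hat.pow_const 2)).aemeasurable
  · refine ae_of_all _ fun x m n hmn => ?_
    exact mul_le_mul_left (ENNReal.ofReal_le_ofReal (truncWeight_mono x hmn)) _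
  · refine ae_of_all _ fun x => tendsto_const_nhds.congr' ?_
    filter_upwards [eventually_truncWeight_eq (φ := φ) x] with n hn
    rw [hn]

/-- The weighted `L^p` bound: once `φ a²` is bounded in `L¹`, the nonlocal term is the convolution
of `v exp (-|x|) ∈ L^p` with an `L¹` function. -/
theorem exists_eLpNorm_weight_mul_le {p : ℝ≥0∞} (hp : 2 ≤ p) {φ v : ℝ → ℝ}
    (hpos : ∀ x, 0 < φ x) (hφm : Measurable φ) {A : ℝ} (hA : 0 ≤ A)
    (hφA : ∀ x y, φ x ≤ Real.exp (A * |x - y|) * φ y)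
    {c : ℝ} (hc : 0 < c) (hv0 : ∀ x, 0 ≤ v x)
    (hφv : ∀ x y, φ (x + y) ≤ c * v x * φ y)
    (hvp : MemLp (fun x : ℝ => v x * Real.exp (-|x|)) p volume)
    {T : ℝ} {a : ℝ → ℝ → ℝ≥0∞}
    (ha : Measurable (Function.uncurry a))
    {X : ℝ → ℝ → ℝ} (hX : ∀ t ∈ Ico 0 T, Measurable (X t)) {D : ℝ}
    (hXD : ∀ t ∈ Ico 0 T, ∀ z, |z - X t z| ≤ D) {K : NNReal}
    (hK : 1 ≤ K) (hmap : ∀ t ∈ Ico 0 T, Measure.map (X t) volume ≤ (K : ℝ≥0∞) • volume) {C : NNReal}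
    (hest : ∀ t ∈ Ico 0 T, ∀ z, a t z ≤
      C * (a 0 (X t z) + ∫⁻ σ in Ioo 0 t, ∫⁻ y, expKernel (z - y) * a σ y ^ 2))
    {Q : NNReal} (hQ : ∀ t ∈ Ico 0 T, ∫⁻ x, ENNReal.ofReal (φ x) * a t x ^ 2 ≤ Q)
    (hinit : eLpNorm (fun x => ENNReal.ofReal (φ x) * a 0 x) p volume ≠ ⊤) :
    ∃ Q' : NNReal, ∀ t ∈ Ico 0 T, eLpNorm (fun x => ENNReal.ofReal (φ x) * a t x) p volume ≤ Q' := by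
  have hp1 : 1 ≤ p := le_trans (by norm_num) hp
  have hat : ∀ t, Measurable (a t) := fun t => ha.comp measurable_prodMk_left
  have hk₀ : MemLp (fun x => c * (v x * Real.exp (-|x|))) p volume := hvp.const_mul c
  have hk₀m : AEMeasurable (fun x => ENNReal.ofReal (c * (v x * Real.exp (-|x|)))) volume :=
    hk₀.1.aemeasurable.ennreal_ofReal
  set k : ℝ → ℝ≥0∞ := hk₀m.mk _ with hk
  have hkm : Measurable k := hk₀m.measurable_mk
  have hkp : eLpNorm k p volume ≠ ⊤ := by
    refine (lt_of_le_of_lt ?_ hk₀.2).ne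
    refine eLpNorm_mono_enorm_ae ?_
    filter_upwards [hk₀m.ae_eq_mk] with x hx
    rw [hk, ← hx, enorm_eq_self, ← ofReal_norm, Real.norm_eq_abs]
    exact ENNReal.ofReal_le_ofReal (le_abs_self _)
  have hφk : ∀ z, ∀ᵐ y : ℝ, ENNReal.ofReal (φ z) * expKernel (z - y) ≤
      k (z - y) * ENNReal.ofReal (φ y) := by
    intro z
    filter_upwards [ae_comp_sub_left hk₀m.ae_eq_mk z] with y hy
    have h0 := hv0 (z - y)
    rw [hk, ← hy, expKernel, ← ENNReal.ofReal_mul (hpos z).le, ← ENNReal.ofReal_mul (by positivity)]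
    refine ENNReal.ofReal_le_ofReal ?_
    calc φ z * Real.exp (-|z - y|) = φ ((z - y) + y) * Real.exp (-|z - y|) := by simp
      _ ≤ (c * v (z - y) * φ y) * Real.exp (-|z - y|) := by gcongr; exact hφv _ _
      _ = _ := by ring
  set L : NNReal := (Real.exp (A * D)).toNNReal with hL
  have hφL : ∀ t ∈ Ico 0 T, ∀ z, ENNReal.ofReal (φ z) ≤ L * ENNReal.ofReal (φ (X t z)) := by
    intro t ht z
    rw [hL, ← ENNReal.ofReal, ← ENNReal.ofReal_mul (Real.exp_nonneg _)]
    refine ENNReal.ofReal_le_ofReal ((hφA z (X t z)).trans ?_)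
    have := hpos (X t z)
    gcongr
    exact hXD t ht z
  set h : ℝ → ℝ≥0∞ := fun y => ∫⁻ σ in Ioo 0 T, ENNReal.ofReal (φ y) * a σ y ^ 2 with hh
  have hjoint : Measurable fun q : ℝ × ℝ => ENNReal.ofReal (φ q.2) * a q.1 q.2 ^ 2 :=
    (hφm.comp measurable_snd).ennreal_ofReal.mul (ha.pow_const 2)
  have hhm : Measurable h := hjoint.lintegral_prod_left'
  have hh1 : ∫⁻ y, h y ≤ Q * ENNReal.ofReal T := by
    rw [hh, ← lintegral_lintegral_swap (f := fun σ y => ENNReal.ofReal (φ y) * a σ y ^ 2)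
      hjoint.aemeasurable]
    calc ∫⁻ σ in Ioo 0 T, ∫⁻ y, ENNReal.ofReal (φ y) * a σ y ^ 2
        ≤ ∫⁻ σ in Ioo 0 T, (Q : ℝ≥0∞) :=
          setLIntegral_mono' measurableSet_Ioo fun σ hσ => hQ σ ⟨hσ.1.le, hσ.2⟩
      _ = _ := by simp
  have hpt : ∀ t ∈ Ico 0 T, ∀ z, ENNReal.ofReal (φ z) * a t z ≤
      C * (L * (ENNReal.ofReal (φ (X t z)) * a 0 (X t z)) + ∫⁻ y, k (z - y) * h y) := by
    intro t ht z
    have hE : Measurable fun q : ℝ × ℝ => expKernel (z - q.2) * a q.1 q.2 ^ 2 :=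
      (measurable_expKernel.comp (by fun_prop)).mul (ha.pow_const _)
    have h1 : ENNReal.ofReal (φ z) * ∫⁻ σ in Ioo 0 t, ∫⁻ y, expKernel (z - y) * a σ y ^ 2 ≤
        ∫⁻ y, k (z - y) * h y := by
      rw [← lintegral_const_mul _ hE.lintegral_prod_right']
      calc ∫⁻ σ in Ioo 0 t, ENNReal.ofReal (φ z) * ∫⁻ y, expKernel (z - y) * a σ y ^ 2
          ≤ ∫⁻ σ in Ioo 0 T, ENNReal.ofReal (φ z) * ∫⁻ y, expKernel (z - y) * a σ y ^ 2 :=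
            lintegral_mono_set (Ioo_subset_Ioo_right ht.2.le)
        _ ≤ ∫⁻ σ in Ioo 0 T, ∫⁻ y, k (z - y) * (ENNReal.ofReal (φ y) * a σ y ^ 2) := by
            refine lintegral_mono fun σ => ?_
            rw [← lintegral_const_mul' _ _ ENNReal.ofReal_ne_top]
            refine lintegral_mono_ae ?_
            filter_upwards [hφk z] with y hy
            rw [← mul_assoc, ← mul_assoc]
            gcongr
        _ = ∫⁻ y, ∫⁻ σ in Ioo 0 T, k (z - y) * (ENNReal.ofReal (φ y) * a σ y ^ 2) := by
            refine lintegral_lintegral_swap (Measurable.aemeasurable ?_)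
            exact (hkm.comp (by fun_prop)).mul hjoint
        _ = _ := by
            refine lintegral_congr fun y => ?_
            exact lintegral_const_mul _ (hjoint.comp measurable_prodMk_right)
    calc ENNReal.ofReal (φ z) * a t z ≤ ENNReal.ofReal (φ z) *
          (C * (a 0 (X t z) + ∫⁻ σ in Ioo 0 t, ∫⁻ y, expKernel (z - y) * a σ y ^ 2)) := by
          gcongr; exact hest t ht z
      _ = C * (ENNReal.ofReal (φ z) * a 0 (X t z) + ENNReal.ofReal (φ z) *
          ∫⁻ σ in Ioo 0 t, ∫⁻ y, expKernel (z - y) * a σ y ^ 2) := by ring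
      _ ≤ C * ((L * ENNReal.ofReal (φ (X t z))) * a 0 (X t z) + ∫⁻ y, k (z - y) * h y) := by
          refine mul_le_mul_right (add_le_add (mul_le_mul_left (hφL t ht z) _) h1) _
      _ = _ := by rw [mul_assoc]
  set Q' : ℝ≥0∞ := C * (L * (K * eLpNorm (fun x => ENNReal.ofReal (φ x) * a 0 x) p volume) +
    eLpNorm k p volume * (Q * ENNReal.ofReal T)) with hQ'
  have hQ'top : Q' ≠ ⊤ := by finiteness
  refine ⟨Q'.toNNReal, fun t ht => ?_⟩
  rw [ENNReal.coe_toNNReal hQ'top]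
  have hm0 : Measurable fun x => ENNReal.ofReal (φ x) * a 0 x := hφm.ennreal_ofReal.mul (hat 0)
  have hconv : Measurable fun z => ∫⁻ y, k (z - y) * h y :=
    Measurable.lintegral_prod_right' (f := fun q : ℝ × ℝ => k (q.1 - q.2) * h q.2)
      ((hkm.comp (by fun_prop)).mul (hhm.comp measurable_snd))
  calc eLpNorm (fun x => ENNReal.ofReal (φ x) * a t x) p volume
      ≤ eLpNorm (fun z => C * (L * (ENNReal.ofReal (φ (X t z)) * a 0 (X t z)) +
          ∫⁻ y, k (z - y) * h y)) p volume := by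
        refine eLpNorm_mono_enorm fun z => ?_
        simpa only [enorm_eq_self] using hpt t ht z
    _ ≤ C * eLpNorm ((fun z => L * (ENNReal.ofReal (φ (X t z)) * a 0 (X t z))) +
          fun z => ∫⁻ y, k (z - y) * h y) p volume :=
        eLpNorm_const_mul_le ENNReal.coe_ne_top _
    _ ≤ C * (eLpNorm (fun z => L * (ENNReal.ofReal (φ (X t z)) * a 0 (X t z))) p volume +
          eLpNorm (fun z => ∫⁻ y, k (z - y) * h y) p volume) := by
        gcongr
        refine eLpNorm_add_le ?_ hconv.aestronglyMeasurable hp1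
        exact ((hm0.comp (hX t ht)).const_mul _).aestronglyMeasurable
    _ ≤ Q' := by
        have h1 := eLpNorm_comp_le_of_map_le hp1 (by exact_mod_cast hK) (hX t ht) (hmap t ht) hm0
        have h2 := (eLpNorm_convolution_le hp1 hkm.aemeasurable hhm.aemeasurable).trans
          (mul_le_mul_right hh1 _)
        have h3 := (eLpNorm_const_mul_le (p := p) (c := L) ENNReal.coe_ne_top
          fun z => ENNReal.ofReal (φ (X t z)) * a 0 (X t z)).trans (mul_le_mul_right h1 _)
        exact mul_le_mul_right (add_le_add h3 h2) _

/-! ### Classical solutions and characteristics -/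

/-- Classical solutions on `[0, T)` of the two-component Camassa-Holm system in the form
`u_t + u u_x = W`, `ρ_t + u ρ_x = - u_x ρ`, where `V_x = W`, `W_x = V + F`,
`F = u² + u_x² / 2 + ρ² / 2`, so that `V = -(1/2) exp (-|·|) * F` and `W = V_x`; the uniform bound
is `M`. Here `U₁`, `U₂`, `R₁` are the space derivatives of `U`, `U₁`, `R`. The convolution
formulas for `V` and `W` enter only through the bounds `V_le` and `W_le`. -/
structure IsClassicalSolution (T M : ℝ) (U U₁ U₂ R R₁ V W : ℝ → ℝ → ℝ) : Prop where
  cont_U : ContinuousOn (Function.uncurry U) (Ico 0 T ×ˢ univ)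
  cont_U₁ : ContinuousOn (Function.uncurry U₁) (Ico 0 T ×ˢ univ)
  cont_U₂ : ContinuousOn (Function.uncurry U₂) (Ico 0 T ×ˢ univ)
  cont_R : ContinuousOn (Function.uncurry R) (Ico 0 T ×ˢ univ)
  cont_R₁ : ContinuousOn (Function.uncurry R₁) (Ico 0 T ×ˢ univ)
  cont_V : ContinuousOn (Function.uncurry V) (Ico 0 T ×ˢ univ)
  cont_W : ContinuousOn (Function.uncurry W) (Ico 0 T ×ˢ univ)
  deriv_U : ∀ t ∈ Ico 0 T, ∀ x, HasDerivAt (U t) (U₁ t x) x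
  deriv_U₁ : ∀ t ∈ Ico 0 T, ∀ x, HasDerivAt (U₁ t) (U₂ t x) x
  deriv_R : ∀ t ∈ Ico 0 T, ∀ x, HasDerivAt (R t) (R₁ t x) x
  deriv_V : ∀ t ∈ Ico 0 T, ∀ x, HasDerivAt (V t) (W t x) x
  time_U : ∀ t ∈ Ioo 0 T, ∀ x, HasDerivAt (fun τ => U τ x) (W t x - U t x * U₁ t x) t
  time_U₁ : ∀ t ∈ Ioo 0 T, ∀ x, HasDerivAt (fun τ => U₁ τ x)
    (V t x + (U t x ^ 2 + U₁ t x ^ 2 / 2 + R t x ^ 2 / 2) - U₁ t x ^ 2 - U t x * U₂ t x) t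
  time_R : ∀ t ∈ Ioo 0 T, ∀ x, HasDerivAt (fun τ => R τ x) (-(U₁ t x * R t x) - U t x * R₁ t x) t
  U_le : ∀ t ∈ Ico 0 T, ∀ x, |U t x| ≤ M
  U₁_le : ∀ t ∈ Ico 0 T, ∀ x, |U₁ t x| ≤ M
  U₂_le : ∀ t ∈ Ico 0 T, ∀ x, |U₂ t x| ≤ M
  R_le : ∀ t ∈ Ico 0 T, ∀ x, |R t x| ≤ M
  R₁_le : ∀ t ∈ Ico 0 T, ∀ x, |R₁ t x| ≤ M
  V_le : ∀ t ∈ Ico 0 T, ∀ x, ENNReal.ofReal |V t x| ≤ ∫⁻ y, expKernel (x - y) *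
    ENNReal.ofReal (U t y ^ 2 + U₁ t y ^ 2 / 2 + R t y ^ 2 / 2)
  W_le : ∀ t ∈ Ico 0 T, ∀ x, ENNReal.ofReal |W t x| ≤ ∫⁻ y, expKernel (x - y) *
    ENNReal.ofReal (U t y ^ 2 + U₁ t y ^ 2 / 2 + R t y ^ 2 / 2)

/-- `γ` is a characteristic of the velocity field `U` on the time interval `[0, t]`. -/
def IsCharacteristic (U : ℝ → ℝ → ℝ) (t : ℝ) (γ : ℝ → ℝ) : Prop :=
  ∀ τ ∈ Icc 0 t, HasDerivWithinAt γ (U τ (γ τ)) (Icc 0 t) τ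

theorem IsCharacteristic.continuousOn {U : ℝ → ℝ → ℝ} {t : ℝ} {γ : ℝ → ℝ}
    (h : IsCharacteristic U t γ) : ContinuousOn γ (Icc 0 t) :=
  fun τ hτ => (h τ hτ).continuousWithinAt

theorem IsCharacteristic.hasDerivAt {U : ℝ → ℝ → ℝ} {t τ : ℝ} {γ : ℝ → ℝ}
    (h : IsCharacteristic U t γ) (hτ : τ ∈ Ioo 0 t) : HasDerivAt γ (U τ (γ τ)) τ :=
  (h τ (Ioo_subset_Icc_self hτ)).hasDerivAt (Icc_mem_nhds hτ.1 hτ.2)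

theorem IsCharacteristic.continuousOn_comp {U f : ℝ → ℝ → ℝ} {t T : ℝ} {γ : ℝ → ℝ}
    (h : IsCharacteristic U t γ) (ht : t < T)
    (hf : ContinuousOn (Function.uncurry f) (Ico 0 T ×ˢ univ)) :
    ContinuousOn (fun τ => f τ (γ τ)) (Icc 0 t) :=
  hf.comp (f := fun τ => (τ, γ τ)) (continuousOn_id.prodMk h.continuousOn)
    fun _ hτ => ⟨⟨hτ.1, hτ.2.trans_lt ht⟩, mem_univ _⟩

/-- A velocity field that is bounded and globally Lipschitz in space has a characteristic through
every point, on the whole time interval. -/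
theorem exists_isCharacteristic {U : ℝ → ℝ → ℝ} {T M : ℝ} (hM : 0 ≤ M)
    (hU : ContinuousOn (Function.uncurry U) (Ico 0 T ×ˢ univ))
    (hlip : ∀ t ∈ Ico 0 T, ∀ x y, |U t x - U t y| ≤ M * |x - y|)
    (hbd : ∀ t ∈ Ico 0 T, ∀ x, |U t x| ≤ M) {t : ℝ} (ht : t ∈ Ico 0 T) (z : ℝ) :
    ∃ γ, IsCharacteristic U t γ ∧ γ t = z := by
  have hsub : ∀ τ ∈ Icc 0 t, τ ∈ Ico 0 T := fun τ hτ => ⟨hτ.1, hτ.2.trans_lt ht.2⟩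
  have hPL : IsPicardLindelof U (⟨t, ht.1, le_rfl⟩ : Icc 0 t) z (M * t).toNNReal 0 M.toNNReal
      M.toNNReal := by
    refine ⟨fun τ hτ => ?_, fun x _ => ?_, fun τ hτ x _ => ?_, ?_⟩
    · refine LipschitzOnWith.of_dist_le_mul fun x _ y _ => ?_
      rw [Real.dist_eq, Real.dist_eq, Real.coe_toNNReal _ hM]
      exact hlip τ (hsub τ hτ) x y
    · exact hU.comp (f := fun τ => (τ, x)) (by fun_prop) fun τ hτ => ⟨hsub τ hτ, mem_univ _⟩
    · rw [Real.coe_toNNReal _ hM]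
      exact hbd τ (hsub τ hτ) x
    · rw [Real.coe_toNNReal _ hM, Real.coe_toNNReal _ (mul_nonneg hM ht.1)]
      simp [ht.1]
  obtain ⟨γ, h1, h2⟩ := hPL.exists_eq_forall_mem_Icc_hasDerivWithinAt₀
  exact ⟨γ, h2, h1⟩

theorem IsCharacteristic.abs_sub_le {U : ℝ → ℝ → ℝ} {t M : ℝ} {γ : ℝ → ℝ}
    (h : IsCharacteristic U t γ) (hbd : ∀ τ ∈ Icc 0 t, ∀ x, |U τ x| ≤ M)
    {σ τ : ℝ} (hσ : σ ∈ Icc 0 t) (hτ : τ ∈ Icc 0 t) : |γ τ - γ σ| ≤ M * |τ - σ| := by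
  have := (convex_Icc 0 t).norm_image_sub_le_of_norm_hasDerivWithin_le (C := M) h
    (fun x hx => hbd x hx _) hσ hτ
  simpa using this

/-- Two characteristics separate or approach each other at most exponentially. -/
theorem IsCharacteristic.abs_sub_le_exp_mul {U : ℝ → ℝ → ℝ} {t M : ℝ} {γ η : ℝ → ℝ} (hM : 0 ≤ M)
    (hγ : IsCharacteristic U t γ) (hη : IsCharacteristic U t η)
    (hlip : ∀ τ ∈ Icc 0 t, ∀ x y, |U τ x - U τ y| ≤ M * |x - y|)
    {σ τ : ℝ} (hσ : σ ∈ Icc 0 t) (hτ : τ ∈ Icc 0 t) :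
    |γ σ - η σ| ≤ Real.exp (M * t) * |γ τ - η τ| := by
  -- The functions `(γ - η) ^ 2 * exp (± 2 M τ)` are monotone, respectively antitone.
  have hcont : ∀ B : ℝ, ContinuousOn (fun τ => (γ τ - η τ) ^ 2 * Real.exp (B * τ)) (Icc 0 t) :=
    fun B => ((hγ.continuousOn.sub hη.continuousOn).pow 2).mul (by fun_prop)
  have hder : ∀ B : ℝ, ∀ τ ∈ Ioo 0 t, HasDerivAt (fun τ => (γ τ - η τ) ^ 2 * Real.exp (B * τ))
      ((2 * (γ τ - η τ) * (U τ (γ τ) - U τ (η τ)) + B * (γ τ - η τ) ^ 2) * Real.exp (B * τ)) τ := by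
    intro B τ hτ
    have h1 := ((hγ.hasDerivAt hτ).sub (hη.hasDerivAt hτ)).pow 2
    have h2 := ((hasDerivAt_id τ).const_mul B).exp
    convert! h1.mul h2 using 1
    simp; ring
  have hkey : ∀ τ ∈ Ioo 0 t, |2 * (γ τ - η τ) * (U τ (γ τ) - U τ (η τ))| ≤
      2 * M * (γ τ - η τ) ^ 2 := by
    intro τ hτ
    rw [abs_mul, abs_mul, abs_two, ← sq_abs (γ τ - η τ)]
    have := hlip τ (Ioo_subset_Icc_self hτ) (γ τ) (η τ)
    nlinarith [abs_nonneg (γ τ - η τ)]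
  have hmono : MonotoneOn (fun τ => (γ τ - η τ) ^ 2 * Real.exp (2 * M * τ)) (Icc 0 t) := by
    refine monotoneOn_of_hasDerivWithinAt_nonneg (convex_Icc 0 t) (hcont _)
      (fun τ hτ => (hder _ τ (by simpa using hτ)).hasDerivWithinAt) fun τ hτ => ?_
    have := (abs_le.1 (hkey τ (by simpa using hτ))).1
    exact mul_nonneg (by linarith) (Real.exp_nonneg _)
  have hanti : AntitoneOn (fun τ => (γ τ - η τ) ^ 2 * Real.exp (-(2 * M) * τ)) (Icc 0 t) := by
    refine antitoneOn_of_hasDerivWithinAt_nonpos (convex_Icc 0 t) (hcont _)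
      (fun τ hτ => (hder _ τ (by simpa using hτ)).hasDerivWithinAt) fun τ hτ => ?_
    have := (abs_le.1 (hkey τ (by simpa using hτ))).2
    exact mul_nonpos_of_nonpos_of_nonneg (by linarith) (Real.exp_nonneg _)
  have hsq : (γ σ - η σ) ^ 2 ≤ (γ τ - η τ) ^ 2 * Real.exp (2 * M * t) := by
    rcases le_total σ τ with h | h
    · have h1 := hmono hσ hτ h
      simp only at h1
      calc (γ σ - η σ) ^ 2 ≤ (γ σ - η σ) ^ 2 * Real.exp (2 * M * σ) :=
            le_mul_of_one_le_right (sq_nonneg _)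
              (Real.one_le_exp (mul_nonneg (by positivity) hσ.1))
        _ ≤ _ := h1
        _ ≤ _ := by
            gcongr
            exact hτ.2
    · have h1 := hanti hτ hσ h
      simp only at h1
      have e : Real.exp (-(2 * M) * σ) * Real.exp (2 * M * σ) = 1 := by
        rw [← Real.exp_add]; simp
      calc (γ σ - η σ) ^ 2
          = (γ σ - η σ) ^ 2 * Real.exp (-(2 * M) * σ) * Real.exp (2 * M * σ) := by
            rw [mul_assoc, e, mul_one]
        _ ≤ (γ τ - η τ) ^ 2 * Real.exp (-(2 * M) * τ) * Real.exp (2 * M * σ) := by gcongr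
        _ ≤ (γ τ - η τ) ^ 2 * 1 * Real.exp (2 * M * t) := by
            gcongr
            · rw [Real.exp_le_one_iff]
              have := mul_nonneg hM hτ.1
              linarith
            · exact hσ.2
        _ = _ := by ring
  refine abs_le_of_sq_le_sq' ?_ (by positivity) |> abs_le.2
  rw [mul_pow, sq_abs, ← Real.exp_nat_mul]
  calc _ ≤ _ := hsq
    _ = _ := by rw [mul_comm]; congr 2; push_cast; ring

/-- Integration of a transport equation `Φ_t + U Φ_x = Ψ` along a characteristic. -/
theorem IsCharacteristic.sub_eq_integral {U Φ Φx Φt Ψ : ℝ → ℝ → ℝ} {t T : ℝ} {γ : ℝ → ℝ}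
    (hγ : IsCharacteristic U t γ) (ht : t < T)
    (hΦ : ContinuousOn (Function.uncurry Φ) (Ico 0 T ×ˢ univ))
    (hΦx : ContinuousOn (Function.uncurry Φx) (Ico 0 T ×ˢ univ))
    (hΦt : ContinuousOn (Function.uncurry Φt) (Ico 0 T ×ˢ univ))
    (hΨ : ContinuousOn (Function.uncurry Ψ) (Ico 0 T ×ˢ univ))
    (hx : ∀ τ ∈ Ico 0 T, ∀ x, HasDerivAt (Φ τ) (Φx τ x) x)
    (htd : ∀ τ ∈ Ioo 0 T, ∀ x, HasDerivAt (fun s => Φ s x) (Φt τ x) τ)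
    (heq : ∀ τ ∈ Ioo 0 T, ∀ x, Φt τ x + U τ x * Φx τ x = Ψ τ x) {τ : ℝ} (hτ : τ ∈ Icc 0 t) :
    Φ τ (γ τ) - Φ 0 (γ 0) = ∫ σ in (0 : ℝ)..τ, Ψ σ (γ σ) := by
  symm
  have hsub : Icc 0 τ ⊆ Icc 0 t := Icc_subset_Icc_right hτ.2
  refine intervalIntegral.integral_eq_sub_of_hasDerivAt_of_le hτ.1
    ((hγ.continuousOn_comp ht hΦ).mono hsub) (fun σ hσ => ?_)
    (((hγ.continuousOn_comp ht hΨ).mono hsub).intervalIntegrable_of_Icc hτ.1)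
  have hσt : σ ∈ Ioo 0 t := ⟨hσ.1, hσ.2.trans_le hτ.2⟩
  have hσT : σ ∈ Ioo 0 T := ⟨hσ.1, hσt.2.trans ht⟩
  have hnhd : Ioo 0 T ×ˢ (univ : Set ℝ) ∈ 𝓝 (σ, γ σ) :=
    prod_mem_nhds (Ioo_mem_nhds hσT.1 hσT.2) univ_mem
  have hnhd' : Ico 0 T ×ˢ (univ : Set ℝ) ∈ 𝓝 (σ, γ σ) :=
    mem_of_superset hnhd (prod_mono_left Ioo_subset_Ico_self)
  have hF : HasStrictFDerivAt (Function.uncurry Φ)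
      ((ContinuousLinearMap.toSpanSingleton ℝ (Φt σ (γ σ))).coprod
        (ContinuousLinearMap.toSpanSingleton ℝ (Φx σ (γ σ)))) (σ, γ σ) := by
    refine hasStrictFDerivAt_uncurry_coprod (𝕜 := ℝ) (u := (σ, γ σ)) (f := Φ)
      (f₁ := fun s x => ContinuousLinearMap.toSpanSingleton ℝ (Φt s x))
      (f₂ := fun s x => ContinuousLinearMap.toSpanSingleton ℝ (Φx s x)) ?_ ?_ ?_ ?_
    · filter_upwards [hnhd] with q hq
      exact (htd q.1 hq.1 q.2).hasFDerivAt
    · filter_upwards [hnhd'] with q hq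
      exact (hx q.1 hq.1 q.2).hasFDerivAt
    · exact (ContinuousLinearMap.toSpanSingletonCLE (𝕜 := ℝ) (E := ℝ)).continuous.continuousAt.comp
        (hΦt.continuousAt hnhd')
    · exact (ContinuousLinearMap.toSpanSingletonCLE (𝕜 := ℝ) (E := ℝ)).continuous.continuousAt.comp
        (hΦx.continuousAt hnhd')
  have hcurve : HasDerivAt (fun s => (s, γ s)) ((1 : ℝ), U σ (γ σ)) σ :=
    (hasDerivAt_id σ).prodMk (hγ.hasDerivAt hσt)
  have := hF.hasFDerivAt.comp_hasDerivAt σ hcurve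
  rw [← heq σ hσT]
  convert! this using 1
  simp

/-! ### Growth along characteristics -/

/-- Propagation of the space derivative `Φ_x` along characteristics for `Φ_t + U Φ_x = Ψ`. The
derivative is estimated through difference quotients along neighbouring characteristics, so that
neither `Φ_xx` nor a derivative of the flow is needed. -/
theorem abs_deriv_le_along_characteristic {U Φ Φx Ψ Ψx : ℝ → ℝ → ℝ} {t T M P : ℝ}
    (hM : 0 ≤ M) {γ : ℝ → ℝ → ℝ} (ht : t ∈ Ico 0 T)
    (hγ : ∀ z, IsCharacteristic U t (γ z)) (hγt : ∀ z, γ z t = z)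
    (hlip : ∀ τ ∈ Icc 0 t, ∀ x y, |U τ x - U τ y| ≤ M * |x - y|)
    (hΨ : ContinuousOn (Function.uncurry Ψ) (Ico 0 T ×ˢ univ))
    (hx : ∀ τ ∈ Ico 0 T, ∀ x, HasDerivAt (Φ τ) (Φx τ x) x)
    (hΨx : ∀ τ ∈ Ico 0 T, ∀ x, HasDerivAt (Ψ τ) (Ψx τ x) x)
    (hP : ∀ τ ∈ Ico 0 T, ∀ x, |Ψx τ x| ≤ P)
    (hint : ∀ z, ∀ τ ∈ Icc 0 t, Φ τ (γ z τ) - Φ 0 (γ z 0) = ∫ σ in (0 : ℝ)..τ, Ψ σ (γ z σ))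
    (z : ℝ) {τ : ℝ} (hτ : τ ∈ Icc 0 t) :
    |Φx τ (γ z τ)| ≤ Real.exp (M * t) *
      (|Φx 0 (γ z 0)| + ∫ σ in (0 : ℝ)..τ, |Ψx σ (γ z σ)|) := by
  set E := Real.exp (M * t) with hE
  have h0 : (0 : ℝ) ∈ Icc 0 t := ⟨le_rfl, ht.1⟩
  have htt : t ∈ Icc 0 t := ⟨ht.1, le_rfl⟩
  have hsubT : ∀ σ ∈ Icc 0 t, σ ∈ Ico 0 T := fun σ hσ => ⟨hσ.1, hσ.2.trans_lt ht.2⟩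
  have hdist : ∀ z', ∀ σ ∈ Icc 0 t, ∀ σ' ∈ Icc 0 t, |γ z' σ - γ z σ| ≤ E * |γ z' σ' - γ z σ'| :=
    fun z' σ hσ σ' hσ' => (hγ z').abs_sub_le_exp_mul hM (hγ z) hlip hσ hσ'
  have hne : ∀ z', z' ≠ z → ∀ σ ∈ Icc 0 t, γ z' σ ≠ γ z σ := by
    intro z' hz' σ hσ h
    have := hdist z' t htt σ hσ
    rw [hγt, hγt, h, sub_self, abs_zero, mul_zero, abs_nonpos_iff, sub_eq_zero] at this
    exact hz' this
  have hlim : ∀ σ ∈ Icc 0 t, Tendsto (fun z' => γ z' σ) (𝓝[≠] z) (𝓝[≠] (γ z σ)) := by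
    intro σ hσ
    refine tendsto_nhdsWithin_iff.2 ⟨?_, ?_⟩
    · refine Tendsto.mono_left ?_ nhdsWithin_le_nhds
      rw [tendsto_iff_dist_tendsto_zero]
      refine squeeze_zero (g := fun z' => E * |z' - z|) (fun _ => dist_nonneg) (fun z' => ?_) ?_
      · have := hdist z' σ hσ t htt
        rwa [hγt, hγt] at this
      · have : Continuous fun z' => E * |z' - z| := by fun_prop
        simpa using this.tendsto z
    · filter_upwards [self_mem_nhdsWithin] with z' hz'
      exact hne z' hz' σ hσ
  have hΨlip : ∀ σ ∈ Ico 0 T, ∀ x y, |slope (Ψ σ) x y| ≤ P := by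
    intro σ hσ x y
    have h1 := (convex_univ (𝕜 := ℝ) (E := ℝ)).norm_image_sub_le_of_norm_hasDerivWithin_le
      (f := Ψ σ) (C := P) (fun w _ => (hΨx σ hσ w).hasDerivWithinAt) (fun w _ => hP σ hσ w)
      (mem_univ x) (mem_univ y)
    rw [Real.norm_eq_abs, Real.norm_eq_abs] at h1
    rw [slope_def_field, abs_div]
    exact div_le_of_le_mul₀ (abs_nonneg _) ((abs_nonneg _).trans (hP σ hσ x)) h1
  have hsub : uIcc 0 τ ⊆ Icc 0 t := by
    rw [uIcc_of_le hτ.1]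
    exact Icc_subset_Icc_right hτ.2
  have hcontΨ : ∀ z', ContinuousOn (fun σ => Ψ σ (γ z' σ)) (Icc 0 t) := fun z' =>
    (hγ z').continuousOn_comp ht.2 hΨ
  have hcs : ∀ z', z' ≠ z → ContinuousOn (fun σ => |slope (Ψ σ) (γ z σ) (γ z' σ)|) (Icc 0 t) := by
    intro z' hz'
    simp only [slope_def_field]
    refine ContinuousOn.abs (((hcontΨ z').sub (hcontΨ z)).div
      ((hγ z').continuousOn.sub (hγ z).continuousOn) fun σ hσ => ?_)
    exact sub_ne_zero.2 (hne z' hz' σ hσ)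
  have hquot : ∀ᶠ z' in 𝓝[≠] z, |slope (Φ τ) (γ z τ) (γ z' τ)| ≤
      E * (|slope (Φ 0) (γ z 0) (γ z' 0)| +
        ∫ σ in (0 : ℝ)..τ, |slope (Ψ σ) (γ z σ) (γ z' σ)|) := by
    filter_upwards [self_mem_nhdsWithin] with z' hz'
    have hd : 0 < |γ z' τ - γ z τ| := abs_pos.2 (sub_ne_zero.2 (hne z' hz' τ hτ))
    have hmul : ∀ f : ℝ → ℝ, ∀ σ ∈ Icc 0 t, |f (γ z' σ) - f (γ z σ)| ≤
        |slope f (γ z σ) (γ z' σ)| * (E * |γ z' τ - γ z τ|) := by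
      intro f σ hσ
      have hd' : 0 < |γ z' σ - γ z σ| := abs_pos.2 (sub_ne_zero.2 (hne z' hz' σ hσ))
      rw [slope_def_field, abs_div]
      calc |f (γ z' σ) - f (γ z σ)|
          = |f (γ z' σ) - f (γ z σ)| / |γ z' σ - γ z σ| * |γ z' σ - γ z σ| := by field_simp
        _ ≤ _ := by gcongr; exact hdist z' σ hσ τ hτ
    rw [slope_def_field, abs_div, div_le_iff₀ hd]
    have e : Φ τ (γ z' τ) - Φ τ (γ z τ) = (Φ 0 (γ z' 0) - Φ 0 (γ z 0)) +
        ∫ σ in (0 : ℝ)..τ, (Ψ σ (γ z' σ) - Ψ σ (γ z σ)) := by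
      rw [intervalIntegral.integral_sub ((hcontΨ z').mono hsub).intervalIntegrable
        ((hcontΨ z).mono hsub).intervalIntegrable, ← hint z' τ hτ, ← hint z τ hτ]
      ring
    rw [e]
    calc _ ≤ |Φ 0 (γ z' 0) - Φ 0 (γ z 0)| +
          |∫ σ in (0 : ℝ)..τ, (Ψ σ (γ z' σ) - Ψ σ (γ z σ))| := abs_add_le _ _
      _ ≤ |slope (Φ 0) (γ z 0) (γ z' 0)| * (E * |γ z' τ - γ z τ|) +
          ∫ σ in (0 : ℝ)..τ, |slope (Ψ σ) (γ z σ) (γ z' σ)| * (E * |γ z' τ - γ z τ|) := by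
          refine add_le_add (hmul _ 0 h0) ?_
          refine (intervalIntegral.abs_integral_le_integral_abs hτ.1).trans ?_
          refine intervalIntegral.integral_mono_on hτ.1 ?_ ?_ fun σ hσ => ?_
          · exact (((hcontΨ z').sub (hcontΨ z)).abs.mono hsub).intervalIntegrable
          · exact (((hcs z' hz').mono hsub).mul continuousOn_const).intervalIntegrable
          · exact hmul _ σ ⟨hσ.1, hσ.2.trans hτ.2⟩
      _ = _ := by
          rw [intervalIntegral.integral_mul_const]
          ring
  have hL : ∀ (f fx : ℝ → ℝ → ℝ), ∀ σ ∈ Icc 0 t, HasDerivAt (f σ) (fx σ (γ z σ)) (γ z σ) →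
      Tendsto (fun z' => |slope (f σ) (γ z σ) (γ z' σ)|) (𝓝[≠] z) (𝓝 |fx σ (γ z σ)|) :=
    fun f fx σ hσ h => ((hasDerivAt_iff_tendsto_slope.1 h).comp (hlim σ hσ)).abs
  refine le_of_tendsto_of_tendsto (hL Φ Φx τ hτ (hx τ (hsubT τ hτ) _))
    ((((hL Φ Φx 0 h0 (hx 0 (hsubT 0 h0) _)).add ?_)).const_mul E) hquot
  refine intervalIntegral.tendsto_integral_filter_of_dominated_convergence (fun _ => P) ?_ ?_ ?_ ?_
  · filter_upwards [self_mem_nhdsWithin] with z' hz'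
    exact ((hcs z' hz').mono (uIoc_subset_uIcc.trans hsub)).aestronglyMeasurable
      measurableSet_uIoc
  · refine Eventually.of_forall fun z' => ae_of_all _ fun σ hσ => ?_
    rw [Real.norm_eq_abs, abs_abs]
    exact hΨlip σ (hsubT σ (hsub (uIoc_subset_uIcc hσ))) _ _
  · exact intervalIntegrable_const
  · refine ae_of_all _ fun σ hσ => ?_
    have hσ' := hsub (uIoc_subset_uIcc hσ)
    exact hL Ψ Ψx σ hσ' (hΨx σ (hsubT σ hσ') _)

/-- Grönwall's inequality in integral form for continuous nonnegative functions. -/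
theorem le_mul_exp_of_le_add_integral {f : ℝ → ℝ} {t A c : ℝ} (hc : 0 ≤ c) (hA : 0 ≤ A)
    (hf : ContinuousOn f (Icc 0 t)) (hf0 : ∀ τ ∈ Icc 0 t, 0 ≤ f τ)
    (h : ∀ τ ∈ Icc 0 t, f τ ≤ A + c * ∫ σ in (0 : ℝ)..τ, f σ) :
    ∀ τ ∈ Icc 0 t, f τ ≤ A * Real.exp (c * τ) := by
  intro τ hτ
  have hint : ∀ σ ∈ Icc 0 t, 0 ≤ ∫ s in (0 : ℝ)..σ, f s := fun σ hσ =>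
    intervalIntegral.integral_nonneg hσ.1 fun s hs => hf0 s ⟨hs.1, hs.2.trans hσ.2⟩
  have ht : 0 ≤ t := hτ.1.trans hτ.2
  have hfi : IntegrableOn f (Icc 0 t) := hf.integrableOn_Icc
  have hcont : ContinuousOn (fun σ => A + c * ∫ s in (0 : ℝ)..σ, f s) (Icc 0 t) := by
    refine continuousOn_const.add (continuousOn_const.mul ?_)
    have := intervalIntegral.continuousOn_primitive_interval (μ := volume) (f := f) (a := 0)
      (b := t) (by rwa [uIcc_of_le ht])
    rwa [uIcc_of_le ht] at this
  have hderiv : ∀ σ ∈ Ico 0 t,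
      HasDerivWithinAt (fun σ => A + c * ∫ s in (0 : ℝ)..σ, f s) (c * f σ) (Ici σ) σ := by
    intro σ hσ
    refine HasDerivWithinAt.const_add _ (HasDerivWithinAt.const_mul _ ?_)
    refine intervalIntegral.integral_hasDerivWithinAt_right (s := Ici σ) (t := Ioi σ) ?_ ?_ ?_
    · exact (hf.mono (Icc_subset_Icc_right hσ.2.le)).intervalIntegrable_of_Icc hσ.1
    · refine ⟨Ioo σ t, Ioo_mem_nhdsGT hσ.2, ?_⟩
      exact (hf.mono fun s hs => ⟨hσ.1.trans hs.1.le, hs.2.le⟩).aestronglyMeasurable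
        measurableSet_Ioo
    · refine (hf σ ⟨hσ.1, hσ.2.le⟩).mono_of_mem_nhdsWithin ?_
      exact mem_of_superset (Ioo_mem_nhdsGT hσ.2) fun s hs => ⟨hσ.1.trans hs.1.le, hs.2.le⟩
  have := norm_le_gronwallBound_of_norm_deriv_right_le (δ := A) (K := c) (ε := 0) hcont hderiv
    (by simp [abs_of_nonneg hA]) (fun σ hσ => ?_) τ hτ
  · rw [gronwallBound_ε0, sub_zero, Real.norm_eq_abs] at this
    exact (h τ hτ).trans ((le_abs_self _).trans this)
  · have hσ' := Ico_subset_Icc_self hσ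
    rw [add_zero, norm_mul, Real.norm_of_nonneg hc, Real.norm_of_nonneg (hf0 σ hσ'),
      Real.norm_of_nonneg (add_nonneg hA (mul_nonneg hc (hint σ hσ')))]
    exact mul_le_mul_of_nonneg_left (h σ hσ') hc

theorem lintegral_expKernel_ne_top : ∫⁻ x, expKernel x ≠ ⊤ := by
  have := (integrable_exp_neg_mul_abs one_pos).lintegral_lt_top.ne
  simpa only [one_mul, expKernel] using this

theorem expKernel_le_of_abs_sub_le {x z y D : ℝ} (h : |z - x| ≤ D) :
    expKernel (x - y) ≤ ENNReal.ofReal (Real.exp D) * expKernel (z - y) := by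
  rw [expKernel, expKernel, ← ENNReal.ofReal_mul (Real.exp_nonneg _), ← Real.exp_add]
  refine ENNReal.ofReal_le_ofReal (Real.exp_le_exp.2 ?_)
  have := abs_add_le (z - x) (x - y)
  rw [sub_add_sub_cancel] at this
  linarith

/-- The total size `|u| + |u_x| + |u_xx| + |ρ| + |ρ_x|` of a solution at a point. -/
noncomputable def solSize (U U₁ U₂ R R₁ : ℝ → ℝ → ℝ) (t x : ℝ) : ℝ :=
  |U t x| + |U₁ t x| + |U₂ t x| + |R t x| + |R₁ t x|

/-! ### The pointwise estimate -/

theorem solSize_nonneg (U U₁ U₂ R R₁ : ℝ → ℝ → ℝ) (t x : ℝ) : 0 ≤ solSize U U₁ U₂ R R₁ t x := by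
  unfold solSize; positivity

theorem sq_add_sq_le_solSize_sq (U U₁ U₂ R R₁ : ℝ → ℝ → ℝ) (t x : ℝ) :
    U t x ^ 2 + U₁ t x ^ 2 / 2 + R t x ^ 2 / 2 ≤ solSize U U₁ U₂ R R₁ t x ^ 2 := by
  rw [← sq_abs (U t x), ← sq_abs (U₁ t x), ← sq_abs (R t x), solSize]
  have h1 := abs_nonneg (U t x)
  have h2 := abs_nonneg (U₁ t x)
  have h3 := abs_nonneg (U₂ t x)
  have h4 := abs_nonneg (R t x)
  have h5 := abs_nonneg (R₁ t x)
  nlinarith [mul_nonneg h1 h2, mul_nonneg h1 h4, mul_nonneg h2 h4,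
    mul_nonneg (add_nonneg h3 h5) (add_nonneg (add_nonneg h1 h2) h4), mul_nonneg h3 h5]

section

variable {T M : ℝ} {U U₁ U₂ R R₁ V W : ℝ → ℝ → ℝ}

theorem IsClassicalSolution.lipschitz_U (h : IsClassicalSolution T M U U₁ U₂ R R₁ V W)
    {t : ℝ} (ht : t ∈ Ico 0 T) (x y : ℝ) : |U t x - U t y| ≤ M * |x - y| := by
  have := (convex_univ (𝕜 := ℝ) (E := ℝ)).norm_image_sub_le_of_norm_hasDerivWithin_le
      (f := U t) (C := M) (fun w _ => (h.deriv_U t ht w).hasDerivWithinAt)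
      (fun w _ => h.U₁_le t ht w) (mem_univ y) (mem_univ x)
  simpa using this

theorem IsClassicalSolution.continuousOn_solSize
    (h : IsClassicalSolution T M U U₁ U₂ R R₁ V W) :
    ContinuousOn (Function.uncurry (solSize U U₁ U₂ R R₁)) (Ico 0 T ×ˢ univ) :=
  (((h.cont_U.abs.add h.cont_U₁.abs).add h.cont_U₂.abs).add h.cont_R.abs).add h.cont_R₁.abs

/-- A uniform bound for `W`; the pointwise estimate uses that it exists, and not its value. -/
theorem IsClassicalSolution.exists_W_bound (h : IsClassicalSolution T M U U₁ U₂ R R₁ V W) :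
    ∃ P : ℝ, ∀ t ∈ Ico 0 T, ∀ x, |W t x| ≤ P := by
  set Q : ℝ≥0∞ := (∫⁻ x, expKernel x) * ENNReal.ofReal (2 * M ^ 2) with hQ
  have hQtop : Q ≠ ⊤ := ENNReal.mul_ne_top lintegral_expKernel_ne_top ENNReal.ofReal_ne_top
  refine ⟨Q.toReal, fun t ht x => ?_⟩
  rw [← ENNReal.ofReal_le_iff_le_toReal hQtop]
  refine (h.W_le t ht x).trans ?_
  rw [hQ, ← lintegral_sub_left_eq_self expKernel x, ← lintegral_mul_const' _ _ ENNReal.ofReal_ne_top]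
  refine lintegral_mono fun y => mul_le_mul_right (ENNReal.ofReal_le_ofReal ?_) _
  have h1 := sq_le_sq' (abs_le.1 (h.U_le t ht y)).1 (abs_le.1 (h.U_le t ht y)).2
  have h2 := sq_le_sq' (abs_le.1 (h.U₁_le t ht y)).1 (abs_le.1 (h.U₁_le t ht y)).2
  have h3 := sq_le_sq' (abs_le.1 (h.R_le t ht y)).1 (abs_le.1 (h.R_le t ht y)).2
  linarith

/-- Along a characteristic, the size of the solution is controlled by its initial size and by the
nonlocal terms. -/
theorem IsClassicalSolution.solSize_le (h : IsClassicalSolution T M U U₁ U₂ R R₁ V W)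
    (hM : 0 ≤ M) {t : ℝ} (ht : t ∈ Ico 0 T) {γ : ℝ → ℝ → ℝ}
    (hγ : ∀ z, IsCharacteristic U t (γ z)) (hγt : ∀ z, γ z t = z) (z : ℝ) :
    solSize U U₁ U₂ R R₁ t z ≤ (Real.exp (M * t) * solSize U U₁ U₂ R R₁ 0 (γ z 0) +
      2 * Real.exp (M * t) * ∫ σ in (0 : ℝ)..t, (|V σ (γ z σ)| + |W σ (γ z σ)|)) *
        Real.exp (3 * Real.exp (M * t) * M * t) := by
  obtain ⟨P, hP⟩ := h.exists_W_bound
  set E := Real.exp (M * t) with hE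
  have hE1 : 1 ≤ E := Real.one_le_exp (mul_nonneg hM ht.1)
  have htt : t ∈ Icc 0 t := ⟨ht.1, le_rfl⟩
  have hsubT : ∀ σ ∈ Icc 0 t, σ ∈ Ico 0 T := fun σ hσ => ⟨hσ.1, hσ.2.trans_lt ht.2⟩
  have hlip : ∀ τ ∈ Icc 0 t, ∀ x y, |U τ x - U τ y| ≤ M * |x - y| := fun τ hτ x y =>
    h.lipschitz_U (hsubT τ hτ) x y
  have hcU := h.cont_U
  have hcU₁ := h.cont_U₁
  have hcU₂ := h.cont_U₂
  have hcR := h.cont_R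
  have hcR₁ := h.cont_R₁
  have hcV := h.cont_V
  have hcW := h.cont_W
  -- The right-hand sides of the transport equations for `U₁` and `R`, and their derivatives.
  set H : ℝ → ℝ → ℝ := fun t x => V t x + U t x ^ 2 - U₁ t x ^ 2 / 2 + R t x ^ 2 / 2 with hH
  set H' : ℝ → ℝ → ℝ := fun t x => W t x + 2 * U t x * U₁ t x - U₁ t x * U₂ t x + R t x * R₁ t x
    with hH'
  set S : ℝ → ℝ → ℝ := fun t x => -(U₁ t x * R t x) with hS
  set S' : ℝ → ℝ → ℝ := fun t x => -(U₂ t x * R t x + U₁ t x * R₁ t x) with hS'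
  have hcH : ContinuousOn (Function.uncurry H) (Ico 0 T ×ˢ univ) :=
    ((hcV.add (hcU.pow 2)).sub ((hcU₁.pow 2).div_const 2)).add ((hcR.pow 2).div_const 2)
  have hcH' : ContinuousOn (Function.uncurry H') (Ico 0 T ×ˢ univ) :=
    ((hcW.add ((continuousOn_const.mul hcU).mul hcU₁)).sub (hcU₁.mul hcU₂)).add (hcR.mul hcR₁)
  have hcS : ContinuousOn (Function.uncurry S) (Ico 0 T ×ˢ univ) := (hcU₁.mul hcR).neg
  have hcS' : ContinuousOn (Function.uncurry S') (Ico 0 T ×ˢ univ) :=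
    ((hcU₂.mul hcR).add (hcU₁.mul hcR₁)).neg
  have hdH : ∀ τ ∈ Ico 0 T, ∀ x, HasDerivAt (H τ) (H' τ x) x := by
    intro τ hτ x
    have := (((h.deriv_V τ hτ x).add ((h.deriv_U τ hτ x).pow 2)).sub
      (((h.deriv_U₁ τ hτ x).pow 2).div_const 2)).add (((h.deriv_R τ hτ x).pow 2).div_const 2)
    convert! this using 1
    simp [hH']; ring
  have hdS : ∀ τ ∈ Ico 0 T, ∀ x, HasDerivAt (S τ) (S' τ x) x := by
    intro τ hτ x
    exact ((h.deriv_U₁ τ hτ x).mul (h.deriv_R τ hτ x)).neg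
  have hmul : ∀ a b : ℝ, |a| ≤ M → |a * b| ≤ M * |b| := fun a b ha => by
    rw [abs_mul]; gcongr
  have hU2 : ∀ τ ∈ Ico 0 T, ∀ x, |H' τ x| ≤
      |W τ x| + M * (2 * |U τ x| + |U₂ τ x| + |R₁ τ x|) := by
    intro τ hτ x
    have h1 := hmul (U₁ τ x) (2 * U τ x) (h.U₁_le τ hτ x)
    have h2 := hmul (U₁ τ x) (U₂ τ x) (h.U₁_le τ hτ x)
    have h3 := hmul (R τ x) (R₁ τ x) (h.R_le τ hτ x)
    rw [abs_mul 2, abs_two] at h1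
    calc |H' τ x| = |W τ x + U₁ τ x * (2 * U τ x) - U₁ τ x * U₂ τ x + R τ x * R₁ τ x| := by
          simp only [hH']; congr 1; ring
      _ ≤ |W τ x| + |U₁ τ x * (2 * U τ x)| + |U₁ τ x * U₂ τ x| + |R τ x * R₁ τ x| :=
          (abs_add_le _ _).trans (add_le_add_left ((abs_sub _ _).trans
            (add_le_add_left (abs_add_le _ _) _)) _)
      _ ≤ _ := by linarith
  have hR1 : ∀ τ ∈ Ico 0 T, ∀ x, |S' τ x| ≤ M * (|R τ x| + |R₁ τ x|) := by
    intro τ hτ x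
    have h2 := hmul (U₂ τ x) (R τ x) (h.U₂_le τ hτ x)
    have h3 := hmul (U₁ τ x) (R₁ τ x) (h.U₁_le τ hτ x)
    rw [hS', abs_neg]
    linarith [abs_add_le (U₂ τ x * R τ x) (U₁ τ x * R₁ τ x)]
  have hU1 : ∀ τ ∈ Ico 0 T, ∀ x, |H τ x| ≤ |V τ x| + M * (|U τ x| + |U₁ τ x| + |R τ x|) := by
    intro τ hτ x
    have h1 := hmul (U τ x) (U τ x) (h.U_le τ hτ x)
    have h2 := hmul (U₁ τ x) (U₁ τ x) (h.U₁_le τ hτ x)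
    have h3 := hmul (R τ x) (R τ x) (h.R_le τ hτ x)
    have h2' : 0 ≤ M * |U₁ τ x| := by positivity
    have h3' : 0 ≤ M * |R τ x| := by positivity
    simp only [hH]
    rw [abs_mul_self] at h1 h2 h3
    have := neg_abs_le (V τ x)
    have := le_abs_self (V τ x)
    rw [abs_le]
    constructor <;> nlinarith [sq_nonneg (U τ x), sq_nonneg (U₁ τ x), sq_nonneg (R τ x)]
  have hH'P : ∀ τ ∈ Ico 0 T, ∀ x, |H' τ x| ≤ P + M * (4 * M) := by
    intro τ hτ x
    refine (hU2 τ hτ x).trans (add_le_add (hP τ hτ x) (mul_le_mul_of_nonneg_left ?_ hM))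
    linarith [h.U_le τ hτ x, h.U₂_le τ hτ x, h.R₁_le τ hτ x]
  have hS'P : ∀ τ ∈ Ico 0 T, ∀ x, |S' τ x| ≤ M * (2 * M) := by
    intro τ hτ x
    refine (hR1 τ hτ x).trans (mul_le_mul_of_nonneg_left ?_ hM)
    linarith [h.R_le τ hτ x, h.R₁_le τ hτ x]
  have iU : ∀ z, ∀ τ ∈ Icc 0 t, U τ (γ z τ) - U 0 (γ z 0) = ∫ σ in (0 : ℝ)..τ, W σ (γ z σ) :=
    fun z τ hτ => (hγ z).sub_eq_integral (Φt := fun t x => W t x - U t x * U₁ t x) ht.2 hcU hcU₁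
      (hcW.sub (hcU.mul hcU₁)) hcW h.deriv_U
      h.time_U (fun τ _ x => by ring) hτ
  have hcU₁t : ContinuousOn (Function.uncurry fun t x => V t x +
      (U t x ^ 2 + U₁ t x ^ 2 / 2 + R t x ^ 2 / 2) - U₁ t x ^ 2 - U t x * U₂ t x)
      (Ico 0 T ×ˢ univ) := by
    have hcF : ContinuousOn (Function.uncurry fun t x => U t x ^ 2 + U₁ t x ^ 2 / 2 +
        R t x ^ 2 / 2) (Ico 0 T ×ˢ univ) :=
      ((hcU.pow 2).add ((hcU₁.pow 2).div_const 2)).add ((hcR.pow 2).div_const 2)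
    exact ((hcV.add hcF).sub (hcU₁.pow 2)).sub (hcU.mul hcU₂)
  have iU₁ : ∀ z, ∀ τ ∈ Icc 0 t, U₁ τ (γ z τ) - U₁ 0 (γ z 0) = ∫ σ in (0 : ℝ)..τ, H σ (γ z σ) :=
    fun z τ hτ => (hγ z).sub_eq_integral (Φt := fun t x => V t x +
        (U t x ^ 2 + U₁ t x ^ 2 / 2 + R t x ^ 2 / 2) - U₁ t x ^ 2 - U t x * U₂ t x) ht.2 hcU₁ hcU₂
      hcU₁t hcH h.deriv_U₁
      h.time_U₁ (fun τ _ x => by simp only [hH]; ring) hτ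
  have iR : ∀ z, ∀ τ ∈ Icc 0 t, R τ (γ z τ) - R 0 (γ z 0) = ∫ σ in (0 : ℝ)..τ, S σ (γ z σ) :=
    fun z τ hτ => (hγ z).sub_eq_integral (Φt := fun t x => -(U₁ t x * R t x) - U t x * R₁ t x)
      ht.2 hcR hcR₁
      ((hcU₁.mul hcR).neg.sub (hcU.mul hcR₁)) hcS h.deriv_R
      h.time_R (fun τ _ x => by simp only [hS]; ring) hτ
  have comp : ∀ {f : ℝ → ℝ → ℝ}, ContinuousOn (Function.uncurry f) (Ico 0 T ×ˢ univ) →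
      ContinuousOn (fun τ => f τ (γ z τ)) (Icc 0 t) := fun hf => (hγ z).continuousOn_comp ht.2 hf
  set s : ℝ → ℝ := fun τ => solSize U U₁ U₂ R R₁ τ (γ z τ) with hs
  set g : ℝ → ℝ := fun τ => |V τ (γ z τ)| + |W τ (γ z τ)| with hg
  have hsc : ContinuousOn s (Icc 0 t) := comp h.continuousOn_solSize
  have hgc : ContinuousOn g (Icc 0 t) := (comp hcV).abs.add (comp hcW).abs
  have hs0 : ∀ τ, 0 ≤ s τ := fun τ => solSize_nonneg _ _ _ _ _ _ _
  have hg0 : ∀ τ, 0 ≤ g τ := fun τ => by simp only [hg]; positivity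
  have hgi : 0 ≤ ∫ σ in (0 : ℝ)..t, g σ :=
    intervalIntegral.integral_nonneg ht.1 fun σ _ => hg0 σ
  have hmain : ∀ τ ∈ Icc 0 t, s τ ≤ (E * s 0 + 2 * E * ∫ σ in (0 : ℝ)..t, g σ) +
      3 * E * M * ∫ σ in (0 : ℝ)..τ, s σ := by
    intro τ hτ
    have hsub : uIcc 0 τ ⊆ Icc 0 t := by
      rw [uIcc_of_le hτ.1]; exact Icc_subset_Icc_right hτ.2
    have ii : ∀ {f : ℝ → ℝ → ℝ}, ContinuousOn (Function.uncurry f) (Ico 0 T ×ˢ univ) →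
        IntervalIntegrable (fun σ => |f σ (γ z σ)|) volume 0 τ := fun hf =>
      ((comp hf).abs.mono hsub).intervalIntegrable
    have b0 : ∀ {f Ψ : ℝ → ℝ → ℝ}, (f τ (γ z τ) - f 0 (γ z 0) = ∫ σ in (0 : ℝ)..τ, Ψ σ (γ z σ)) →
        |f τ (γ z τ)| ≤ |f 0 (γ z 0)| + ∫ σ in (0 : ℝ)..τ, |Ψ σ (γ z σ)| := by
      intro f Ψ e
      have e' : f τ (γ z τ) = f 0 (γ z 0) + ∫ σ in (0 : ℝ)..τ, Ψ σ (γ z σ) := by rw [← e]; ring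
      rw [e']
      exact (abs_add_le _ _).trans (add_le_add_right
        (intervalIntegral.abs_integral_le_integral_abs hτ.1) _)
    have b1 := b0 (iU z τ hτ)
    have b2 := b0 (iU₁ z τ hτ)
    have b3 := b0 (iR z τ hτ)
    have b4 := abs_deriv_le_along_characteristic hM ht hγ hγt hlip hcH h.deriv_U₁ hdH hH'P iU₁ z hτ
    have b5 := abs_deriv_le_along_characteristic hM ht hγ hγt hlip hcS h.deriv_R hdS hS'P iR z hτ
    have bsum : (∫ σ in (0 : ℝ)..τ, |W σ (γ z σ)|) + (∫ σ in (0 : ℝ)..τ, |H σ (γ z σ)|) +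
        (∫ σ in (0 : ℝ)..τ, |S σ (γ z σ)|) + E * (∫ σ in (0 : ℝ)..τ, |H' σ (γ z σ)|) +
        E * (∫ σ in (0 : ℝ)..τ, |S' σ (γ z σ)|) ≤
        ∫ σ in (0 : ℝ)..τ, (2 * E * g σ + 3 * E * M * s σ) := by
      rw [← intervalIntegral.integral_const_mul, ← intervalIntegral.integral_const_mul,
        ← intervalIntegral.integral_add (ii hcW) (ii hcH),
        ← intervalIntegral.integral_add ((ii hcW).add (ii hcH)) (ii hcS),
        ← intervalIntegral.integral_add (((ii hcW).add (ii hcH)).add (ii hcS))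
          ((ii hcH').const_mul E),
        ← intervalIntegral.integral_add ((((ii hcW).add (ii hcH)).add (ii hcS)).add
          ((ii hcH').const_mul E)) ((ii hcS').const_mul E)]
      refine intervalIntegral.integral_mono_on hτ.1 ?_ ?_ fun σ hσ => ?_
      · exact ((((ii hcW).add (ii hcH)).add (ii hcS)).add ((ii hcH').const_mul E)).add
          ((ii hcS').const_mul E)
      · exact (((continuousOn_const.mul hgc).add (continuousOn_const.mul hsc)).mono
          hsub).intervalIntegrable
      · have hσT := hsubT σ ⟨hσ.1, hσ.2.trans hτ.2⟩
        have c1 := hU1 σ hσT (γ z σ)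
        have c2 := mul_le_mul_of_nonneg_left (hU2 σ hσT (γ z σ)) (zero_le_one.trans hE1)
        have c3 := mul_le_mul_of_nonneg_left (hR1 σ hσT (γ z σ)) (zero_le_one.trans hE1)
        have c4 : |S σ (γ z σ)| ≤ M * |R σ (γ z σ)| := by
          simp only [hS]
          rw [abs_neg]
          exact hmul _ _ (h.U₁_le σ hσT _)
        have d0 : ∀ x : ℝ, M * |x| ≤ E * (M * |x|) := fun x =>
          le_mul_of_one_le_left (by positivity) hE1
        have d1 := d0 (U σ (γ z σ))
        have d2 := d0 (U₁ σ (γ z σ))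
        have d3 := d0 (R σ (γ z σ))
        have e0 : ∀ x : ℝ, 0 ≤ E * (M * |x|) := fun x => by positivity
        have e1 := e0 (U σ (γ z σ))
        have e2 := e0 (U₁ σ (γ z σ))
        have e3 := e0 (R σ (γ z σ))
        have e4 := e0 (U₂ σ (γ z σ))
        have e5 := e0 (R₁ σ (γ z σ))
        have f1 : |V σ (γ z σ)| ≤ E * |V σ (γ z σ)| := le_mul_of_one_le_left (abs_nonneg _) hE1
        have f2 : |W σ (γ z σ)| ≤ E * |W σ (γ z σ)| := le_mul_of_one_le_left (abs_nonneg _) hE1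
        have f3 : 0 ≤ E * |V σ (γ z σ)| := by positivity
        simp only [hg, hs, solSize]
        linarith
    rw [intervalIntegral.integral_add, intervalIntegral.integral_const_mul,
      intervalIntegral.integral_const_mul] at bsum
    · have hmonog : ∫ σ in (0 : ℝ)..τ, g σ ≤ ∫ σ in (0 : ℝ)..t, g σ :=
        intervalIntegral.integral_mono_interval le_rfl hτ.1 hτ.2 (ae_of_all _ fun σ => hg0 σ)
          (hgc.intervalIntegrable_of_Icc ht.1)
      have hmonog' := mul_le_mul_of_nonneg_left hmonog (show 0 ≤ 2 * E by positivity)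
      have g0 : ∀ x : ℝ, |x| ≤ E * |x| := fun x => le_mul_of_one_le_left (abs_nonneg _) hE1
      have g1 := g0 (U 0 (γ z 0))
      have g2 := g0 (U₁ 0 (γ z 0))
      have g3 := g0 (R 0 (γ z 0))
      have hs0' : E * s 0 = E * |U 0 (γ z 0)| + E * |U₁ 0 (γ z 0)| + E * |U₂ 0 (γ z 0)| +
          E * |R 0 (γ z 0)| + E * |R₁ 0 (γ z 0)| := by
        simp only [hs, solSize]; ring
      have hsτ : s τ = |U τ (γ z τ)| + |U₁ τ (γ z τ)| + |U₂ τ (γ z τ)| + |R τ (γ z τ)| +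
          |R₁ τ (γ z τ)| := rfl
      rw [hs0', hsτ]
      linarith
    · exact ((continuousOn_const.mul hgc).mono hsub).intervalIntegrable
    · exact ((continuousOn_const.mul hsc).mono hsub).intervalIntegrable
  have := le_mul_exp_of_le_add_integral (by positivity)
    (add_nonneg (mul_nonneg (by positivity) (hs0 0)) (by positivity)) hsc (fun τ _ => hs0 τ)
    hmain t htt
  simpa only [hs, hγt] using this

end

/-! ### The transport estimate -/

open Classical in
/-- The size of a solution as a `[0, ∞]`-valued function, extended by `0` outside `[0, T)`. -/
noncomputable def solENorm (T : ℝ) (U U₁ U₂ R R₁ : ℝ → ℝ → ℝ) (t x : ℝ) : ℝ≥0∞ :=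
  if t ∈ Ico 0 T then ENNReal.ofReal (solSize U U₁ U₂ R R₁ t x) else 0

theorem solENorm_of_mem {T : ℝ} {t : ℝ} (ht : t ∈ Ico 0 T) (U U₁ U₂ R R₁ : ℝ → ℝ → ℝ) (x : ℝ) :
    solENorm T U U₁ U₂ R R₁ t x = ENNReal.ofReal (solSize U U₁ U₂ R R₁ t x) := if_pos ht

/-- A map of the line that contracts distances at most by the factor `K` distorts Lebesgue measure at
most by `K`: the preimage of a set is its image under a `K`-Lipschitz inverse. -/
theorem map_le_smul_of_le_mul_abs {X : ℝ → ℝ} (hX : Measurable X) {K : NNReal}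
    (h : ∀ x y, |x - y| ≤ K * |X x - X y|) :
    Measure.map X volume ≤ (K : ℝ≥0∞) • volume := by
  have hanti : AntilipschitzWith K X := AntilipschitzWith.of_le_mul_dist fun x y => by
    simpa only [Real.dist_eq] using h x y
  refine Measure.le_iff.2 fun s hs => ?_
  rw [Measure.map_apply hX hs, ← hausdorffMeasure_real]
  have := hanti.hausdorffMeasure_preimage_le zero_le_one s
  rwa [ENNReal.rpow_one] at this

section

variable {T M : ℝ} {U U₁ U₂ R R₁ V W : ℝ → ℝ → ℝ}

theorem IsClassicalSolution.measurable_solENorm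
    (h : IsClassicalSolution T M U U₁ U₂ R R₁ V W) :
    Measurable (Function.uncurry (solENorm T U U₁ U₂ R R₁)) := by
  classical
  have hc := ENNReal.continuous_ofReal.comp_continuousOn h.continuousOn_solSize
  have hm : MeasurableSet (Ico 0 T ×ˢ (univ : Set ℝ)) := measurableSet_Ico.prod .univ
  have := hc.measurable_piecewise (g := fun _ => (0 : ℝ≥0∞)) continuousOn_const hm
  convert this using 1
  refine funext fun q => ?_
  by_cases hq : q.1 ∈ Ico 0 T
  · rw [piecewise_eq_of_mem _ _ _ (show q ∈ Ico 0 T ×ˢ univ from ⟨hq, mem_univ _⟩)]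
    exact if_pos hq
  · rw [piecewise_eq_of_notMem _ _ _ (show q ∉ Ico 0 T ×ˢ univ from fun hq' => hq hq'.1)]
    exact if_neg hq

theorem IsClassicalSolution.solENorm_le (h : IsClassicalSolution T M U U₁ U₂ R R₁ V W) (t x : ℝ) :
    solENorm T U U₁ U₂ R R₁ t x ≤ (5 * M).toNNReal := by
  unfold solENorm
  split_ifs with ht
  · refine ENNReal.ofReal_le_ofReal ?_
    unfold solSize
    linarith [h.U_le t ht x, h.U₁_le t ht x, h.U₂_le t ht x, h.R_le t ht x, h.R₁_le t ht x]
  · exact zero_le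

/-- The transport estimate: the size of the solution at time `t` and position `z` is controlled by
the initial size at the foot `X t z` of the characteristic through `(t, z)`, and by the convolution
of the squared size with the exponential kernel. Characteristics move by at most `M T`, so that the
kernel may be centred at `z`. -/
theorem IsClassicalSolution.exists_transport_estimate
    (h : IsClassicalSolution T M U U₁ U₂ R R₁ V W) (hM : 0 ≤ M) (hT : 0 < T) :
    ∃ (X : ℝ → ℝ → ℝ) (K C : NNReal), 1 ≤ K ∧ (∀ t ∈ Ico 0 T, Measurable (X t)) ∧
      (∀ t ∈ Ico 0 T, ∀ z, |z - X t z| ≤ M * T) ∧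
      (∀ t ∈ Ico 0 T, Measure.map (X t) volume ≤ (K : ℝ≥0∞) • volume) ∧
      ∀ t ∈ Ico 0 T, ∀ z, solENorm T U U₁ U₂ R R₁ t z ≤
        C * (solENorm T U U₁ U₂ R R₁ 0 (X t z) +
          ∫⁻ σ in Ioo 0 t, ∫⁻ y, expKernel (z - y) * solENorm T U U₁ U₂ R R₁ σ y ^ 2) := by
  have hex : ∀ t, ∃ γ : ℝ → ℝ → ℝ, t ∈ Ico 0 T →
      ∀ z, IsCharacteristic U t (γ z) ∧ γ z t = z := by
    intro t
    by_cases ht : t ∈ Ico 0 T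
    · choose γ hγ using exists_isCharacteristic hM h.cont_U
        (fun s hs => h.lipschitz_U hs) h.U_le ht
      exact ⟨γ, fun _ => hγ⟩
    · exact ⟨fun _ _ => 0, fun ht' => absurd ht' ht⟩
  choose γ hγ using hex
  set E : ℝ := Real.exp (M * T) with hE
  have hE1 : 1 ≤ E := Real.one_le_exp (mul_nonneg hM hT.le)
  have hEt : ∀ t ∈ Ico 0 T, Real.exp (M * t) ≤ E := fun t ht => by
    rw [hE]; gcongr; exact ht.2.le
  have hsubT : ∀ t ∈ Ico 0 T, ∀ σ ∈ Icc 0 t, σ ∈ Ico 0 T :=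
    fun t ht σ hσ => ⟨hσ.1, hσ.2.trans_lt ht.2⟩
  have hsep : ∀ t ∈ Ico 0 T, ∀ σ ∈ Icc 0 t, ∀ τ ∈ Icc 0 t, ∀ z z',
      |γ t z σ - γ t z' σ| ≤ E * |γ t z τ - γ t z' τ| := by
    intro t ht σ hσ τ hτ z z'
    refine ((hγ t ht z).1.abs_sub_le_exp_mul hM (hγ t ht z').1
      (fun s hs x y => h.lipschitz_U (hsubT t ht s hs) x y) hσ hτ).trans ?_
    gcongr
    exact hEt t ht
  have h0 : ∀ t ∈ Ico 0 T, (0 : ℝ) ∈ Icc 0 t := fun t ht => ⟨le_rfl, ht.1⟩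
  have htt : ∀ t ∈ Ico 0 T, t ∈ Icc 0 t := fun t ht => ⟨ht.1, le_rfl⟩
  have hmove : ∀ t ∈ Ico 0 T, ∀ z, ∀ σ ∈ Icc 0 t, |z - γ t z σ| ≤ M * T := by
    intro t ht z σ hσ
    have := (hγ t ht z).1.abs_sub_le (fun s hs x => h.U_le s (hsubT t ht s hs) x) hσ (htt t ht)
    rw [(hγ t ht z).2] at this
    refine this.trans (mul_le_mul_of_nonneg_left ?_ hM)
    rw [abs_of_nonneg (sub_nonneg.2 hσ.2)]
    linarith [hσ.1, ht.2]
  have hXm : ∀ t ∈ Ico 0 T, Measurable fun z => γ t z 0 := by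
    intro t ht
    refine (LipschitzWith.of_dist_le_mul (K := E.toNNReal) fun z z' => ?_).continuous.measurable
    rw [Real.coe_toNNReal _ (by positivity), Real.dist_eq, Real.dist_eq]
    have := hsep t ht 0 (h0 t ht) t (htt t ht) z z'
    rwa [(hγ t ht z).2, (hγ t ht z').2] at this
  set G : ℝ := Real.exp (3 * E * M * T) with hG
  refine ⟨fun t z => γ t z 0, E.toNNReal, (4 * E * E * G).toNNReal, ?_, hXm,
    fun t ht z => hmove t ht z 0 (h0 t ht), fun t ht => ?_, fun t ht z => ?_⟩
  · rw [← Real.toNNReal_one]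
    exact Real.toNNReal_le_toNNReal hE1
  · refine map_le_smul_of_le_mul_abs (hXm t ht) fun z z' => ?_
    rw [Real.coe_toNNReal _ (by positivity)]
    have := hsep t ht t (htt t ht) 0 (h0 t ht) z z'
    rwa [(hγ t ht z).2, (hγ t ht z').2] at this
  · set s := solSize U U₁ U₂ R R₁ with hs
    set N : ℝ≥0∞ := ∫⁻ σ in Ioo 0 t, ∫⁻ y, expKernel (z - y) * solENorm T U U₁ U₂ R R₁ σ y ^ 2
      with hN
    have hs0 : 0 ≤ s 0 (γ t z 0) := solSize_nonneg _ _ _ _ _ _ _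
    set I : ℝ := ∫ σ in (0 : ℝ)..t, (|V σ (γ t z σ)| + |W σ (γ t z σ)|) with hI
    have hI0 : 0 ≤ I := intervalIntegral.integral_nonneg ht.1 fun σ _ => by positivity
    have hbase : s t z ≤ 2 * E * G * (s 0 (γ t z 0) + I) := by
      refine (h.solSize_le hM ht (fun z => (hγ t ht z).1) (fun z => (hγ t ht z).2) z).trans ?_
      have e1 := hEt t ht
      have e2 : Real.exp (3 * Real.exp (M * t) * M * t) ≤ G := by
        rw [hG]; gcongr; exacts [ht.1, ht.2.le]
      calc _ ≤ (E * s 0 (γ t z 0) + 2 * E * I) * G := by gcongr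
        _ ≤ (2 * E * s 0 (γ t z 0) + 2 * E * I) * G := by
            gcongr
            linarith
        _ = _ := by ring
    have hcont : ContinuousOn (fun σ => |V σ (γ t z σ)| + |W σ (γ t z σ)|) (Icc 0 t) :=
      ((hγ t ht z).1.continuousOn_comp ht.2 h.cont_V).abs.add
        ((hγ t ht z).1.continuousOn_comp ht.2 h.cont_W).abs
    have hIN : ENNReal.ofReal I ≤ ENNReal.ofReal (2 * E) * N := by
      rw [hI, intervalIntegral.integral_of_le ht.1, integral_Ioc_eq_integral_Ioo,
        ofReal_integral_eq_lintegral_ofReal (hcont.integrableOn_Icc.mono_set Ioo_subset_Icc_self)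
          (ae_of_all _ fun σ => by positivity), hN, ← lintegral_const_mul' _ _ ENNReal.ofReal_ne_top]
      refine setLIntegral_mono' measurableSet_Ioo fun σ hσ => ?_
      have hσ' : σ ∈ Icc 0 t := Ioo_subset_Icc_self hσ
      have hσT := hsubT t ht σ hσ'
      have hker : ∫⁻ y, expKernel (γ t z σ - y) *
          ENNReal.ofReal (U σ y ^ 2 + U₁ σ y ^ 2 / 2 + R σ y ^ 2 / 2) ≤ ENNReal.ofReal E *
            ∫⁻ y, expKernel (z - y) * solENorm T U U₁ U₂ R R₁ σ y ^ 2 := by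
        rw [← lintegral_const_mul' _ _ ENNReal.ofReal_ne_top]
        refine lintegral_mono fun y => ?_
        rw [← mul_assoc]
        refine mul_le_mul' (expKernel_le_of_abs_sub_le (hmove t ht z σ hσ')) ?_
        rw [solENorm_of_mem hσT, ← ENNReal.ofReal_pow (solSize_nonneg _ _ _ _ _ _ _)]
        exact ENNReal.ofReal_le_ofReal (sq_add_sq_le_solSize_sq _ _ _ _ _ _ _)
      rw [ENNReal.ofReal_add (abs_nonneg _) (abs_nonneg _),
        ENNReal.ofReal_mul zero_le_two, ENNReal.ofReal_ofNat, mul_assoc, two_mul]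
      exact add_le_add ((h.V_le σ hσT _).trans hker) ((h.W_le σ hσT _).trans hker)
    rw [solENorm_of_mem ht, solENorm_of_mem ⟨le_rfl, hT⟩]
    calc ENNReal.ofReal (s t z) ≤ ENNReal.ofReal (2 * E * G * (s 0 (γ t z 0) + I)) :=
          ENNReal.ofReal_le_ofReal hbase
      _ = ENNReal.ofReal (2 * E * G) * (ENNReal.ofReal (s 0 (γ t z 0)) + ENNReal.ofReal I) := by
          rw [ENNReal.ofReal_mul (by positivity), ENNReal.ofReal_add hs0 hI0]
      _ ≤ ENNReal.ofReal (2 * E * G) * (ENNReal.ofReal (2 * E) * ENNReal.ofReal (s 0 (γ t z 0)) +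
            ENNReal.ofReal (2 * E) * N) := by
          gcongr
          refine le_mul_of_one_le_left' ?_
          rw [ENNReal.one_le_ofReal]
          linarith
      _ = _ := by
          rw [← mul_add, ← mul_assoc, ← ENNReal.ofReal_mul (by positivity)]
          congr 2
          ring

end

/-! ### Weak derivatives on the line -/

theorem IsWeakDeriv.ae_eq {f g g' : ℝ → ℝ} (h : IsWeakDeriv f g) (h' : IsWeakDeriv f g') :
    g =ᵐ[volume] g' := by
  refine ae_eq_of_integral_contDiff_smul_eq h.2.1 h'.2.1 fun ψ hψ hc => ?_
  have h1 := h.2.2 ψ hψ hc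
  rw [h'.2.2 ψ hψ hc, neg_inj] at h1
  simpa only [smul_eq_mul, mul_comm] using h1.symm

theorem IsWeakDeriv.congr {f f' g g' : ℝ → ℝ} (h : IsWeakDeriv f g) (hf : f =ᵐ[volume] f')
    (hg : g =ᵐ[volume] g') : IsWeakDeriv f' g' := by
  refine ⟨h.1.congr hf, h.2.1.congr hg, fun ψ hψ hc => ?_⟩
  have e1 : ∫ x, f' x * deriv ψ x = ∫ x, f x * deriv ψ x :=
    integral_congr_ae (hf.symm.mono fun x hx => by simp only [hx])
  have e2 : ∫ x, g' x * ψ x = ∫ x, g x * ψ x :=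
    integral_congr_ae (hg.symm.mono fun x hx => by simp only [hx])
  rw [e1, e2, h.2.2 ψ hψ hc]

theorem isWeakDeriv_weakDeriv {f : ℝ → ℝ} (h : ∃ g, IsWeakDeriv f g) :
    IsWeakDeriv f (weakDeriv f) := by
  rw [weakDeriv, dif_pos h]
  exact h.choose_spec

theorem IsWeakDeriv.weakDeriv_ae_eq {f g : ℝ → ℝ} (h : IsWeakDeriv f g) :
    weakDeriv f =ᵐ[volume] g :=
  (isWeakDeriv_weakDeriv ⟨g, h⟩).ae_eq h

theorem integrable_mul_test {f ψ : ℝ → ℝ} (hf : LocallyIntegrable f volume) (hψ : Continuous ψ)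
    (hc : HasCompactSupport ψ) : Integrable (fun x => f x * ψ x) := by
  have := hf.integrable_smul_right_of_hasCompactSupport hψ hc
  simpa using this

theorem IsWeakDeriv.sub {f f' g g' : ℝ → ℝ} (h : IsWeakDeriv f g) (h' : IsWeakDeriv f' g') :
    IsWeakDeriv (f - f') (g - g') := by
  refine ⟨h.1.sub h'.1, h.2.1.sub h'.2.1, fun ψ hψ hc => ?_⟩
  have hψ' : Continuous (deriv ψ) := hψ.continuous_deriv (by simp)
  simp only [Pi.sub_apply, sub_mul]
  rw [integral_sub (integrable_mul_test h.1 hψ' hc.deriv)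
      (integrable_mul_test h'.1 hψ' hc.deriv),
    integral_sub (integrable_mul_test h.2.1 hψ.continuous hc)
      (integrable_mul_test h'.2.1 hψ.continuous hc), h.2.2 ψ hψ hc, h'.2.2 ψ hψ hc]
  ring

theorem IsWeakDeriv.const_smul {f g : ℝ → ℝ} (h : IsWeakDeriv f g) (c : ℝ) :
    IsWeakDeriv (c • f) (c • g) := by
  refine ⟨h.1.smul c, h.2.1.smul c, fun ψ hψ hc => ?_⟩
  simp only [Pi.smul_apply, smul_eq_mul, mul_assoc]
  rw [integral_const_mul, integral_const_mul, h.2.2 ψ hψ hc]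
  ring

/-- The support of a test function lies in a symmetric interval. -/
theorem exists_forall_notMem_Ioo_eq_zero {ψ : ℝ → ℝ} (hc : HasCompactSupport ψ) :
    ∃ N : ℝ, 0 < N ∧ ∀ x, x ∉ Ioo (-N) N → ψ x = 0 := by
  obtain ⟨N, hN, h⟩ := (hc.isCompact.isBounded).exists_pos_norm_lt
  refine ⟨N, hN, fun x hx => ?_⟩
  by_contra hne
  exact hx (abs_lt.1 (h x (subset_tsupport ψ hne)))

theorem integral_eq_intervalIntegral_of_eq_zero {F : ℝ → ℝ} {N : ℝ} (hN : 0 < N)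
    (h : ∀ x, x ∉ Ioo (-N) N → F x = 0) : ∫ x, F x = ∫ x in (-N)..N, F x := by
  rw [intervalIntegral.integral_of_le (by linarith),
    setIntegral_eq_integral_of_forall_compl_eq_zero]
  intro x hx
  exact h x fun hx' => hx (Ioo_subset_Ioc_self hx')

/-- A primitive of a locally integrable function has that function as weak derivative. -/
theorem isWeakDeriv_primitive {g : ℝ → ℝ} (hg : LocallyIntegrable g volume) :
    IsWeakDeriv (fun x => ∫ y in (0 : ℝ)..x, g y) g := by
  have hi : ∀ a b, IntervalIntegrable g volume a b := fun a b =>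
    (hg.integrableOn_isCompact isCompact_uIcc).intervalIntegrable
  have hcont : Continuous fun x => ∫ y in (0 : ℝ)..x, g y :=
    intervalIntegral.continuous_primitive hi 0
  refine ⟨hcont.locallyIntegrable, hg, fun ψ hψ hc => ?_⟩
  obtain ⟨N, hN, hψN⟩ := exists_forall_notMem_Ioo_eq_zero hc
  have hψ' : ∀ x, x ∉ Ioo (-N) N → deriv ψ x = 0 := by
    intro x hx
    by_contra hne
    -- `ψ` vanishes on a half-line with endpoint `x`.
    rcases le_or_gt x (-N) with hxN | hxN
    · have h0 : EqOn ψ (fun _ => 0) (Iic x) := fun y hy => hψN y fun hy' =>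
        absurd hy'.1 (not_lt.2 ((mem_Iic.1 hy).trans hxN))
      have h1 : HasDerivWithinAt ψ 0 (Iic x) x :=
        (hasDerivWithinAt_const x _ (0 : ℝ)).congr h0 (h0 self_mem_Iic)
      have h2 := (hψ.differentiable (by simp) x).hasDerivAt.hasDerivWithinAt (s := Iic x)
      exact hne ((uniqueDiffWithinAt_Iic x).eq_deriv _ h2 h1)
    · have hxN' : N ≤ x := by
        by_contra hlt
        exact hx ⟨hxN, not_le.1 hlt⟩
      have h0 : EqOn ψ (fun _ => 0) (Ici x) := fun y hy => hψN y fun hy' =>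
        absurd hy'.2 (not_lt.2 (hxN'.trans (mem_Ici.1 hy)))
      have h1 : HasDerivWithinAt ψ 0 (Ici x) x :=
        (hasDerivWithinAt_const x _ (0 : ℝ)).congr h0 (h0 self_mem_Ici)
      have h2 := (hψ.differentiable (by simp) x).hasDerivAt.hasDerivWithinAt (s := Ici x)
      exact hne ((uniqueDiffWithinAt_Ici x).eq_deriv _ h2 h1)
  rw [integral_eq_intervalIntegral_of_eq_zero hN fun x hx => by rw [hψ' x hx, mul_zero],
    integral_eq_intervalIntegral_of_eq_zero hN fun x hx => by rw [hψN x hx, mul_zero]]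
  have hac : AbsolutelyContinuousOnInterval (fun x => ∫ y in (0 : ℝ)..x, g y) (-N) N :=
    (hi (-N) N).absolutelyContinuousOnInterval_intervalIntegral
      (by rw [uIcc_of_le (by linarith)]; exact ⟨by linarith, hN.le⟩)
  have hψac : AbsolutelyContinuousOnInterval ψ (-N) N :=
    ContDiffOn.absolutelyContinuousOnInterval (hψ.of_le (by simp)).contDiffOn
  rw [hac.integral_mul_deriv_eq_deriv_mul hψac, hψN N (by simp), hψN (-N) (by simp)]
  have : ∫ x in (-N)..N, deriv (fun x => ∫ y in (0 : ℝ)..x, g y) x * ψ x =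
      ∫ x in (-N)..N, g x * ψ x := by
    refine intervalIntegral.integral_congr_ae ?_
    filter_upwards [LocallyIntegrable.ae_hasDerivAt_integral hg] with x hx _
    rw [(hx 0).deriv]
  rw [this]; ring

/-- The lemma of du Bois-Reymond: a locally integrable function whose integral against derivatives
of test functions vanishes is constant almost everywhere. -/
theorem IsWeakDeriv.ae_eq_const {f : ℝ → ℝ} (h : IsWeakDeriv f 0) :
    ∃ c : ℝ, f =ᵐ[volume] fun _ => c := by
  let χ₀ : ContDiffBump (0 : ℝ) := ⟨1, 2, one_pos, one_lt_two⟩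
  set χ : ℝ → ℝ := χ₀.normed volume with hχ
  have hχs : ContDiff ℝ ∞ χ := χ₀.contDiff_normed
  have hχc : HasCompactSupport χ := χ₀.hasCompactSupport_normed
  have hχ1 : ∫ x, χ x = 1 := χ₀.integral_normed
  set c := ∫ x, f x * χ x with hcdef
  refine ⟨c, ae_eq_of_integral_contDiff_smul_eq h.1 continuous_const.locallyIntegrable
    fun η hη hηc => ?_⟩
  -- `η - (∫ η) χ` has integral zero, so that its primitive `ψ` has compact support.
  set q : ℝ → ℝ := fun x => η x - (∫ y, η y) * χ x with hq
  have hqs : ContDiff ℝ ∞ q := hη.sub (contDiff_const.mul hχs)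
  have hqc : HasCompactSupport q := hηc.sub hχc.mul_left
  have hηi : Integrable η := hη.continuous.integrable_of_hasCompactSupport hηc
  have hχi : Integrable χ := hχs.continuous.integrable_of_hasCompactSupport hχc
  have hq0 : ∫ x, q x = 0 := by
    rw [hq, integral_sub hηi (hχi.const_mul _), integral_const_mul, hχ1, mul_one, sub_self]
  obtain ⟨N, hN, hqN⟩ := exists_forall_notMem_Ioo_eq_zero hqc
  set ψ : ℝ → ℝ := fun x => ∫ y in (-N)..x, q y with hψ
  have hψd : ∀ x, HasDerivAt ψ (q x) x := fun x =>
    intervalIntegral.integral_hasDerivAt_right (hqs.continuous.intervalIntegrable _ _)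
      (hqs.continuous.stronglyMeasurableAtFilter _ _) hqs.continuous.continuousAt
  have hψd' : deriv ψ = q := funext fun x => (hψd x).deriv
  have hψs : ContDiff ℝ ∞ ψ := contDiff_infty_iff_deriv.2
    ⟨fun x => (hψd x).differentiableAt, by rw [hψd']; exact hqs⟩
  have hψc : HasCompactSupport ψ := by
    refine HasCompactSupport.intro (isCompact_Icc (a := -N) (b := N)) fun x hx => ?_
    rcases lt_or_ge x (-N) with hlt | hge
    · rw [hψ]
      simp only
      rw [intervalIntegral.integral_symm, neg_eq_zero]
      refine intervalIntegral.integral_zero_ae (ae_of_all _ fun y hy => hqN y fun hy' => ?_)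
      rw [uIoc_of_le hlt.le] at hy
      linarith [hy.2, hy'.1]
    · have hgt : N < x := by
        by_contra hle
        exact hx ⟨hge, not_lt.1 hle⟩
      have e : ψ x = (∫ y in (-N)..N, q y) + ∫ y in N..x, q y :=
        (intervalIntegral.integral_add_adjacent_intervals
          (hqs.continuous.intervalIntegrable _ _) (hqs.continuous.intervalIntegrable _ _)).symm
      rw [e, ← integral_eq_intervalIntegral_of_eq_zero hN hqN, hq0, zero_add]
      refine intervalIntegral.integral_zero_ae (ae_of_all _ fun y hy => hqN y fun hy' => ?_)
      rw [uIoc_of_le hgt.le] at hy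
      linarith [hy.1, hy'.2]
  have h1 := h.2.2 ψ hψs hψc
  simp only [Pi.zero_apply, zero_mul, integral_zero, neg_zero, hψd'] at h1
  have e : ∫ x, f x * q x = (∫ x, f x * η x) - (∫ y, η y) * c := by
    rw [hcdef, ← integral_const_mul, ← integral_sub (integrable_mul_test h.1 hη.continuous hηc)
      ((integrable_mul_test h.1 hχs.continuous hχc).const_mul _)]
    refine integral_congr_ae (ae_of_all _ fun x => ?_)
    simp only [hq]; ring
  simp only [smul_eq_mul]
  rw [integral_mul_const]
  rw [e, sub_eq_zero] at h1
  rw [← h1]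
  simp only [mul_comm]

/-- A function with a weak derivative is almost everywhere equal to a primitive of it. -/
theorem IsWeakDeriv.exists_ae_eq_primitive {f g : ℝ → ℝ} (h : IsWeakDeriv f g) :
    ∃ c : ℝ, f =ᵐ[volume] fun x => c + ∫ y in (0 : ℝ)..x, g y := by
  have h1 := h.sub (isWeakDeriv_primitive h.2.1)
  rw [sub_self] at h1
  obtain ⟨c, hc⟩ := h1.ae_eq_const
  refine ⟨c, hc.mono fun x hx => ?_⟩
  simp only [Pi.sub_apply] at hx
  linarith

/-- The one-dimensional Sobolev inequality: a function with weak derivative is bounded by the sum of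
its `L²` norm and that of its derivative. -/
theorem enorm_le_eLpNorm_add {F f g : ℝ → ℝ} (hf : f =ᵐ[volume] F)
    (hfm : AEStronglyMeasurable f volume) (hg : LocallyIntegrable g volume)
    (hF : ∀ a b, F b - F a = ∫ y in a..b, g y) (x : ℝ) :
    ‖F x‖ₑ ≤ eLpNorm f 2 volume + eLpNorm g 2 volume := by
  have hgm : AEStronglyMeasurable g volume := hg.aestronglyMeasurable
  have hμ : (volume.restrict (Ioc x (x + 1))) univ = 1 := by simp
  have hL : ∀ k : ℝ → ℝ, AEStronglyMeasurable k volume →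
      ∫⁻ y in Ioc x (x + 1), ‖k y‖ₑ ≤ eLpNorm k 2 volume := by
    intro k hk
    have h1 := eLpNorm_le_eLpNorm_mul_rpow_measure_univ (p := 1) (q := 2)
      (μ := volume.restrict (Ioc x (x + 1))) (by norm_num) hk.restrict
    rw [hμ, ENNReal.one_rpow, mul_one, eLpNorm_one_eq_lintegral_enorm] at h1
    exact h1.trans (eLpNorm_mono_measure _ Measure.restrict_le_self)
  have hpt : ∀ y ∈ Ioc x (x + 1), ‖F x‖ₑ ≤ ‖F y‖ₑ + ∫⁻ z in Ioc x (x + 1), ‖g z‖ₑ := by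
    intro y hy
    have e : F x = F y - ∫ z in x..y, g z := by rw [← hF x y]; ring
    rw [e]
    refine (enorm_sub_le).trans (add_le_add_right ?_ _)
    rw [intervalIntegral.integral_of_le hy.1.le]
    exact (enorm_integral_le_lintegral_enorm _).trans
      (lintegral_mono_set (Ioc_subset_Ioc_right hy.2))
  calc ‖F x‖ₑ = ∫⁻ _ in Ioc x (x + 1), ‖F x‖ₑ := by simp
    _ ≤ ∫⁻ y in Ioc x (x + 1), (‖F y‖ₑ + ∫⁻ z in Ioc x (x + 1), ‖g z‖ₑ) :=
        setLIntegral_mono' measurableSet_Ioc hpt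
    _ = (∫⁻ y in Ioc x (x + 1), ‖f y‖ₑ) + ∫⁻ z in Ioc x (x + 1), ‖g z‖ₑ := by
        rw [lintegral_add_right _ measurable_const]
        congr 1
        · refine lintegral_congr_ae (ae_restrict_of_ae ?_)
          filter_upwards [hf] with y hy
          rw [hy]
        · simp
    _ ≤ _ := add_le_add (hL f hfm) (hL g hgm)

/-! ### The Fourier transform and weak derivatives in Sobolev spaces -/

theorem eLpNorm_two_sq {E : Type*} [NormedAddCommGroup E] (f : ℝ → E) :
    eLpNorm f 2 volume ^ 2 = ∫⁻ x, ‖f x‖ₑ ^ 2 := by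
  have h := eLpNorm_nnreal_pow_eq_lintegral (f := f) (μ := (volume : Measure ℝ)) (p := 2)
    two_ne_zero
  simpa using h

theorem MemH.memLp {s : ℝ} {f : ℝ → ℝ} (h : MemH s f) :
    MemLp (fun x => (f x : ℂ)) 2 (volume : Measure ℝ) := by
  by_contra hn
  rw [MemH, sobolevENorm, dif_neg hn] at h
  exact lt_irrefl _ h

theorem memLp_ofReal_iff {f : ℝ → ℝ} :
    MemLp (fun x => (f x : ℂ)) 2 (volume : Measure ℝ) ↔ MemLp f 2 volume :=
  ⟨fun h => by simpa using h.re, fun h => h.ofReal⟩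

theorem MemH.memLp_two {s : ℝ} {f : ℝ → ℝ} (h : MemH s f) : MemLp f 2 volume :=
  memLp_ofReal_iff.1 h.memLp

theorem sobolevENorm_congr_ae {s : ℝ} {f g : ℝ → ℝ} (h : f =ᵐ[volume] g) :
    sobolevENorm s f = sobolevENorm s g := by
  have h' : (fun x => (f x : ℂ)) =ᵐ[volume] fun x => (g x : ℂ) := h.mono fun x hx => by
    simp only [hx]
  by_cases hf : MemLp (fun x => (f x : ℂ)) 2 (volume : Measure ℝ)
  · have hg : MemLp (fun x => (g x : ℂ)) 2 (volume : Measure ℝ) := (memLp_congr_ae h').1 hf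
    rw [sobolevENorm, sobolevENorm, dif_pos hf, dif_pos hg,
      MemLp.toLp_congr hf hg h']
  · have hg : ¬ MemLp (fun x => (g x : ℂ)) 2 (volume : Measure ℝ) :=
      fun hg => hf ((memLp_congr_ae h').2 hg)
    rw [sobolevENorm, sobolevENorm, dif_neg hf, dif_neg hg]

theorem sobolevENorm_sq {s : ℝ} {f : ℝ → ℝ}
    (h : MemLp (fun x => (f x : ℂ)) 2 (volume : Measure ℝ)) :
    sobolevENorm s f ^ 2 =
      ∫⁻ ξ : ℝ, ‖(𝓕 (h.toLp (fun x => (f x : ℂ))) : Lp ℂ 2 (volume : Measure ℝ)) ξ‖ₑ ^ 2 *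
        ENNReal.ofReal ((1 + (2 * Real.pi * ξ) ^ 2) ^ s) := by
  rw [sobolevENorm, dif_pos h, ← ENNReal.rpow_natCast, ← ENNReal.rpow_mul]
  norm_num

theorem eLpNorm_le_sobolevENorm {s : ℝ} (hs : 0 ≤ s) (f : ℝ → ℝ) :
    eLpNorm f 2 volume ≤ sobolevENorm s f := by
  by_cases h : MemLp (fun x => (f x : ℂ)) 2 (volume : Measure ℝ)
  · refine (ENNReal.pow_le_pow_left_iff two_ne_zero).1 ?_
    rw [sobolevENorm_sq h]
    set F : Lp ℂ 2 (volume : Measure ℝ) := h.toLp (fun x => (f x : ℂ)) with hF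
    have e : eLpNorm f 2 volume = eLpNorm ((𝓕 F : Lp ℂ 2 (volume : Measure ℝ)) : ℝ → ℂ) 2 volume := by
      have h1 := Lp.norm_fourier_eq F
      rw [Lp.norm_def, Lp.norm_def, ENNReal.toReal_eq_toReal_iff' (Lp.eLpNorm_ne_top _)
        (Lp.eLpNorm_ne_top _)] at h1
      rw [h1, eLpNorm_congr_ae h.coeFn_toLp]
      exact eLpNorm_congr_norm_ae (ae_of_all _ fun x => by simp)
    rw [e, eLpNorm_two_sq]
    refine lintegral_mono fun ξ => ?_
    conv_lhs => rw [← mul_one (_ ^ 2)]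
    refine mul_le_mul_right ?_ _
    rw [← ENNReal.ofReal_one]
    exact ENNReal.ofReal_le_ofReal (Real.one_le_rpow (by nlinarith [sq_nonneg (2 * Real.pi * ξ)]) hs)
  · rw [sobolevENorm, dif_neg h]
    exact le_top

/-- The derivative of a square integrable function, when it is computed as a Fourier multiplier,
is a distributional derivative: both sides are inner products with a Schwartz function, and the
Fourier transform is an isometry of `L²`. -/
theorem integral_mul_deriv_eq_neg_of_fourier {F G : Lp ℂ 2 (volume : Measure ℝ)}
    (h : ((𝓕 G : Lp ℂ 2 (volume : Measure ℝ)) : ℝ → ℂ) =ᵐ[volume] fun ξ =>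
      2 * Real.pi * Complex.I * ξ * (𝓕 F : Lp ℂ 2 (volume : Measure ℝ)) ξ)
    {ψ : ℝ → ℝ} (hψ : ContDiff ℝ ∞ ψ) (hc : HasCompactSupport ψ) :
    ∫ x, F x * ((deriv ψ x : ℝ) : ℂ) = -∫ x, G x * (ψ x : ℂ) := by
  have hc' : HasCompactSupport (fun x => (ψ x : ℂ)) :=
    hc.comp_left (g := Complex.ofReal) Complex.ofReal_zero
  have hψ' : ContDiff ℝ ∞ (fun x => (ψ x : ℂ)) := Complex.ofRealCLM.contDiff.comp hψ
  set Ψ : SchwartzMap ℝ ℂ := hc'.toSchwartzMap hψ' with hΨ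
  have hΨx : ∀ x, Ψ x = (ψ x : ℂ) := fun x => rfl
  set D : SchwartzMap ℝ ℂ := LineDeriv.lineDerivOp (1 : ℝ) Ψ with hD
  have hDx : ∀ x, D x = ((deriv ψ x : ℝ) : ℂ) := by
    intro x
    rw [hD, SchwartzMap.lineDerivOp_apply_eq_fderiv]
    have := ((hψ.differentiable (by simp) x).hasDerivAt.ofReal_comp).hasFDerivAt
    have e : (Ψ : ℝ → ℂ) = fun x => (ψ x : ℂ) := rfl
    rw [e, this.fderiv]
    simp
  have e1 : ∫ x, F x * ((deriv ψ x : ℝ) : ℂ) =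
      inner ℂ (D.toLp 2 volume) F := by
    rw [L2.inner_def]
    refine integral_congr_ae ?_
    filter_upwards [D.coeFn_toLp 2 volume] with x hx
    rw [hx, hDx]
    simp
  have e2 : ∫ x, G x * (ψ x : ℂ) = inner ℂ (Ψ.toLp 2 volume) G := by
    rw [L2.inner_def]
    refine integral_congr_ae ?_
    filter_upwards [Ψ.coeFn_toLp 2 volume] with x hx
    rw [hx, hΨx]
    simp
  rw [e1, e2, ← Lp.inner_fourier_eq, ← Lp.inner_fourier_eq (Ψ.toLp 2 volume),
    SchwartzMap.toLp_fourier_eq, SchwartzMap.toLp_fourier_eq, L2.inner_def, L2.inner_def,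
    ← integral_neg]
  refine integral_congr_ae ?_
  filter_upwards [h, (𝓕 D).coeFn_toLp 2 volume,
    (𝓕 Ψ).coeFn_toLp 2 volume] with ξ h1 h2 h3
  rw [h1, h2, h3, hD, SchwartzMap.fourier_lineDerivOp_eq, smul_apply,
    SchwartzMap.smulLeftCLM_apply_apply (by fun_prop)]
  have e3 : (starRingEnd ℂ) (2 : ℂ) = 2 := Complex.conj_ofNat 2
  simp [e3]
  ring

theorem le_one_add_sq_rpow (s a : ℝ) :
    a ^ 2 * (1 + a ^ 2) ^ (s - 1) ≤ (1 + a ^ 2) ^ s := by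
  have h0 : 0 < 1 + a ^ 2 := by positivity
  calc a ^ 2 * (1 + a ^ 2) ^ (s - 1) ≤ (1 + a ^ 2) * (1 + a ^ 2) ^ (s - 1) := by
        gcongr; linarith
    _ = (1 + a ^ 2) ^ s := by
        conv_lhs => rw [← Real.rpow_one (1 + a ^ 2), ← Real.rpow_mul h0.le, one_mul]
        rw [← Real.rpow_add h0]; ring_nf

/-- A function in `H^s`, `s ≥ 1`, has a weak derivative, which belongs to `H^(s-1)` with the
expected bound for the norm. -/
theorem MemH.exists_isWeakDeriv {s : ℝ} (hs : 1 ≤ s) {f : ℝ → ℝ} (h : MemH s f) :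
    ∃ g, IsWeakDeriv f g ∧ sobolevENorm (s - 1) g ≤ sobolevENorm s f := by
  have hf := h.memLp
  -- `m = 2πiξ 𝓕 f` is square integrable, and its inverse transform `G` is the derivative of `f`.
  set F : Lp ℂ 2 (volume : Measure ℝ) := hf.toLp (fun x => (f x : ℂ)) with hF
  set m : ℝ → ℂ := fun ξ => 2 * Real.pi * Complex.I * ξ * (𝓕 F : Lp ℂ 2 (volume : Measure ℝ)) ξ
    with hm
  have hm2 : ∀ ξ, ‖m ξ‖ₑ ^ 2 = ‖(𝓕 F : Lp ℂ 2 (volume : Measure ℝ)) ξ‖ₑ ^ 2 *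
      ENNReal.ofReal ((2 * Real.pi * ξ) ^ 2) := by
    intro ξ
    have e : ‖(2 * Real.pi * Complex.I * ξ : ℂ)‖ₑ ^ 2 = ENNReal.ofReal ((2 * Real.pi * ξ) ^ 2) := by
      rw [← ofReal_norm, ← ENNReal.ofReal_pow (norm_nonneg _), ← sq_abs (2 * Real.pi * ξ)]
      simp [abs_mul]
    rw [hm]
    simp only
    rw [enorm_mul, mul_pow, e, mul_comm]
  have hint : ∀ ξ, ‖m ξ‖ₑ ^ 2 * ENNReal.ofReal ((1 + (2 * Real.pi * ξ) ^ 2) ^ (s - 1)) ≤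
      ‖(𝓕 F : Lp ℂ 2 (volume : Measure ℝ)) ξ‖ₑ ^ 2 *
        ENNReal.ofReal ((1 + (2 * Real.pi * ξ) ^ 2) ^ s) := by
    intro ξ
    rw [hm2, mul_assoc, ← ENNReal.ofReal_mul (sq_nonneg _)]
    gcongr
    exact le_one_add_sq_rpow _ _
  have hmm : AEStronglyMeasurable m volume := by
    refine AEStronglyMeasurable.mul ?_ (Lp.aestronglyMeasurable _)
    exact Continuous.aestronglyMeasurable (by fun_prop)
  have hmL : MemLp m 2 volume := by
    refine ⟨hmm, ?_⟩
    have h2 : eLpNorm m 2 volume ^ 2 ≤ sobolevENorm s f ^ 2 := by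
      rw [eLpNorm_two_sq, sobolevENorm_sq hf]
      refine (lintegral_mono fun ξ => ?_).trans (lintegral_mono hint)
      conv_lhs => rw [← mul_one (_ ^ 2)]
      refine mul_le_mul_right ?_ _
      rw [← ENNReal.ofReal_one]
      exact ENNReal.ofReal_le_ofReal
        (Real.one_le_rpow (by nlinarith [sq_nonneg (2 * Real.pi * ξ)]) (by linarith))
    exact ((ENNReal.pow_le_pow_left_iff two_ne_zero).1 h2).trans_lt h
  set G : Lp ℂ 2 (volume : Measure ℝ) := 𝓕⁻ (hmL.toLp m) with hG
  have hFG : (𝓕 G : Lp ℂ 2 (volume : Measure ℝ)) = hmL.toLp m :=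
    FourierTransform.fourier_fourierInv_eq _
  have hFG' : ((𝓕 G : Lp ℂ 2 (volume : Measure ℝ)) : ℝ → ℂ) =ᵐ[volume] m := by
    rw [hFG]; exact hmL.coeFn_toLp
  have hGL : LocallyIntegrable (G : ℝ → ℂ) volume := (Lp.memLp G).locallyIntegrable (by norm_num)
  have key : ∀ ψ : ℝ → ℝ, ContDiff ℝ ∞ ψ → HasCompactSupport ψ →
      ((∫ x, f x * deriv ψ x : ℝ) : ℂ) = -∫ x, G x * (ψ x : ℂ) := by
    intro ψ hψ hc
    rw [← integral_mul_deriv_eq_neg_of_fourier hFG' hψ hc, ← integral_complex_ofReal]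
    refine integral_congr_ae ?_
    filter_upwards [hf.coeFn_toLp] with x hx
    rw [hx]; push_cast; rfl
  have hGi : ∀ ψ : ℝ → ℝ, ContDiff ℝ ∞ ψ → HasCompactSupport ψ →
      Integrable (fun x => G x * (ψ x : ℂ)) := by
    intro ψ hψ hc
    have := hGL.integrable_smul_left_of_hasCompactSupport hψ.continuous hc
    refine this.congr (ae_of_all _ fun x => ?_)
    simp [mul_comm]
  have hre : ∀ ψ : ℝ → ℝ, ContDiff ℝ ∞ ψ → HasCompactSupport ψ →
      ∫ x, f x * deriv ψ x = -∫ x, (G x).re * ψ x := by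
    intro ψ hψ hc
    have h1 := congrArg Complex.re (key ψ hψ hc)
    have h2 : ∫ x, (G x * (ψ x : ℂ)).re = (∫ x, G x * (ψ x : ℂ)).re := integral_re (hGi ψ hψ hc)
    rw [Complex.ofReal_re, Complex.neg_re, ← h2] at h1
    rw [h1]
    simp
  have him : ∀ ψ : ℝ → ℝ, ContDiff ℝ ∞ ψ → HasCompactSupport ψ →
      ∫ x, ψ x • (G x).im = 0 := by
    intro ψ hψ hc
    have h1 := congrArg Complex.im (key ψ hψ hc)
    have h2 : ∫ x, (G x * (ψ x : ℂ)).im = (∫ x, G x * (ψ x : ℂ)).im := integral_im (hGi ψ hψ hc)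
    rw [Complex.ofReal_im, Complex.neg_im, ← h2, eq_comm, neg_eq_zero] at h1
    rw [← h1]
    simp [mul_comm]
  -- `f` is real, hence so is its derivative.
  have him0 : ∀ᵐ x, (G x).im = 0 :=
    ae_eq_zero_of_integral_contDiff_smul_eq_zero
      ((Lp.memLp G).im.locallyIntegrable (by norm_num)) him
  have hgG : (fun x => (((G x).re : ℝ) : ℂ)) =ᵐ[volume] G := by
    filter_upwards [him0] with x hx
    apply Complex.ext <;> simp [hx]
  have hgL : MemLp (fun x => (((G x).re : ℝ) : ℂ)) 2 (volume : Measure ℝ) :=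
    (memLp_congr_ae hgG).2 (Lp.memLp G)
  refine ⟨fun x => (G x).re, ⟨h.memLp_two.locallyIntegrable (by norm_num),
    (Lp.memLp G).re.locallyIntegrable (by norm_num), hre⟩, ?_⟩
  refine (ENNReal.pow_le_pow_left_iff two_ne_zero).1 ?_
  rw [sobolevENorm_sq hgL, sobolevENorm_sq hf]
  have e : hgL.toLp (fun x => (((G x).re : ℝ) : ℂ)) = G :=
     Lp.ext (hgL.coeFn_toLp.trans hgG)
  rw [e]
  refine (lintegral_congr_ae ?_).trans_le (lintegral_mono hint)
  filter_upwards [hFG'] with ξ hξ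
  rw [hξ]

/-! ### Continuous representatives -/

theorem MemH.isWeakDeriv {s : ℝ} (hs : 1 ≤ s) {f : ℝ → ℝ} (h : MemH s f) :
    IsWeakDeriv f (weakDeriv f) := by
  obtain ⟨g, hg, -⟩ := h.exists_isWeakDeriv hs
  exact isWeakDeriv_weakDeriv ⟨g, hg⟩

theorem sobolevENorm_weakDeriv_le {s : ℝ} (hs : 1 ≤ s) (f : ℝ → ℝ) :
    sobolevENorm (s - 1) (weakDeriv f) ≤ sobolevENorm s f := by
  by_cases h : MemH s f
  · obtain ⟨g, hg, hle⟩ := h.exists_isWeakDeriv hs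
    rwa [sobolevENorm_congr_ae hg.weakDeriv_ae_eq]
  · rw [MemH, not_lt, top_le_iff] at h
    rw [h]
    exact le_top

theorem MemH.weakDeriv {s : ℝ} (hs : 1 ≤ s) {f : ℝ → ℝ} (h : MemH s f) :
    MemH (s - 1) (weakDeriv f) :=
  (sobolevENorm_weakDeriv_le hs f).trans_lt h

theorem weakDeriv_sub {f g : ℝ → ℝ} (hf : IsWeakDeriv f (weakDeriv f))
    (hg : IsWeakDeriv g (weakDeriv g)) :
    weakDeriv (f - g) =ᵐ[volume] weakDeriv f - weakDeriv g :=
  (hf.sub hg).weakDeriv_ae_eq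

theorem ContInH.weakDeriv {s : ℝ} (hs : 1 ≤ s) {I : Set ℝ} {w : ℝ → ℝ → ℝ}
    (h : ContInH s I w) : ContInH (s - 1) I fun t => weakDeriv (w t) := by
  refine ⟨fun t ht => (h.1 t ht).weakDeriv hs, fun t ht => ?_⟩
  refine tendsto_of_tendsto_of_tendsto_of_le_of_le' tendsto_const_nhds (h.2 t ht)
    (Eventually.of_forall fun _ => zero_le) ?_
  filter_upwards [self_mem_nhdsWithin] with τ hτ
  rw [← sobolevENorm_congr_ae (weakDeriv_sub ((h.1 τ hτ).isWeakDeriv hs)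
    ((h.1 t ht).isWeakDeriv hs))]
  exact sobolevENorm_weakDeriv_le hs _

theorem HasTimeDerivInH.weakDeriv {s : ℝ} (hs : 1 ≤ s) {I : Set ℝ} {w wt : ℝ → ℝ → ℝ}
    (h : HasTimeDerivInH s I w wt) (hw : ∀ t ∈ I, MemH s (w t)) (hwt : ∀ t ∈ I, MemH s (wt t)) :
    HasTimeDerivInH (s - 1) I (fun t => weakDeriv (w t)) fun t => weakDeriv (wt t) := by
  intro t ht
  refine tendsto_of_tendsto_of_tendsto_of_le_of_le' tendsto_const_nhds (h t ht)
    (Eventually.of_forall fun _ => zero_le) ?_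
  filter_upwards [self_mem_nhdsWithin] with τ hτ
  have hd := ((((hw τ hτ.1).isWeakDeriv hs).sub ((hw t ht).isWeakDeriv hs)).const_smul
    (τ - t)⁻¹).sub ((hwt t ht).isWeakDeriv hs)
  rw [← sobolevENorm_congr_ae hd.weakDeriv_ae_eq]
  exact sobolevENorm_weakDeriv_le hs _

open Classical in
/-- The continuous representative of the almost everywhere class of `f`; the value `0` is used if
there is none. -/
noncomputable def contRep (f : ℝ → ℝ) : ℝ → ℝ :=
  if h : ∃ F : ℝ → ℝ, Continuous F ∧ f =ᵐ[volume] F then h.choose else 0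

theorem contRep_eq {f F : ℝ → ℝ} (hF : Continuous F) (h : f =ᵐ[volume] F) : contRep f = F := by
  have hex : ∃ F : ℝ → ℝ, Continuous F ∧ f =ᵐ[volume] F := ⟨F, hF, h⟩
  rw [contRep, dif_pos hex]
  exact Measure.eq_of_ae_eq (hex.choose_spec.2.symm.trans h) hex.choose_spec.1 hF

/-- A function with a locally integrable weak derivative has a continuous representative, which is a
primitive of the weak derivative. -/
theorem IsWeakDeriv.contRep_spec {f g : ℝ → ℝ} (h : IsWeakDeriv f g) :
    Continuous (contRep f) ∧ f =ᵐ[volume] contRep f ∧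
      ∀ a b, contRep f b - contRep f a = ∫ y in a..b, g y := by
  obtain ⟨c, hc⟩ := h.exists_ae_eq_primitive
  have hi : ∀ a b, IntervalIntegrable g volume a b := fun a b =>
    (h.2.1.integrableOn_isCompact isCompact_uIcc).intervalIntegrable
  have hcont : Continuous fun x => c + ∫ y in (0 : ℝ)..x, g y :=
    continuous_const.add (intervalIntegral.continuous_primitive hi 0)
  have e := contRep_eq hcont hc
  rw [e]
  refine ⟨hcont, hc, fun a b => ?_⟩
  rw [add_sub_add_left_eq_sub, intervalIntegral.integral_interval_sub_left (hi _ _) (hi _ _)]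

theorem IsWeakDeriv.continuous_contRep {f g : ℝ → ℝ} (h : IsWeakDeriv f g) :
    Continuous (contRep f) := h.contRep_spec.1

theorem IsWeakDeriv.ae_eq_contRep {f g : ℝ → ℝ} (h : IsWeakDeriv f g) :
    f =ᵐ[volume] contRep f := h.contRep_spec.2.1

theorem IsWeakDeriv.contRep_sub {f g f' g' : ℝ → ℝ} (h : IsWeakDeriv f g)
    (h' : IsWeakDeriv f' g') : contRep (f - f') = contRep f - contRep f' :=
  contRep_eq (h.continuous_contRep.sub h'.continuous_contRep)
    (h.ae_eq_contRep.sub h'.ae_eq_contRep)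

theorem IsWeakDeriv.contRep_const_smul {f g : ℝ → ℝ} (h : IsWeakDeriv f g) (c : ℝ) :
    contRep (c • f) = c • contRep f :=
  contRep_eq (h.continuous_contRep.const_smul c) (h.ae_eq_contRep.const_smul c)

/-- The Sobolev embedding of `H^s`, `s ≥ 1`, into the bounded continuous functions. There is no
membership hypothesis, as the right-hand side is infinite outside `H^s`. -/
theorem enorm_contRep_le {s : ℝ} (hs : 1 ≤ s) (f : ℝ → ℝ) (x : ℝ) :
    ‖contRep f x‖ₑ ≤ 2 * sobolevENorm s f := by
  by_cases h : MemH s f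
  · have hd := h.isWeakDeriv hs
    have h1 := enorm_le_eLpNorm_add hd.ae_eq_contRep h.memLp_two.1 hd.2.1 hd.contRep_spec.2.2 x
    refine h1.trans ?_
    rw [two_mul]
    exact add_le_add (eLpNorm_le_sobolevENorm (by linarith) f)
      ((eLpNorm_le_sobolevENorm (by linarith) _).trans (sobolevENorm_weakDeriv_le hs f))
  · rw [MemH, not_lt, top_le_iff] at h
    rw [h]
    simp

theorem MemH.exists_abs_contRep_le {s : ℝ} (hs : 1 ≤ s) {f : ℝ → ℝ} (h : MemH s f) :
    ∃ B : ℝ, ∀ x, |contRep f x| ≤ B := by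
  refine ⟨(2 * sobolevENorm s f).toReal, fun x => ?_⟩
  have h1 := ENNReal.toReal_mono (ENNReal.mul_ne_top (by norm_num) h.ne) (enorm_contRep_le hs f x)
  simpa using h1

/-- Continuity in time with values in `H^s`, `s ≥ 1`, gives joint continuity in time and space, since
convergence in `H^s` is uniform. -/
theorem ContInH.continuousOn_contRep {s : ℝ} (hs : 1 ≤ s) {I : Set ℝ} {w : ℝ → ℝ → ℝ}
    (h : ContInH s I w) :
    ContinuousOn (Function.uncurry fun t => contRep (w t)) (I ×ˢ univ) := by
  rintro ⟨t, x⟩ ⟨ht, -⟩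
  have hd := (h.1 t ht).isWeakDeriv hs
  have hfst : Tendsto Prod.fst (𝓝[I ×ˢ univ] (t, x)) (𝓝[I] t) := by
    refine tendsto_nhdsWithin_iff.2 ⟨(continuous_fst.tendsto _).mono_left nhdsWithin_le_nhds, ?_⟩
    filter_upwards [self_mem_nhdsWithin] with q hq using hq.1
  have h1 : Tendsto (fun q : ℝ × ℝ => 2 * sobolevENorm s (w q.1 - w t))
      (𝓝[I ×ˢ univ] (t, x)) (𝓝 0) := by
    have := ENNReal.Tendsto.const_mul (a := 2) ((h.2 t ht).comp hfst) (Or.inr (by norm_num))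
    simpa using this
  have h2 : Tendsto (fun q : ℝ × ℝ => edist (contRep (w t) q.2) (contRep (w t) x))
      (𝓝[I ×ˢ univ] (t, x)) (𝓝 0) := by
    refine tendsto_iff_edist_tendsto_0.1 ?_
    exact ((hd.continuous_contRep.comp continuous_snd).tendsto (t, x)).mono_left
      nhdsWithin_le_nhds
  refine tendsto_iff_edist_tendsto_0.2 ?_
  have h3 := h1.add h2
  rw [add_zero] at h3
  refine tendsto_of_tendsto_of_tendsto_of_le_of_le' tendsto_const_nhds h3
    (Eventually.of_forall fun _ => zero_le) ?_
  filter_upwards [self_mem_nhdsWithin] with q hq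
  refine (edist_triangle _ (contRep (w t) q.2) _).trans (add_le_add ?_ le_rfl)
  have e := ((h.1 q.1 hq.1).isWeakDeriv hs).contRep_sub hd
  have h4 := enorm_contRep_le hs (w q.1 - w t) q.2
  rw [e, Pi.sub_apply, ← edist_eq_enorm_sub] at h4
  exact h4

/-- Differentiability in time with values in `H^s`, `s ≥ 1`, gives pointwise differentiability. -/
theorem HasTimeDerivInH.hasDerivWithinAt_contRep {s : ℝ} (hs : 1 ≤ s) {I : Set ℝ}
    {w wt : ℝ → ℝ → ℝ} (h : HasTimeDerivInH s I w wt) (hw : ∀ t ∈ I, MemH s (w t))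
    (hwt : ∀ t ∈ I, MemH s (wt t)) {t : ℝ} (ht : t ∈ I) (x : ℝ) :
    HasDerivWithinAt (fun τ => contRep (w τ) x) (contRep (wt t) x) I t := by
  rw [hasDerivWithinAt_iff_tendsto_slope]
  refine tendsto_iff_edist_tendsto_0.2 ?_
  have h1 := ENNReal.Tendsto.const_mul (a := 2) (h t ht) (Or.inr (by norm_num))
  rw [mul_zero] at h1
  refine tendsto_of_tendsto_of_tendsto_of_le_of_le' tendsto_const_nhds h1
    (Eventually.of_forall fun _ => zero_le) ?_
  filter_upwards [self_mem_nhdsWithin] with τ hτ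
  have d1 := (hw τ hτ.1).isWeakDeriv hs
  have d2 := (hw t ht).isWeakDeriv hs
  have d3 := (hwt t ht).isWeakDeriv hs
  have h4 := enorm_contRep_le hs ((τ - t)⁻¹ • (w τ - w t) - wt t) x
  rw [((d1.sub d2).const_smul _).contRep_sub d3, (d1.sub d2).contRep_const_smul,
    d1.contRep_sub d2, Pi.sub_apply, ← edist_eq_enorm_sub] at h4
  exact h4

/-! ### Bounded solutions of `V'' - V = F` -/

/-- A bounded solution of `P' = P + F`, `F ≥ 0`, is dominated by `∫_x^∞ exp (x - y) F y dy`. -/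
theorem ofReal_abs_le_of_hasDerivAt_add {P F : ℝ → ℝ} {B : ℝ} (hF : Continuous F)
    (hF0 : ∀ x, 0 ≤ F x) (hP : ∀ x, HasDerivAt P (P x + F x) x) (hB : ∀ x, |P x| ≤ B) (x : ℝ) :
    ENNReal.ofReal |P x| ≤ ∫⁻ y in Ioi x, expKernel (x - y) * ENNReal.ofReal (F y) := by
  have hc : Continuous fun y => Real.exp (x - y) * F y := by fun_prop
  have hd : ∀ y, HasDerivAt (fun y => Real.exp (x - y) * P y) (Real.exp (x - y) * F y) y := by
    intro y
    have h1 : HasDerivAt (fun y => Real.exp (x - y)) (Real.exp (x - y) * (-1)) y :=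
      ((hasDerivAt_id y).const_sub x).exp
    exact (h1.mul (hP y)).congr_deriv (by ring)
  -- Integrate `(exp (x - y) P y)' = exp (x - y) F y` over `[x, b]` and let `b` tend to infinity.
  have hfin : ∀ b, x ≤ b → ENNReal.ofReal |P x| ≤
      (∫⁻ y in Ioi x, expKernel (x - y) * ENNReal.ofReal (F y)) +
        ENNReal.ofReal (Real.exp (x - b) * B) := by
    intro b hb
    have h1 := intervalIntegral.integral_eq_sub_of_hasDerivAt (a := x) (b := b)
      (fun y _ => hd y) (hc.intervalIntegrable _ _)
    simp only [sub_self, Real.exp_zero, one_mul] at h1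
    have h0 : 0 ≤ ∫ y in x..b, Real.exp (x - y) * F y :=
      intervalIntegral.integral_nonneg hb fun y _ => mul_nonneg (Real.exp_pos _).le (hF0 y)
    have h2 : |P x| ≤ (∫ y in x..b, Real.exp (x - y) * F y) + Real.exp (x - b) * B := by
      have e : P x = Real.exp (x - b) * P b - ∫ y in x..b, Real.exp (x - y) * F y := by
        rw [h1]; ring
      calc |P x| ≤ |Real.exp (x - b) * P b| + |∫ y in x..b, Real.exp (x - y) * F y| := by
            conv_lhs => rw [e]
            exact abs_sub _ _
        _ ≤ _ := by
            rw [abs_of_nonneg h0, abs_mul, Real.abs_exp, add_comm]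
            gcongr
            exact hB b
    refine (ENNReal.ofReal_le_ofReal h2).trans (ENNReal.ofReal_add_le.trans ?_)
    gcongr
    rw [intervalIntegral.integral_of_le hb, ofReal_integral_eq_lintegral_ofReal
      (hc.integrableOn_Ioc) (ae_of_all _ fun y => mul_nonneg (Real.exp_pos _).le (hF0 y))]
    refine (setLIntegral_mono' measurableSet_Ioc fun y hy => ?_).trans
      (lintegral_mono_set Ioc_subset_Ioi_self)
    rw [ENNReal.ofReal_mul (Real.exp_pos _).le, expKernel, abs_of_neg (by linarith [hy.1]), neg_neg]
  have hlim : Tendsto (fun b => (∫⁻ y in Ioi x, expKernel (x - y) * ENNReal.ofReal (F y)) +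
        ENNReal.ofReal (Real.exp (x - b) * B)) atTop
      (𝓝 ((∫⁻ y in Ioi x, expKernel (x - y) * ENNReal.ofReal (F y)) + 0)) := by
    refine tendsto_const_nhds.add ?_
    have h3 : Tendsto (fun b : ℝ => Real.exp (x - b) * B) atTop (𝓝 (0 * B)) :=
      (Real.tendsto_exp_atBot.comp (tendsto_atBot_add_const_left _ x tendsto_neg_atTop_atBot)).mul_const B
    rw [zero_mul] at h3
    simpa using ENNReal.tendsto_ofReal h3
  rw [add_zero] at hlim
  exact ge_of_tendsto hlim ((eventually_ge_atTop x).mono hfin)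

/-- The bounded solutions of `V' = W`, `W' = V + F` with `F ≥ 0`, that is, of `V'' - V = F`, are
dominated by the convolution of `F` with `exp (-|x|)`: the functions `W + V` and, after reflection,
`V - W` solve first order equations `P' = P + F`. -/
theorem ofReal_abs_le_lintegral_expKernel {V W F : ℝ → ℝ} {B : ℝ} (hF : Continuous F)
    (hF0 : ∀ x, 0 ≤ F x) (hV : ∀ x, HasDerivAt V (W x) x) (hW : ∀ x, HasDerivAt W (V x + F x) x)
    (hVB : ∀ x, |V x| ≤ B) (hWB : ∀ x, |W x| ≤ B) (x : ℝ) :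
    ENNReal.ofReal |V x| ≤ (∫⁻ y, expKernel (x - y) * ENNReal.ofReal (F y)) ∧
      ENNReal.ofReal |W x| ≤ ∫⁻ y, expKernel (x - y) * ENNReal.ofReal (F y) := by
  have h1 := ofReal_abs_le_of_hasDerivAt_add (P := fun x => W x + V x) (B := B + B) hF hF0
    (fun y => ((hW y).add (hV y)).congr_deriv (by ring))
    (fun y => (abs_add_le _ _).trans (add_le_add (hWB y) (hVB y))) x
  have h2 := ofReal_abs_le_of_hasDerivAt_add (P := fun x => V (-x) - W (-x)) (F := fun x => F (-x))
    (B := B + B) (hF.comp continuous_neg) (fun y => hF0 _)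
    (fun y => by
      have a1 := (hV (-y)).comp y (hasDerivAt_neg y)
      have a2 := (hW (-y)).comp y (hasDerivAt_neg y)
      exact (a1.sub a2).congr_deriv (by ring))
    (fun y => (abs_sub _ _).trans (add_le_add (hVB _) (hWB _))) (-x)
  simp only [neg_neg] at h2
  have e : ∫⁻ y in Ioi (-x), expKernel (-x - y) * ENNReal.ofReal (F (-y)) =
      ∫⁻ y in Iio x, expKernel (x - y) * ENNReal.ofReal (F y) := by
    have h3 := (Measure.measurePreserving_neg (volume : Measure ℝ)).setLIntegral_comp_preimage
      (s := Iio x) measurableSet_Iio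
      (f := fun y => expKernel (x - y) * ENNReal.ofReal (F y))
      ((measurable_expKernel.comp (measurable_const.sub measurable_id)).mul
        hF.measurable.ennreal_ofReal)
    rw [← h3]
    have h4 : Neg.neg ⁻¹' Iio x = Ioi (-x) := by ext y; simp
    rw [h4]
    refine lintegral_congr fun y => ?_
    congr 1
    rw [expKernel, expKernel, ← abs_neg]
    congr 4
    ring
  rw [e] at h2
  have hsum : (∫⁻ y in Ioi x, expKernel (x - y) * ENNReal.ofReal (F y)) +
      (∫⁻ y in Iio x, expKernel (x - y) * ENNReal.ofReal (F y)) ≤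
      ∫⁻ y, expKernel (x - y) * ENNReal.ofReal (F y) := by
    have hdisj : Disjoint (Ioi x) (Iio x) := disjoint_left.2 fun y hy hy' =>
      lt_asymm (mem_Ioi.1 hy) (mem_Iio.1 hy')
    rw [← lintegral_union measurableSet_Iio hdisj]
    exact setLIntegral_le_lintegral _ _
  have key : ENNReal.ofReal (|W x + V x| + |V x - W x|) ≤
      ∫⁻ y, expKernel (x - y) * ENNReal.ofReal (F y) :=
    ENNReal.ofReal_add_le.trans ((add_le_add h1 h2).trans hsum)
  constructor <;> refine (ENNReal.ofReal_le_ofReal ?_).trans key <;>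
    rw [abs_le] <;> constructor <;>
    cases' abs_cases (W x + V x) with g1 g1 <;> cases' abs_cases (V x - W x) with g2 g2 <;>
    linarith

/-! ### From strong solutions to classical solutions -/

theorem IsWeakDeriv.locallyAC_contRep {f g : ℝ → ℝ} (h : IsWeakDeriv f g) :
    LocallyAC (contRep f) := by
  intro a b
  have hi : IntervalIntegrable g volume a b :=
    (h.2.1.integrableOn_isCompact isCompact_uIcc).intervalIntegrable
  have h1 : AbsolutelyContinuousOnInterval (fun x => ∫ y in a..x, g y) a b :=
    hi.absolutelyContinuousOnInterval_intervalIntegral left_mem_uIcc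
  have h2 : AbsolutelyContinuousOnInterval (fun _ : ℝ => contRep f a) a b :=
    ContDiffOn.absolutelyContinuousOnInterval contDiffOn_const
  have e : contRep f = (fun _ : ℝ => contRep f a) + fun x => ∫ y in a..x, g y := by
    funext x
    simp only [Pi.add_apply, ← h.contRep_spec.2.2 a x]
    ring
  rw [e]
  exact h2.add h1

theorem IsWeakDeriv.ae_hasDerivAt_contRep {f g : ℝ → ℝ} (h : IsWeakDeriv f g) :
    ∀ᵐ x, HasDerivAt (contRep f) (g x) x := by
  filter_upwards [LocallyIntegrable.ae_hasDerivAt_integral h.2.1] with x hx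
  have e : contRep f = fun x => contRep f 0 + ∫ y in (0 : ℝ)..x, g y := by
    funext x
    simp only [← h.contRep_spec.2.2 0 x]
    ring
  rw [e]
  exact (hx 0).const_add _

/-- A locally absolutely continuous function whose derivative agrees almost everywhere with a
continuous function is continuously differentiable. -/
theorem hasDerivAt_of_locallyAC {f g : ℝ → ℝ} (hf : LocallyAC f) (hg : Continuous g)
    (h : ∀ᵐ x, HasDerivAt f (g x) x) (x : ℝ) : HasDerivAt f (g x) x := by
  have e : f = fun x => f 0 + ∫ y in (0 : ℝ)..x, g y := by
    funext x
    have h1 := (hf 0 x).integral_deriv_eq_sub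
    have h2 : ∫ y in (0 : ℝ)..x, deriv f y = ∫ y in (0 : ℝ)..x, g y :=
      intervalIntegral.integral_congr_ae (h.mono fun y hy _ => hy.deriv)
    rw [← h2, h1]; ring
  rw [e]
  exact (intervalIntegral.integral_hasDerivAt_right (hg.intervalIntegrable _ _)
    (hg.stronglyMeasurableAtFilter _ _) hg.continuousAt).const_add _

theorem IsWeakDeriv.hasDerivAt_contRep {f g k : ℝ → ℝ} (h : IsWeakDeriv f g)
    (h' : IsWeakDeriv g k) (x : ℝ) : HasDerivAt (contRep f) (contRep g x) x := by
  refine hasDerivAt_of_locallyAC h.locallyAC_contRep h'.continuous_contRep ?_ x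
  filter_upwards [h.ae_hasDerivAt_contRep, h'.ae_eq_contRep] with y hy hy'
  rwa [← hy']

theorem isWeakDeriv_of_hasDerivAt {F F' : ℝ → ℝ} (hF' : Continuous F')
    (h : ∀ x, HasDerivAt F (F' x) x) : IsWeakDeriv F F' := by
  have hF : Continuous F := continuous_iff_continuousAt.2 fun x => (h x).continuousAt
  refine ⟨hF.locallyIntegrable, hF'.locallyIntegrable, fun ψ hψ hc => ?_⟩
  exact integral_mul_deriv_eq_deriv_mul_of_integrable (u := F) (v := ψ) (u' := F') (fun x _ => h x)
    (fun x _ => (hψ.differentiable (by simp) x).hasDerivAt)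
    (integrable_mul_test hF.locallyIntegrable (hψ.continuous_deriv (by simp)) hc.deriv)
    (integrable_mul_test hF'.locallyIntegrable hψ.continuous hc)
    (integrable_mul_test hF.locallyIntegrable hψ.continuous hc)

/-- The momentum equation, integrated once in space. Its right-hand side
`f f₃ + 2 f₁ f₂ - 3 f f₁ - r r₁` is the derivative of `f f₂ + f₁² / 2 - (3/2) f² - r² / 2`, so that
the equation `y - y₁' = ...` for the time derivative `y` reads `V' = y + f f₁`, where
`V = y₁ + f₁² + f f₂ - (f² + f₁² / 2 + r² / 2)`. As `f₂` and `y₁` are only absolutely continuous,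
this is first obtained almost everywhere. -/
theorem hasDerivAt_potential {f f₁ f₂ f₃ r r₁ r₂ y y₁ y₂ : ℝ → ℝ}
    (hf : IsWeakDeriv f f₁) (hf₁ : IsWeakDeriv f₁ f₂) (hf₂ : IsWeakDeriv f₂ f₃)
    (hr : IsWeakDeriv r r₁) (hr₁ : IsWeakDeriv r₁ r₂)
    (hy : IsWeakDeriv y y₁) (hy₁ : IsWeakDeriv y₁ y₂)
    (heq : ∀ᵐ x, y x - y₂ x = f x * f₃ x + 2 * f₁ x * f₂ x - 3 * f x * f₁ x - r x * r₁ x)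
    (x : ℝ) :
    HasDerivAt (fun x => contRep y₁ x + contRep f₁ x ^ 2 + contRep f x * contRep f₂ x -
      (contRep f x ^ 2 + contRep f₁ x ^ 2 / 2 + contRep r x ^ 2 / 2))
      (contRep y x + contRep f x * contRep f₁ x) x := by
  have df := hf.hasDerivAt_contRep hf₁
  have df₁ := hf₁.hasDerivAt_contRep hf₂
  have dr := hr.hasDerivAt_contRep hr₁
  refine hasDerivAt_of_locallyAC (g := fun x => contRep y x + contRep f x * contRep f₁ x) ?_
    (hy.continuous_contRep.add (hf.continuous_contRep.mul hf₁.continuous_contRep)) ?_ x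
  · intro a b
    have a0 := hf.locallyAC_contRep a b
    have a1 := hf₁.locallyAC_contRep a b
    have a2 := hf₂.locallyAC_contRep a b
    have a3 := hr.locallyAC_contRep a b
    have a4 := hy₁.locallyAC_contRep a b
    have e : (fun x => contRep y₁ x + contRep f₁ x ^ 2 + contRep f x * contRep f₂ x -
        (contRep f x ^ 2 + contRep f₁ x ^ 2 / 2 + contRep r x ^ 2 / 2)) =
        contRep y₁ + contRep f₁ * contRep f₁ + contRep f * contRep f₂ -
        (contRep f * contRep f + (1 / 2 : ℝ) • (contRep f₁ * contRep f₁) +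
          (1 / 2 : ℝ) • (contRep r * contRep r)) := by
      funext z
      simp only [Pi.add_apply, Pi.sub_apply, Pi.mul_apply, Pi.smul_apply, smul_eq_mul]
      ring
    rw [e]
    exact ((a4.add (a1.mul a1)).add (a0.mul a2)).sub
      (((a0.mul a0).add ((a1.mul a1).const_smul (1 / 2 : ℝ))).add ((a3.mul a3).const_smul (1 / 2 : ℝ)))
  · filter_upwards [heq, hf.ae_eq_contRep, hf₁.ae_eq_contRep, hf₂.ae_eq_contRep, hr.ae_eq_contRep,
      hr₁.ae_eq_contRep, hy.ae_eq_contRep, hf₂.ae_hasDerivAt_contRep,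
      hy₁.ae_hasDerivAt_contRep] with x h0 h1 h2 h3 h4 h5 h6 h7 h8
    have d := ((h8.add ((df₁ x).pow 2)).add ((df x).mul h7)).sub
      ((((df x).pow 2).add (((df₁ x).pow 2).div_const 2)).add (((dr x).pow 2).div_const 2))
    refine d.congr_deriv ?_
    rw [h1, h2, h3, h4, h5, h6] at h0
    simp only [Nat.cast_ofNat, Nat.add_one_sub_one, pow_one]
    linarith

theorem sobolevENorm_mono {s s' : ℝ} (hs : s' ≤ s) (f : ℝ → ℝ) :
    sobolevENorm s' f ≤ sobolevENorm s f := by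
  by_cases h : MemLp (fun x => (f x : ℂ)) 2 (volume : Measure ℝ)
  · refine (ENNReal.pow_le_pow_left_iff two_ne_zero).1 ?_
    rw [sobolevENorm_sq h, sobolevENorm_sq h]
    gcongr
    exact le_add_of_nonneg_right (sq_nonneg _)
  · rw [sobolevENorm, sobolevENorm, dif_neg h, dif_neg h]

theorem MemH.mono {s s' : ℝ} (hs : s' ≤ s) {f : ℝ → ℝ} (h : MemH s f) : MemH s' f :=
  (sobolevENorm_mono hs f).trans_lt h

/-- A strong solution of the two-component Camassa-Holm system is a classical solution of its
non-local transport form, for the continuous representatives. -/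
theorem IsStrongSolution.isClassicalSolution {s T M : ℝ} (hs : 3 < s) {u₀ ρ₀ : ℝ → ℝ}
    {u ρ : ℝ → ℝ → ℝ} (h : IsStrongSolution s T u₀ ρ₀ u ρ)
    (hM : ∀ t ∈ Ico 0 T, ∀ x, |contRep (u t) x| ≤ M ∧ |contRep (weakDeriv (u t)) x| ≤ M ∧
      |contRep (weakDeriv (weakDeriv (u t))) x| ≤ M ∧ |contRep (ρ t) x| ≤ M ∧
      |contRep (weakDeriv (ρ t)) x| ≤ M) :
    ∃ V W, IsClassicalSolution T M (fun t => contRep (u t)) (fun t => contRep (weakDeriv (u t)))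
      (fun t => contRep (weakDeriv (weakDeriv (u t)))) (fun t => contRep (ρ t))
      (fun t => contRep (weakDeriv (ρ t))) V W := by
  obtain ⟨ut, ρt, hut, hdu, hρt, hdρ, heq⟩ := h.eqn
  have cu := h.cont_u
  have cu₁ := cu.weakDeriv (by linarith)
  have cu₂ := cu₁.weakDeriv (by linarith)
  have cr := h.cont_rho
  have cr₁ := cr.weakDeriv (by linarith)
  have cy₁ := hut.weakDeriv (by linarith)
  have mu : ∀ t ∈ Ico 0 T, MemH (s - 1) (u t) := fun t ht => (cu.1 t ht).mono (by linarith)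
  have mr : ∀ t ∈ Ico 0 T, MemH (s - 2) (ρ t) := fun t ht => (cr.1 t ht).mono (by linarith)
  have hdu₁ := hdu.weakDeriv (by linarith) mu hut.1
  have wu := fun t ht => (cu.1 t ht).isWeakDeriv (by linarith)
  have wu₁ := fun t ht => (cu₁.1 t ht).isWeakDeriv (by linarith)
  have wu₂ := fun t ht => (cu₂.1 t ht).isWeakDeriv (by linarith)
  have wr := fun t ht => (cr.1 t ht).isWeakDeriv (by linarith)
  have wr₁ := fun t ht => (cr₁.1 t ht).isWeakDeriv (by linarith)
  have wy := fun t ht => (hut.1 t ht).isWeakDeriv (by linarith)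
  have wy₁ := fun t ht => (cy₁.1 t ht).isWeakDeriv (by linarith)
  have kU := cu.continuousOn_contRep (by linarith)
  have kU₁ := cu₁.continuousOn_contRep (by linarith)
  have kU₂ := cu₂.continuousOn_contRep (by linarith)
  have kR := cr.continuousOn_contRep (by linarith)
  have kR₁ := cr₁.continuousOn_contRep (by linarith)
  have kY := hut.continuousOn_contRep (by linarith)
  have kY₁ := cy₁.continuousOn_contRep (by linarith)
  have hnhds : ∀ t ∈ Ioo 0 T, Ico 0 T ∈ 𝓝 t := fun t ht => Ico_mem_nhds ht.1 ht.2
  have hIco : ∀ t ∈ Ioo 0 T, t ∈ Ico 0 T := fun t ht => ⟨ht.1.le, ht.2⟩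
  set V : ℝ → ℝ → ℝ := fun t x => contRep (weakDeriv (ut t)) x + contRep (weakDeriv (u t)) x ^ 2 +
    contRep (u t) x * contRep (weakDeriv (weakDeriv (u t))) x -
    (contRep (u t) x ^ 2 + contRep (weakDeriv (u t)) x ^ 2 / 2 + contRep (ρ t) x ^ 2 / 2) with hV
  set W : ℝ → ℝ → ℝ := fun t x => contRep (ut t) x + contRep (u t) x * contRep (weakDeriv (u t)) x
    with hW
  have dV : ∀ t ∈ Ico 0 T, ∀ x, HasDerivAt (V t) (W t x) x := fun t ht x =>
    hasDerivAt_potential (wu t ht) (wu₁ t ht) (wu₂ t ht) (wr t ht) (wr₁ t ht) (wy t ht) (wy₁ t ht)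
      (heq t ht).1 x
  have dW : ∀ t ∈ Ico 0 T, ∀ x, HasDerivAt (W t) (V t x + (contRep (u t) x ^ 2 +
      contRep (weakDeriv (u t)) x ^ 2 / 2 + contRep (ρ t) x ^ 2 / 2)) x := fun t ht x =>
    (((wy t ht).hasDerivAt_contRep (wy₁ t ht) x).add
      (((wu t ht).hasDerivAt_contRep (wu₁ t ht) x).mul
        ((wu₁ t ht).hasDerivAt_contRep (wu₂ t ht) x))).congr_deriv (by rw [hV]; ring)
  have hbound : ∀ t ∈ Ico 0 T, ∀ x,
      ENNReal.ofReal |V t x| ≤ (∫⁻ y, expKernel (x - y) * ENNReal.ofReal (contRep (u t) y ^ 2 +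
        contRep (weakDeriv (u t)) y ^ 2 / 2 + contRep (ρ t) y ^ 2 / 2)) ∧
      ENNReal.ofReal |W t x| ≤ ∫⁻ y, expKernel (x - y) * ENNReal.ofReal (contRep (u t) y ^ 2 +
        contRep (weakDeriv (u t)) y ^ 2 / 2 + contRep (ρ t) y ^ 2 / 2) := by
    intro t ht x
    obtain ⟨B₀, hB₀⟩ := (hut.1 t ht).exists_abs_contRep_le (by linarith)
    obtain ⟨B₁, hB₁⟩ := (cy₁.1 t ht).exists_abs_contRep_le (by linarith)
    have hM0 : 0 ≤ M := (abs_nonneg _).trans (hM t ht 0).1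
    have c0 := (wu t ht).continuous_contRep
    have c1 := (wu₁ t ht).continuous_contRep
    have c2 := (wr t ht).continuous_contRep
    have hB0 : 0 ≤ B₀ := (abs_nonneg _).trans (hB₀ 0)
    have hB1 : 0 ≤ B₁ := (abs_nonneg _).trans (hB₁ 0)
    refine ofReal_abs_le_lintegral_expKernel (B := B₀ + B₁ + 4 * M ^ 2) (by fun_prop)
      (fun y => by positivity) (dV t ht) (dW t ht) (fun z => ?_) (fun z => ?_) x
    · obtain ⟨g0, g1, g2, g3, -⟩ := hM t ht z
      have s0 : contRep (u t) z ^ 2 ≤ M ^ 2 := sq_le_sq' (abs_le.1 g0).1 (abs_le.1 g0).2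
      have s1 : contRep (weakDeriv (u t)) z ^ 2 ≤ M ^ 2 :=
        sq_le_sq' (abs_le.1 g1).1 (abs_le.1 g1).2
      have s3 : contRep (ρ t) z ^ 2 ≤ M ^ 2 := sq_le_sq' (abs_le.1 g3).1 (abs_le.1 g3).2
      have s2 : |contRep (u t) z * contRep (weakDeriv (weakDeriv (u t))) z| ≤ M ^ 2 := by
        rw [abs_mul, sq]; gcongr
      have s4 := abs_le.1 (hB₁ z)
      rw [abs_le] at s2 ⊢
      simp only [hV]
      constructor <;> nlinarith [sq_nonneg (contRep (u t) z),
        sq_nonneg (contRep (weakDeriv (u t)) z), sq_nonneg (contRep (ρ t) z)]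
    · obtain ⟨g0, g1, -⟩ := hM t ht z
      have s2 : |contRep (u t) z * contRep (weakDeriv (u t)) z| ≤ M ^ 2 := by
        rw [abs_mul, sq]; gcongr
      have s4 := abs_le.1 (hB₀ z)
      rw [abs_le] at s2 ⊢
      simp only [hW]
      constructor <;> nlinarith [sq_nonneg M]
  refine ⟨V, W, kU, kU₁, kU₂, kR, kR₁, ?_, ?_,
    fun t ht => (wu t ht).hasDerivAt_contRep (wu₁ t ht),
    fun t ht => (wu₁ t ht).hasDerivAt_contRep (wu₂ t ht),
    fun t ht => (wr t ht).hasDerivAt_contRep (wr₁ t ht), dV, ?_, ?_, ?_,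
    fun t ht x => (hM t ht x).1, fun t ht x => (hM t ht x).2.1, fun t ht x => (hM t ht x).2.2.1,
    fun t ht x => (hM t ht x).2.2.2.1, fun t ht x => (hM t ht x).2.2.2.2,
    fun t ht x => (hbound t ht x).1, fun t ht x => (hbound t ht x).2⟩
  · exact ((kY₁.add (kU₁.pow 2)).add (kU.mul kU₂)).sub
      (((kU.pow 2).add ((kU₁.pow 2).div_const 2)).add ((kR.pow 2).div_const 2))
  · exact kY.add (kU.mul kU₁)
  · intro t ht x
    refine ((hdu.hasDerivWithinAt_contRep (by linarith) mu hut.1 (hIco t ht) x).hasDerivAt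
      (hnhds t ht)).congr_deriv ?_
    simp only [hW]; ring
  · intro t ht x
    refine ((hdu₁.hasDerivWithinAt_contRep (by linarith) (fun t ht => (mu t ht).weakDeriv
      (by linarith)) cy₁.1 (hIco t ht) x).hasDerivAt (hnhds t ht)).congr_deriv ?_
    simp only [hV]; ring
  · intro t ht x
    have ht' := hIco t ht
    refine ((hdρ.hasDerivWithinAt_contRep (by linarith) mr hρt.1 ht' x).hasDerivAt
      (hnhds t ht)).congr_deriv ?_
    have dprod := fun x => ((wr t ht').hasDerivAt_contRep (wr₁ t ht') x).mul
      ((wu t ht').hasDerivAt_contRep (wu₁ t ht') x)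
    have hc : Continuous fun x => contRep (weakDeriv (ρ t)) x * contRep (u t) x +
        contRep (ρ t) x * contRep (weakDeriv (u t)) x :=
      ((wr₁ t ht').continuous_contRep.mul (wu t ht').continuous_contRep).add
        ((wr t ht').continuous_contRep.mul (wu₁ t ht').continuous_contRep)
    have hw := (isWeakDeriv_of_hasDerivAt hc dprod).congr
      (f' := fun y => ρ t y * u t y) ((wr t ht').ae_eq_contRep.mul (wu t ht').ae_eq_contRep).symm
      EventuallyEq.rfl
    -- `-(ρ u)_x` has the continuous representative `-(R₁ U + R U₁)`, which is therefore that of `ρ_t`.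
    have e := contRep_eq (f := ρt t) hc.neg (by
      filter_upwards [(heq t ht').2, hw.weakDeriv_ae_eq] with z hz hz'
      rw [hz, hz']; rfl)
    rw [e]
    simp only [Pi.neg_apply]
    ring

/-! ### The weighted bounds -/

/-- A bound almost everywhere holds everywhere for the continuous representative. -/
theorem abs_contRep_le_of_eLpNorm_top_le {f g : ℝ → ℝ} (h : IsWeakDeriv f g) {S : ℝ≥0∞}
    (hS : S ≠ ⊤) (hf : eLpNorm (fun x => 1 * f x) ⊤ volume ≤ S) (x : ℝ) :
    |contRep f x| ≤ S.toReal := by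
  have h1 : ∀ᵐ x, |contRep f x| ≤ S.toReal := by
    rw [eLpNorm_exponent_top] at hf
    filter_upwards [enorm_ae_le_eLpNormEssSup (fun x => 1 * f x) volume, h.ae_eq_contRep]
      with x hx hx'
    have h2 := ENNReal.toReal_mono hS (hx.trans hf)
    rw [one_mul, hx'] at h2
    simpa using h2
  have hcl : IsClosed {x | |contRep f x| ≤ S.toReal} :=
    isClosed_le h.continuous_contRep.abs continuous_const
  have hd : Dense {x | |contRep f x| ≤ S.toReal} := Measure.dense_of_ae h1
  have := hd.closure_eq
  rw [hcl.closure_eq] at this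
  exact (this ▸ mem_univ x : x ∈ {x | |contRep f x| ≤ S.toReal})

/-- Each of the five norms is at most that of the sum `a` of the five absolute values. -/
theorem weightedNorm_le_of_ae_eq {p : ℝ≥0∞} {w f r : ℝ → ℝ} (hw : ∀ x, 0 ≤ w x) {a : ℝ → ℝ≥0∞}
    (ha : ∀ᵐ x, a x = ‖f x‖ₑ + ‖weakDeriv f x‖ₑ + ‖weakDeriv (weakDeriv f) x‖ₑ + ‖r x‖ₑ +
      ‖weakDeriv r x‖ₑ) :
    weightedNorm p w f r ≤ 5 * eLpNorm (fun x => ENNReal.ofReal (w x) * a x) p volume := by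
  have key : ∀ g : ℝ → ℝ, (∀ᵐ x, ‖g x‖ₑ ≤ a x) → eLpNorm (fun x => w x * g x) p volume ≤
      eLpNorm (fun x => ENNReal.ofReal (w x) * a x) p volume := by
    intro g hg
    refine eLpNorm_mono_enorm_ae ?_
    filter_upwards [hg] with x hx
    rw [enorm_mul, enorm_eq_self, ← Real.enorm_of_nonneg (hw x)]
    gcongr
  rw [weightedNorm, show (5 : ℝ≥0∞) = 1 + 1 + 1 + 1 + 1 by norm_num]
  simp only [add_mul, one_mul]
  refine add_le_add (add_le_add (add_le_add (add_le_add ?_ ?_) ?_) ?_) ?_ <;>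
    refine key _ (ha.mono fun x hx => ?_) <;> rw [hx]
  · exact le_add_right (le_add_right (le_add_right le_self_add))
  · exact le_add_right (le_add_right (le_add_right le_add_self))
  · exact le_add_right (le_add_right le_add_self)
  · exact le_add_right le_add_self
  · exact le_add_self

theorem WeightedMemLp.eLpNorm_ne_top {p : ℝ≥0∞} {w f r : ℝ → ℝ} (hw : ∀ x, 0 ≤ w x)
    (h : WeightedMemLp p w f r) {a : ℝ → ℝ≥0∞}
    (ha : ∀ᵐ x, a x = ‖f x‖ₑ + ‖weakDeriv f x‖ₑ + ‖weakDeriv (weakDeriv f) x‖ₑ + ‖r x‖ₑ +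
      ‖weakDeriv r x‖ₑ) :
    eLpNorm (fun x => ENNReal.ofReal (w x) * a x) p volume ≠ ⊤ := by
  obtain ⟨h1, h2, h3, h4, h5⟩ := h
  have e : (fun x => ENNReal.ofReal (w x) * a x) =ᵐ[volume]
      (fun x => ‖w x * f x‖ₑ) + (fun x => ‖w x * weakDeriv f x‖ₑ) +
      (fun x => ‖w x * weakDeriv (weakDeriv f) x‖ₑ) + (fun x => ‖w x * r x‖ₑ) +
      (fun x => ‖w x * weakDeriv r x‖ₑ) := by
    filter_upwards [ha] with x hx
    simp only [Pi.add_apply, enorm_mul, hx, mul_add, Real.enorm_of_nonneg (hw x)]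
  rw [eLpNorm_congr_ae e]
  have hm : ∀ {g : ℝ → ℝ}, MemLp g p volume → MemLp (fun x => ‖g x‖ₑ) p volume := fun hg =>
    hg.enorm
  exact (((((hm h1).add (hm h2)).add (hm h3)).add (hm h4)).add (hm h5)).2.ne

/-- The squared `L²` norm with weight `φ ^ (1 / 2)` is the integral with weight `φ`. -/
theorem eLpNorm_sqrt_weight_sq {φ : ℝ → ℝ} (hφ : ∀ x, 0 < φ x) (a : ℝ → ℝ≥0∞) :
    eLpNorm (fun x => ENNReal.ofReal (φ x ^ (1 / 2 : ℝ)) * a x) 2 volume ^ 2 =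
      ∫⁻ x, ENNReal.ofReal (φ x) * a x ^ 2 := by
  rw [← lintegral_sq_eq_eLpNorm_sq]
  refine lintegral_congr fun x => ?_
  rw [mul_pow, ← ENNReal.ofReal_pow (Real.rpow_nonneg (hφ x).le _), ← Real.sqrt_eq_rpow,
    Real.sq_sqrt (hφ x).le]

end TwoCH

open TwoCH

theorem corollary1 (p : ℝ≥0∞) (hp : 2 ≤ p)
    (φ v : ℝ → ℝ) (hφpos : ∀ x, 0 < φ x)
    (hφac : TwoCH.LocallyAC φ)
    (hvsub : TwoCH.IsSubmultiplicative v) (hφv : TwoCH.IsModerate v φ)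
    (hφderiv : ∃ A > 0, ∀ᵐ x : ℝ, |deriv φ x| ≤ A * |φ x|)
    (hvinf : ∃ δ > 0, ∀ x, δ ≤ v x)
    (hvp : MemLp (fun x : ℝ => v x * Real.exp (-|x|)) p volume)
    (s T : ℝ) (hs : 3 < s) (hT : 0 < T)
    (u₀ ρ₀ : ℝ → ℝ) (u ρ : ℝ → ℝ → ℝ)
    (hsol : TwoCH.IsStrongSolution s T u₀ ρ₀ u ρ)
    (hM : (⨆ t ∈ Ico 0 T, TwoCH.weightedNorm ⊤ (fun _ => 1) (u t) (ρ t)) < ⊤)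
    (hdata_p : TwoCH.WeightedMemLp p φ u₀ ρ₀)
    (hdata_two : TwoCH.WeightedMemLp 2 (fun x => φ x ^ (1 / 2 : ℝ)) u₀ ρ₀) :
    (⨆ t ∈ Ico 0 T, TwoCH.weightedNorm p φ (u t) (ρ t)) < ⊤ ∧
    (⨆ t ∈ Ico 0 T,
      TwoCH.weightedNorm 2 (fun x => φ x ^ (1 / 2 : ℝ)) (u t) (ρ t)) < ⊤ := by
  obtain ⟨A, hA, hφA⟩ := hφderiv
  obtain ⟨c, hc, hφv⟩ := hφv
  obtain ⟨δ, hδ, hvδ⟩ := hvinf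
  have hφexp := le_exp_mul_of_abs_deriv_le hφpos hφac hφA
  have hφcont : Continuous φ := by
    refine continuous_iff_continuousAt.2 fun x => ?_
    have h1 := (hφac (x - 1) (x + 1)).continuousOn
    rw [uIcc_of_le (by linarith)] at h1
    exact h1.continuousAt (Icc_mem_nhds (by linarith) (by linarith))
  have cu := hsol.cont_u
  have cu₁ := cu.weakDeriv (by linarith)
  have cu₂ := cu₁.weakDeriv (by linarith)
  have cr := hsol.cont_rho
  have cr₁ := cr.weakDeriv (by linarith)
  have wu := fun t ht => (cu.1 t ht).isWeakDeriv (by linarith)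
  have wu₁ := fun t ht => (cu₁.1 t ht).isWeakDeriv (by linarith)
  have wu₂ := fun t ht => (cu₂.1 t ht).isWeakDeriv (by linarith)
  have wr := fun t ht => (cr.1 t ht).isWeakDeriv (by linarith)
  have wr₁ := fun t ht => (cr₁.1 t ht).isWeakDeriv (by linarith)
  set S := ⨆ t ∈ Ico 0 T, weightedNorm ⊤ (fun _ => 1) (u t) (ρ t) with hS
  have hSt : ∀ t ∈ Ico 0 T, weightedNorm ⊤ (fun _ => 1) (u t) (ρ t) ≤ S := fun t ht =>
    le_iSup₂ (f := fun t (_ : t ∈ Ico 0 T) => weightedNorm ⊤ (fun _ => 1) (u t) (ρ t)) t ht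
  obtain ⟨V, W, hcl⟩ := hsol.isClassicalSolution (M := S.toReal) hs fun t ht x => by
    have h0 := hSt t ht
    rw [weightedNorm] at h0
    refine ⟨abs_contRep_le_of_eLpNorm_top_le (wu t ht) hM.ne (le_trans ?_ h0) x,
      abs_contRep_le_of_eLpNorm_top_le (wu₁ t ht) hM.ne (le_trans ?_ h0) x,
      abs_contRep_le_of_eLpNorm_top_le (wu₂ t ht) hM.ne (le_trans ?_ h0) x,
      abs_contRep_le_of_eLpNorm_top_le (wr t ht) hM.ne (le_trans ?_ h0) x,
      abs_contRep_le_of_eLpNorm_top_le (wr₁ t ht) hM.ne (le_trans ?_ h0) x⟩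
    · exact le_add_right (le_add_right (le_add_right le_self_add))
    · exact le_add_right (le_add_right (le_add_right le_add_self))
    · exact le_add_right (le_add_right le_add_self)
    · exact le_add_right le_add_self
    · exact le_add_self
  have hM0 : 0 ≤ S.toReal := ENNReal.toReal_nonneg
  obtain ⟨X, K, C, hK, hX, hXD, hmap, hest⟩ := hcl.exists_transport_estimate hM0 hT
  set a := solENorm T (fun t => contRep (u t)) (fun t => contRep (weakDeriv (u t)))
    (fun t => contRep (weakDeriv (weakDeriv (u t)))) (fun t => contRep (ρ t))
    (fun t => contRep (weakDeriv (ρ t))) with ha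
  have hae : ∀ t ∈ Ico 0 T, ∀ᵐ x, a t x = ‖u t x‖ₑ + ‖weakDeriv (u t) x‖ₑ +
      ‖weakDeriv (weakDeriv (u t)) x‖ₑ + ‖ρ t x‖ₑ + ‖weakDeriv (ρ t) x‖ₑ := by
    intro t ht
    filter_upwards [(wu t ht).ae_eq_contRep, (wu₁ t ht).ae_eq_contRep, (wu₂ t ht).ae_eq_contRep,
      (wr t ht).ae_eq_contRep, (wr₁ t ht).ae_eq_contRep] with x h1 h2 h3 h4 h5
    rw [h1, h2, h3, h4, h5, ha, solENorm_of_mem ht, solSize, ENNReal.ofReal_add (by positivity)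
      (abs_nonneg _), ENNReal.ofReal_add (by positivity) (abs_nonneg _),
      ENNReal.ofReal_add (by positivity) (abs_nonneg _),
      ENNReal.ofReal_add (by positivity) (abs_nonneg _)]
    simp only [Real.enorm_eq_ofReal_abs]
  have h0mem : (0 : ℝ) ∈ Ico 0 T := ⟨le_rfl, hT⟩
  have hae0 := hae 0 h0mem
  rw [hsol.init_u, hsol.init_rho] at hae0
  have hsqrt0 : ∀ x, 0 ≤ φ x ^ (1 / 2 : ℝ) := fun x => Real.rpow_nonneg (hφpos x).le _
  have hinit2 : ∫⁻ x, ENNReal.ofReal (φ x) * a 0 x ^ 2 ≠ ⊤ := by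
    rw [← eLpNorm_sqrt_weight_sq hφpos]
    exact ENNReal.pow_ne_top (hdata_two.eLpNorm_ne_top hsqrt0 hae0)
  obtain ⟨Q, hQ⟩ := exists_lintegral_weight_mul_sq_le hp hφpos hφcont.measurable hφexp hc hδ hvδ
    hφv hvp hcl.measurable_solENorm hcl.solENorm_le hX (mul_nonneg hM0 hT.le) hXD hK hmap hest
    hinit2
  obtain ⟨Q', hQ'⟩ := exists_eLpNorm_weight_mul_le hp hφpos hφcont.measurable hA.le hφexp hc
    (fun x => hδ.le.trans (hvδ x)) hφv hvp hcl.measurable_solENorm hX hXD hK hmap hest hQ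
    (hdata_p.eLpNorm_ne_top (fun x => (hφpos x).le) hae0)
  constructor
  · refine (iSup₂_le fun t ht => (weightedNorm_le_of_ae_eq (fun x => (hφpos x).le)
      (hae t ht)).trans (mul_le_mul_right (hQ' t ht) 5)).trans_lt
      (ENNReal.mul_lt_top (by norm_num) ENNReal.coe_lt_top)
  · -- The square of the norm is at most `Q`, hence the norm is at most `Q + 1`.
    have h2 : ∀ t ∈ Ico 0 T, eLpNorm (fun x => ENNReal.ofReal (φ x ^ (1 / 2 : ℝ)) * a t x) 2
        volume ≤ Q + 1 := by
      intro t ht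
      refine (ENNReal.pow_le_pow_left_iff two_ne_zero).1 ?_
      rw [eLpNorm_sqrt_weight_sq hφpos]
      refine (hQ t ht).trans ?_
      calc (Q : ℝ≥0∞) ≤ Q + 1 := le_self_add
        _ ≤ ((Q : ℝ≥0∞) + 1) ^ 2 := le_self_pow₀ le_add_self two_ne_zero
    refine (iSup₂_le fun t ht => (weightedNorm_le_of_ae_eq hsqrt0
      (hae t ht)).trans (mul_le_mul_right (h2 t ht) 5)).trans_lt
      (ENNReal.mul_lt_top (by norm_num) (ENNReal.add_lt_top.2 ⟨ENNReal.coe_lt_top, by norm_num⟩))
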